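/- **Universality Lemma.** Let $\mathbb K=\mathbb R$ ($\beta=1$) or $\mathbb K=\mathbb C$ ($\beta=2$), and let $N\ge 3$, $d\ge 2$, $n=d^2$, $m=d^N$. Consider an open chain of $N$ sites of dimension $d$ with bonds $l=1,\dots,N-1$, where bond $l$ joins the sites $l$ and $l+1$. To each bond is attached a random diagonal $n\times n$ matrix $\Lambda_l$ of real local eigenvalues. The $\Lambda_l$ are independent; those with $l$ odd have a common law $\nu_{\rm odd}$ and those with $l$ even have a common law $\nu_{\rm even}$ (the two laws may differ). Assume that, under each of these two laws, the eigenvalues are permutation invariant (it suffices that their first and second moments are invariant under permutations of the $n$ eigenvalues), have finite fourth moments, and are not almost surely all equal to each other. Put $$A=\sum_{l\ \rm odd}\mathbb I\otimes\Lambda_l\otimes\mathbb I,\qquad B=\sum_{l\ \rm even}\mathbb I\otimes\Lambda_l\otimes\mathbb I .$$ Independently of the eigenvalues, let $\Pi$ be a uniformly random $m\times m$ permutation matrix, let $Q$ be a Haar distributed $m\times m$ orthogonal ($\beta=1$) or unitary ($\beta=2$) matrix, and let $Q_q=Q^{(B)}\bigl(Q^{(A)}\bigr)^{-1}$, where $Q^{(A)}$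 (resp. $Q^{(B)}$) is the tensor product of the matrices $Q_l$ over the odd (resp. even) bonds $l$, with the identity on the uncovered sites, and the $Q_l$ are independent Haar orthogonal/unitary matrices of size $n$. Thus $A+Q_q^{-1}BQ_q$ is, up to a unitary change of basis, the Hamiltonian $\sum_l \mathbb I\otimes Q_l^{-1}\Lambda_lQ_l\otimes\mathbb I$. For a random Hermitian $m\times m$ matrix $M$ let $m_j=\frac1m\mathbb E\,\mathrm{Tr}\,M^j$, let $\sigma^2=m_2-m_1^2$, and let its kurtosis be $\gamma_2=\kappa_4/\sigma^4$, where $\kappa_4$ is the fourth cumulant of the distribution with moments $m_j$. Let $\gamma_2^{c},\gamma_2^{iso},\gamma_2^{q}$ be the kurtoses of $A+\Pi^{-1}B\Pi$, $A+Q^{-1}BQ$ and $A+Q_q^{-1}BQ_q$. Then $\gamma_2^c\ne\gamma_2^{iso}$, the interpolation parameter $$p=\frac{\gamma_2^q-\gamma_2^{iso}}{\gamma_2^c-\gamma_2^{iso}}$$ depends only on $N$, $d$ and $\beta$ (not on $\nu_{\rm odd},\nu_{\rm even}$), and $$1-p=\frac{\mathbb E\,\mathrm{Tr}(A\Pi^{-1}B\Pi)^2-\mathbb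 E\,\mathrm{Tr}(AQ_q^{-1}BQ_q)^2}{\mathbb E\,\mathrm{Tr}(A\Pi^{-1}B\Pi)^2-\mathbb E\,\mathrm{Tr}(AQ^{-1}BQ)^2},$$ where the denominator is non-zero. Moreover, if $N=2k+1$ is odd, then $$1-p=\frac{d(2k-1)\,\mathbb E\bigl(\|uv\|_F^2-\|uv(uv)^\dagger\|_F^2\bigr)}{\Bigl(\frac{km(n-1)}{n(m-1)}\Bigr)^2\bigl(1-m\,\mathbb E|q_{ij}|^4\bigr)} .$$ Here $q_{ij}$ is any entry of $Q$, and $u$, $v$ are the $d\times d$ coefficient matrices, in the product basis, of any chosen column of $Q_1^{-1}$ and any chosen column of $Q_2^{-1}$ (an eigenvector of each of two neighbouring local terms $Q_l^{-1}\Lambda_lQ_l$). -/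

import Mathlib

open MeasureTheory Matrix

noncomputable section

namespace SpinChain

/-! ## Haar measure on the orthogonal and unitary groups

For `𝕜 = ℝ` (`β = 1`) the group `Matrix.unitaryGroup ι ℝ` is the orthogonal group, for `𝕜 = ℂ`
(`β = 2`) it is the unitary group. -/

section Haar

variable {ι 𝕜 : Type*} [Fintype ι] [DecidableEq ι] [RCLike 𝕜]

instance instCompactSpaceUnitary : CompactSpace (Matrix.unitaryGroup ι 𝕜) := by
  have hcpt : IsCompact {M : Matrix ι ι 𝕜 | ∀ i j, M i j ∈ Metric.closedBall (0 : 𝕜) 1} := by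
    have h := isCompact_univ_pi (X := fun _ : ι => ι → 𝕜)
      (s := fun _ => Set.univ.pi fun _ : ι => Metric.closedBall (0 : 𝕜) 1)
      fun _ => isCompact_univ_pi fun _ => isCompact_closedBall (0 : 𝕜) 1
    have h2 : {M : Matrix ι ι 𝕜 | ∀ i j, M i j ∈ Metric.closedBall (0 : 𝕜) 1} =
        Set.univ.pi fun _ : ι => Set.univ.pi fun _ : ι => Metric.closedBall (0 : 𝕜) 1 := by
      ext M
      exact ⟨fun h i _ j _ => h i j, fun h i j => h i trivial j trivial⟩
    rw [h2]
    exact h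
  refine isCompact_iff_compactSpace.mp (hcpt.of_isClosed_subset ?_ ?_)
  · exact isClosed_unitary (R := Matrix ι ι 𝕜)
  · intro U hU i j
    simpa using entry_norm_bound_of_unitary hU i j

instance instMeasurableSpaceUnitary : MeasurableSpace (Matrix.unitaryGroup ι 𝕜) := borel _

instance instBorelSpaceUnitary : BorelSpace (Matrix.unitaryGroup ι 𝕜) := ⟨rfl⟩

variable (ι 𝕜) in
/-- The Haar probability measure on the orthogonal (`𝕜 = ℝ`) or unitary (`𝕜 = ℂ`) group. -/
def haar : Measure (Matrix.unitaryGroup ι 𝕜) := Measure.haarMeasure ⊤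

instance instIsProbabilityMeasureHaar : IsProbabilityMeasure (haar ι 𝕜) :=
  ⟨by simpa [haar] using Measure.haarMeasure_self (K₀ := (⊤ :
    TopologicalSpace.PositiveCompacts (Matrix.unitaryGroup ι 𝕜)))⟩

instance instIsHaarMeasureHaar : (haar ι 𝕜).IsHaarMeasure := by
  unfold haar; infer_instance

end Haar

/-! ## The uniform measure on permutations -/

instance instMeasurableSpacePerm {α : Type*} : MeasurableSpace (Equiv.Perm α) := ⊤

/-- The uniform probability measure on the permutations of a finite type. -/
def uniformPerm (α : Type*) [Fintype α] [DecidableEq α] : Measure (Equiv.Perm α) :=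
  (PMF.uniformOfFintype (Equiv.Perm α)).toMeasure

/-! ## The chain

Sites are `Fin N`, each with `d` levels; the computational basis of the whole space is indexed by
`Fin N → Fin d`.  The bond `l : Fin (N - 1)` joins the sites `l` and `l + 1` (counted from `0`), so
that the odd bonds `1, 3, 5, …` of the chain (counted from `1`) are those with `l` even here. -/

section Chain

variable {N d : ℕ} {𝕜 : Type*} [RCLike 𝕜]

/-- Left end of a bond. -/
def left (l : Fin (N - 1)) : Fin N := ⟨l.1, by have := l.2; omega⟩

/-- Right end of a bond. -/
def right (l : Fin (N - 1)) : Fin N := ⟨l.1 + 1, by have := l.2; omega⟩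

/-- The restriction of a configuration to the two ends of a bond. -/
def atBond (x : Fin N → Fin d) (l : Fin (N - 1)) : Fin d × Fin d := (x (left l), x (right l))

/-- First, third, fifth, … bond. -/
def oddBonds (N : ℕ) : Finset (Fin (N - 1)) := Finset.univ.filter fun l => Even l.1

/-- Second, fourth, sixth, … bond. -/
def evenBonds (N : ℕ) : Finset (Fin (N - 1)) := Finset.univ.filter fun l => ¬ Even l.1

/-- Local eigenvalues: `d ^ 2` real numbers for each bond. -/
abbrev LocalEigenvalues (N d : ℕ) : Type := Fin (N - 1) → Fin d × Fin d → ℝ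

/-- Local eigenvector matrices: an orthogonal or unitary matrix of size `d ^ 2` for each bond. -/
abbrev LocalUnitaries (N d : ℕ) (𝕜 : Type*) [RCLike 𝕜] : Type _ :=
  Fin (N - 1) → Matrix.unitaryGroup (Fin d × Fin d) 𝕜

/-- The diagonal matrix `∑_{l ∈ S} 𝕀 ⊗ Λ_l ⊗ 𝕀` of size `d ^ N`. -/
def diagSum (𝕜 : Type*) [RCLike 𝕜] (S : Finset (Fin (N - 1))) (Λ : LocalEigenvalues N d) :
    Matrix (Fin N → Fin d) (Fin N → Fin d) 𝕜 :=
  Matrix.diagonal fun x => ((∑ l ∈ S, Λ l (atBond x l) : ℝ) : 𝕜)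

/-- `A`: the locally diagonalized sum of the odd terms. -/
def matA (𝕜 : Type*) [RCLike 𝕜] (Λ : LocalEigenvalues N d) :
    Matrix (Fin N → Fin d) (Fin N → Fin d) 𝕜 := diagSum 𝕜 (oddBonds N) Λ

/-- `B`: the locally diagonalized sum of the even terms. -/
def matB (𝕜 : Type*) [RCLike 𝕜] (Λ : LocalEigenvalues N d) :
    Matrix (Fin N → Fin d) (Fin N → Fin d) 𝕜 := diagSum 𝕜 (evenBonds N) Λ

/-- For pairwise disjoint bonds `S`, the tensor product of the matrices `Q l`, `l ∈ S`, and of the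
identity on every site that belongs to no bond of `S`. -/
def bondTensor (S : Finset (Fin (N - 1))) (Q : LocalUnitaries N d 𝕜) :
    Matrix (Fin N → Fin d) (Fin N → Fin d) 𝕜 :=
  Matrix.of fun x y =>
    (∏ l ∈ S, (Q l : Matrix (Fin d × Fin d) (Fin d × Fin d) 𝕜) (atBond x l) (atBond y l)) *
      if ∀ s : Fin N, (∀ l ∈ S, s ≠ left l ∧ s ≠ right l) → x s = y s then 1 else 0

/-- `Q_q = Q^{(B)} (Q^{(A)})⁻¹`, so that `A + Q_q⁻¹ B Q_q` is the Hamiltonian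
`H_odd + H_even = (Q^{(A)})⁻¹ A Q^{(A)} + (Q^{(B)})⁻¹ B Q^{(B)}`, with local terms
`H^{(l)} = Q_l⁻¹ Λ_l Q_l`, in a basis that diagonalizes `H_odd`. -/
def matQq (Q : LocalUnitaries N d 𝕜) : Matrix (Fin N → Fin d) (Fin N → Fin d) 𝕜 :=
  bondTensor (evenBonds N) Q * (bondTensor (oddBonds N) Q)ᴴ

/-! ### The three sums

In each case the sum is `A + B'`, where `B'` is a random conjugate of `B`. -/

/-- `Π⁻¹ B Π` for a permutation matrix `Π`. -/
def classicalB (𝕜 : Type*) [RCLike 𝕜]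
    (ω : LocalEigenvalues N d × Equiv.Perm (Fin N → Fin d)) :
    Matrix (Fin N → Fin d) (Fin N → Fin d) 𝕜 :=
  (ω.2.permMatrix 𝕜)ᵀ * matB 𝕜 ω.1 * ω.2.permMatrix 𝕜

/-- `Q⁻¹ B Q` for an orthogonal or unitary matrix `Q` of size `d ^ N`. -/
def isoB (ω : LocalEigenvalues N d × Matrix.unitaryGroup (Fin N → Fin d) 𝕜) :
    Matrix (Fin N → Fin d) (Fin N → Fin d) 𝕜 :=
  (ω.2 : Matrix (Fin N → Fin d) (Fin N → Fin d) 𝕜)ᴴ * matB 𝕜 ω.1 *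
    (ω.2 : Matrix (Fin N → Fin d) (Fin N → Fin d) 𝕜)

/-- `Q_q⁻¹ B Q_q`. -/
def quantumB (ω : LocalEigenvalues N d × LocalUnitaries N d 𝕜) :
    Matrix (Fin N → Fin d) (Fin N → Fin d) 𝕜 :=
  (matQq ω.2)ᴴ * matB 𝕜 ω.1 * matQq ω.2

/-- The law of the local eigenvalues: independent bonds, with the law `νo` on every odd bond and
the law `νe` on every even bond. -/
def eigLaw (N : ℕ) (νo νe : Measure (Fin d × Fin d → ℝ)) : Measure (LocalEigenvalues N d) :=
  Measure.pi fun l => if Even l.1 then νo else νe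

/-- Eigenvalues, and an independent uniform permutation. -/
def classicalLaw (N : ℕ) (νo νe : Measure (Fin d × Fin d → ℝ)) :
    Measure (LocalEigenvalues N d × Equiv.Perm (Fin N → Fin d)) :=
  (eigLaw N νo νe).prod (uniformPerm (Fin N → Fin d))

/-- Eigenvalues, and an independent Haar matrix of size `d ^ N`. -/
def isoLaw (𝕜 : Type*) [RCLike 𝕜] (N : ℕ) (νo νe : Measure (Fin d × Fin d → ℝ)) :
    Measure (LocalEigenvalues N d × Matrix.unitaryGroup (Fin N → Fin d) 𝕜) :=
  (eigLaw N νo νe).prod (haar (Fin N → Fin d) 𝕜)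

/-- Eigenvalues, and an independent family of independent Haar matrices of size `d ^ 2`. -/
def quantumLaw (𝕜 : Type*) [RCLike 𝕜] (N : ℕ) (νo νe : Measure (Fin d × Fin d → ℝ)) :
    Measure (LocalEigenvalues N d × LocalUnitaries N d 𝕜) :=
  (eigLaw N νo νe).prod (Measure.pi fun _ => haar (Fin d × Fin d) 𝕜)

end Chain

/-! ## Moments and kurtosis of the expected eigenvalue distribution -/

section Moments

variable {Ω ι 𝕜 : Type*} [MeasurableSpace Ω] [Fintype ι] [DecidableEq ι] [RCLike 𝕜]

/-- `𝔼 Tr M` for a random matrix with real trace. -/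
def expTrace (P : Measure Ω) (M : Ω → Matrix ι ι 𝕜) : ℝ := ∫ ω, RCLike.re (M ω).trace ∂P

/-- The `j`-th moment `(1 / m) 𝔼 Tr M ^ j` of the expected eigenvalue distribution of a random
Hermitian matrix of size `m`. -/
def specMoment (P : Measure Ω) (M : Ω → Matrix ι ι 𝕜) (j : ℕ) : ℝ :=
  (Fintype.card ι : ℝ)⁻¹ * expTrace P fun ω => M ω ^ j

/-- The variance `σ²` of the expected eigenvalue distribution. -/
def specVariance (P : Measure Ω) (M : Ω → Matrix ι ι 𝕜) : ℝ :=
  specMoment P M 2 - specMoment P M 1 ^ 2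

/-- The fourth central moment of the expected eigenvalue distribution. -/
def specCentralFour (P : Measure Ω) (M : Ω → Matrix ι ι 𝕜) : ℝ :=
  specMoment P M 4 - 4 * specMoment P M 1 * specMoment P M 3
    + 6 * specMoment P M 1 ^ 2 * specMoment P M 2 - 3 * specMoment P M 1 ^ 4

/-- The kurtosis `γ₂ = κ₄ / σ⁴ = (fourth central moment) / σ⁴ - 3` of the expected eigenvalue
distribution. -/
def kurtosis (P : Measure Ω) (M : Ω → Matrix ι ι 𝕜) : ℝ :=
  specCentralFour P M / specVariance P M ^ 2 - 3

end Moments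

section Interpolation

variable (𝕜 : Type*) [RCLike 𝕜] (N : ℕ) {d : ℕ} (νo νe : Measure (Fin d × Fin d → ℝ))

/-- The kurtosis of the classical sum `A + Π⁻¹ B Π`. -/
def kurtosisClassical : ℝ :=
  kurtosis (classicalLaw N νo νe) fun ω => matA 𝕜 ω.1 + classicalB 𝕜 ω

/-- The kurtosis of the isotropic sum `A + Q⁻¹ B Q`. -/
def kurtosisIso : ℝ := kurtosis (isoLaw 𝕜 N νo νe) fun ω => matA 𝕜 ω.1 + isoB ω

/-- The kurtosis of the quantum sum `A + Q_q⁻¹ B Q_q`. -/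
def kurtosisQuantum : ℝ := kurtosis (quantumLaw 𝕜 N νo νe) fun ω => matA 𝕜 ω.1 + quantumB ω

/-- The interpolation parameter `p`, which solves `γ₂^q = p γ₂^c + (1 - p) γ₂^iso`. -/
def interpolation : ℝ :=
  (kurtosisQuantum 𝕜 N νo νe - kurtosisIso 𝕜 N νo νe) /
    (kurtosisClassical 𝕜 N νo νe - kurtosisIso 𝕜 N νo νe)

/-- `𝔼 Tr (A Π⁻¹ B Π)²`. -/
def departClassical : ℝ :=
  expTrace (classicalLaw N νo νe) fun ω => (matA 𝕜 ω.1 * classicalB 𝕜 ω) ^ 2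

/-- `𝔼 Tr (A Q⁻¹ B Q)²`. -/
def departIso : ℝ := expTrace (isoLaw 𝕜 N νo νe) fun ω => (matA 𝕜 ω.1 * isoB ω) ^ 2

/-- `𝔼 Tr (A Q_q⁻¹ B Q_q)²`. -/
def departQuantum : ℝ := expTrace (quantumLaw 𝕜 N νo νe) fun ω => (matA 𝕜 ω.1 * quantumB ω) ^ 2

end Interpolation

/-! ## Assumptions on the local eigenvalues -/

section Local

variable {ι : Type*}

/-- Permutation invariance in the sense of expectations: the first and second moments of the
eigenvalues do not change when the eigenvalues are permuted. -/
def PermutationInvariant (ν : Measure (ι → ℝ)) : Prop :=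
  ∀ σ : Equiv.Perm ι, (∀ i, ∫ x, x (σ i) ∂ν = ∫ x, x i ∂ν) ∧
    ∀ i j, ∫ x, x (σ i) * x (σ j) ∂ν = ∫ x, x i * x j ∂ν

/-- Eigenvalues whose joint law is permutation invariant are permutation invariant in the sense
of expectations. -/
theorem PermutationInvariant.of_map {ν : Measure (ι → ℝ)}
    (h : ∀ σ : Equiv.Perm ι, ν.map (fun x i => x (σ i)) = ν) : PermutationInvariant ν := by
  intro σ
  have hm : Measurable (fun (x : ι → ℝ) i => x (σ i)) :=
    measurable_pi_lambda _ fun i => measurable_pi_apply _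
  refine ⟨fun i => ?_, fun i j => ?_⟩
  · conv_rhs => rw [← h σ]
    rw [integral_map hm.aemeasurable (measurable_pi_apply i).aestronglyMeasurable]
  · conv_rhs => rw [← h σ]
    have hij : Measurable fun x : ι → ℝ => x i * x j :=
      (measurable_pi_apply i).mul (measurable_pi_apply j)
    rw [integral_map hm.aemeasurable hij.aestronglyMeasurable]

/-- Admissible laws of the `d ^ 2` eigenvalues of a local term: permutation invariant, with finite
fourth moments, and not almost surely all equal (the local term is not a random multiple of the
identity). -/
structure IsLocalLaw (ν : Measure (ι → ℝ)) : Prop where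
  isProbabilityMeasure : IsProbabilityMeasure ν
  memLp : ∀ i, MemLp (fun x : ι → ℝ => x i) 4 ν
  permutationInvariant : PermutationInvariant ν
  nondegenerate : ¬ ∀ᵐ x ∂ν, ∀ i j, x i = x j

end Local

/-! ## The universal quantities -/

section Universal

variable {𝕜 : Type*} [RCLike 𝕜]

/-- The square of the Frobenius norm. -/
def frobSq {ι : Type*} [Fintype ι] (M : Matrix ι ι 𝕜) : ℝ := ∑ i, ∑ j, ‖M i j‖ ^ 2

/-- The `i`-th eigenvector `∑ u_{a b} |a⟩|b⟩` of `Q⁻¹ Λ Q`, that is the `i`-th column of `Q⁻¹`, as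
the `d × d` matrix `u` of its coefficients. -/
def eigenvectorMatrix {d : ℕ} (Q : Matrix.unitaryGroup (Fin d × Fin d) 𝕜) (i : Fin d × Fin d) :
    Matrix (Fin d) (Fin d) 𝕜 :=
  Matrix.of fun a b => (Q : Matrix (Fin d × Fin d) (Fin d × Fin d) 𝕜)ᴴ (a, b) i

/-- `𝔼 (‖u v‖_F² - ‖u v (u v)†‖_F²)`, where `u` and `v` are the coefficient matrices of the `i`-th
and the `j`-th eigenvector of two independent local terms with Haar eigenvectors. -/
def uvExpectation (𝕜 : Type*) [RCLike 𝕜] {d : ℕ} (i j : Fin d × Fin d) : ℝ :=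
  ∫ ω : Matrix.unitaryGroup (Fin d × Fin d) 𝕜 × Matrix.unitaryGroup (Fin d × Fin d) 𝕜,
    (frobSq (eigenvectorMatrix ω.1 i * eigenvectorMatrix ω.2 j) -
      frobSq (eigenvectorMatrix ω.1 i * eigenvectorMatrix ω.2 j *
        (eigenvectorMatrix ω.1 i * eigenvectorMatrix ω.2 j)ᴴ))
    ∂((haar (Fin d × Fin d) 𝕜).prod (haar (Fin d × Fin d) 𝕜))

/-- `𝔼 |q_{a b}|⁴` for an entry of a Haar matrix of size `d ^ N`. -/
def entryFourth (𝕜 : Type*) [RCLike 𝕜] {N d : ℕ} (a b : Fin N → Fin d) : ℝ :=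
  ∫ Q : Matrix.unitaryGroup (Fin N → Fin d) 𝕜,
    ‖(Q : Matrix (Fin N → Fin d) (Fin N → Fin d) 𝕜) a b‖ ^ 4 ∂(haar (Fin N → Fin d) 𝕜)

end Universal

end SpinChain

end

/-! Write B' = V⁻¹BV, where V is Π, Q or Q_q, and let a, b be the eigenvalues of A and B. Up to
cyclic rotation, every word of length at most three in A and B' is A^i B'^j, and at length four the
only exceptions are AB'AB' and B'AB'A. The trace of A^i B'^j sees V only through |V_zx|², whose mean
is 1/m in all three models (`IsMixing`). Hence the three kurtoses are one and the same affine
function, of slope 2/(mσ⁴) > 0, of 𝔼 Tr(AB')² (`kurtosis_eq`, `convMoment_variance_pos`).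

By independence, 𝔼 Tr(AB')² is the sum over x, y, z, w of 𝔼(a_x a_y) 𝔼(b_z b_w) times a quartic
moment of V. Permutation invariance forces 𝔼(a_x a_y) = K + δ·`agree` x y, where δ > 0 by
nondegeneracy, and likewise for b. The terms containing K or K' collapse by unitarity, so 𝔼 Tr(AB')²
= C + δδ'·`coupling`, and `coupling` knows nothing of the eigenvalues (`IsMixing.expTrace_sq_eq`).
In the ratio defining p the constants cancel and δδ' divides out: this is the universality.

It remains to compare three couplings. For Π every pair of an odd and an even bond contributes m.
For Q, invariance under permutations of rows and of columns together with the unitarity relations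
expresses every quartic moment needed by 𝔼|q|⁴ (`haarQuartic_eq`); strictness comes from m𝔼|q|⁴ < 1.
For Q_q, `agree` is a sum of rank-one indicators, so that the coupling is a sum over pairs of bonds
of traces of (PR)², with P and R local eigenprojections (`sum_agree_mul_eq`, `trace_sq_matQq`).
Disjoint bonds commute and again contribute m. The N − 2 neighbouring pairs live on three sites,
where the trace is ‖ūv(ūv)†‖_F²; the conjugation is absorbed by Haar measure, and the sum of ‖ūv‖_F²
over all pairs of eigenvectors is exactly d³. Thus each neighbouring pair lowers the coupling by
m·d·𝔼(‖uv‖² − ‖uv(uv)†‖²) (`coupling_matQq`). -/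

noncomputable section

namespace SpinChain

open scoped Kronecker

/-! ## Invariances of the Haar measure -/

section HaarInvariance

variable {ι 𝕜 : Type*} [Fintype ι] [DecidableEq ι] [RCLike 𝕜]

instance instSecondCountableTopologyUnitary :
    SecondCountableTopology (Matrix.unitaryGroup ι 𝕜) := by
  have : SecondCountableTopology (Matrix ι ι 𝕜) :=
    inferInstanceAs (SecondCountableTopology (ι → ι → 𝕜))
  exact TopologicalSpace.Subtype.secondCountableTopology _

/-- Right translation turns a left Haar probability measure into another one, and such a measure is
unique. -/
instance instIsMulRightInvariantHaar : (haar ι 𝕜).IsMulRightInvariant := by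
  refine ⟨fun g => ?_⟩
  have : IsProbabilityMeasure (Measure.map (fun x => x * g) (haar ι 𝕜)) :=
    Measure.isProbabilityMeasure_map (measurable_mul_const g).aemeasurable
  have : (Measure.map (fun x => x * g) (haar ι 𝕜)).IsHaarMeasure := inferInstance
  exact Measure.isHaarMeasure_eq_of_isProbabilityMeasure _ _

theorem map_conj_mem_unitaryGroup (Q : Matrix.unitaryGroup ι 𝕜) :
    (Q : Matrix ι ι 𝕜).map (starRingEnd 𝕜) ∈ Matrix.unitaryGroup ι 𝕜 := by
  have h := Matrix.mem_unitaryGroup_iff.mp Q.2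
  rw [Matrix.mem_unitaryGroup_iff]
  ext i j
  have h2 := congrArg (starRingEnd 𝕜) (congrFun (congrFun h i) j)
  simpa [Matrix.mul_apply, Matrix.one_apply, apply_ite] using h2

/-- Entrywise complex conjugation, as an automorphism of the unitary group. -/
def conjUnitary : Matrix.unitaryGroup ι 𝕜 ≃* Matrix.unitaryGroup ι 𝕜 where
  toFun Q := ⟨(Q : Matrix ι ι 𝕜).map (starRingEnd 𝕜), map_conj_mem_unitaryGroup Q⟩
  invFun Q := ⟨(Q : Matrix ι ι 𝕜).map (starRingEnd 𝕜), map_conj_mem_unitaryGroup Q⟩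
  left_inv Q := by ext; simp
  right_inv Q := by ext; simp
  map_mul' Q R := by ext i j; simp [Matrix.mul_apply]

@[simp]
theorem conjUnitary_apply (Q : Matrix.unitaryGroup ι 𝕜) (i j : ι) :
    (conjUnitary Q : Matrix ι ι 𝕜) i j = starRingEnd 𝕜 ((Q : Matrix ι ι 𝕜) i j) := rfl

theorem continuous_entry (i j : ι) :
    Continuous fun Q : Matrix.unitaryGroup ι 𝕜 => (Q : Matrix ι ι 𝕜) i j :=
  continuous_subtype_val.matrix_elem i j

theorem continuous_conjUnitary : Continuous (conjUnitary : Matrix.unitaryGroup ι 𝕜 → _) := by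
  refine Continuous.subtype_mk ?_ _
  exact continuous_matrix fun i j => RCLike.continuous_conj.comp (continuous_entry i j)

/-- The trace over three sites produces ūv instead of uv; this invariance removes the bar. -/
theorem measurePreserving_conjUnitary :
    MeasurePreserving (conjUnitary : Matrix.unitaryGroup ι 𝕜 → _) (haar ι 𝕜) (haar ι 𝕜) := by
  have hm : Measurable (conjUnitary : Matrix.unitaryGroup ι 𝕜 → _) :=
    continuous_conjUnitary.measurable
  refine ⟨hm, ?_⟩
  have : IsProbabilityMeasure (Measure.map (conjUnitary : Matrix.unitaryGroup ι 𝕜 → _)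
      (haar ι 𝕜)) := Measure.isProbabilityMeasure_map hm.aemeasurable
  have : (Measure.map (conjUnitary : Matrix.unitaryGroup ι 𝕜 → _) (haar ι 𝕜)).IsHaarMeasure :=
    MulEquiv.isHaarMeasure_map (haar ι 𝕜) conjUnitary continuous_conjUnitary
      continuous_conjUnitary
  exact Measure.isHaarMeasure_eq_of_isProbabilityMeasure _ _

/-- The unitary matrix that moves row `σ i` to row `i` when it multiplies from the left. -/
def permUnitary (𝕜 : Type*) [RCLike 𝕜] (σ : Equiv.Perm ι) : Matrix.unitaryGroup ι 𝕜 :=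
  ⟨σ.permMatrix 𝕜, by
    rw [Matrix.mem_unitaryGroup_iff, Matrix.star_eq_conjTranspose,
      Matrix.conjTranspose_permMatrix, ← Matrix.permMatrix_mul]
    simp⟩

theorem permUnitary_mul_apply (σ : Equiv.Perm ι) (Q : Matrix.unitaryGroup ι 𝕜) (i j : ι) :
    ((permUnitary 𝕜 σ * Q : Matrix.unitaryGroup ι 𝕜) : Matrix ι ι 𝕜) i j =
      (Q : Matrix ι ι 𝕜) (σ i) j := by
  simp [permUnitary, Equiv.Perm.permMatrix, PEquiv.toMatrix_toPEquiv_mul]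

theorem mul_permUnitary_apply (σ : Equiv.Perm ι) (Q : Matrix.unitaryGroup ι 𝕜) (i j : ι) :
    ((Q * permUnitary 𝕜 σ : Matrix.unitaryGroup ι 𝕜) : Matrix ι ι 𝕜) i j =
      (Q : Matrix ι ι 𝕜) i (σ.symm j) := by
  simp [permUnitary, Equiv.Perm.permMatrix, PEquiv.mul_toMatrix_toPEquiv]

theorem integrable_of_continuous {X E : Type*} [TopologicalSpace X] [CompactSpace X]
    [MeasurableSpace X] [OpensMeasurableSpace X] [NormedAddCommGroup E]
    [SecondCountableTopologyEither X E] {P : Measure X}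
    [IsFiniteMeasure P] {f : X → E} (hf : Continuous f) : Integrable f P :=
  hf.integrable_of_hasCompactSupport (HasCompactSupport.of_compactSpace f)

end HaarInvariance

/-! ## Traces of words in a diagonal matrix and a conjugate of a diagonal matrix -/

section Traces

variable {X 𝕜 : Type*} [Fintype X] [DecidableEq X] [RCLike 𝕜]

/-- A real diagonal matrix. -/
def realDiag (𝕜 : Type*) [RCLike 𝕜] (a : X → ℝ) : Matrix X X 𝕜 :=
  Matrix.diagonal fun x => (a x : 𝕜)

/-- `V⁻¹ diag(b) V` for unitary `V`. -/
def conjDiag (V : Matrix X X 𝕜) (b : X → ℝ) : Matrix X X 𝕜 := Vᴴ * realDiag 𝕜 b * V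

theorem realDiag_mul (a b : X → ℝ) : realDiag 𝕜 a * realDiag 𝕜 b = realDiag 𝕜 (a * b) := by
  simp [realDiag, Matrix.diagonal_mul_diagonal]

theorem realDiag_one : realDiag 𝕜 (1 : X → ℝ) = 1 := by
  simp [realDiag]

theorem mul_conjTranspose_of_mem {V : Matrix X X 𝕜} (hV : V ∈ Matrix.unitaryGroup X 𝕜) :
    V * Vᴴ = 1 := by
  simpa [Matrix.star_eq_conjTranspose] using Matrix.mem_unitaryGroup_iff.mp hV

theorem conjTranspose_mul_of_mem {V : Matrix X X 𝕜} (hV : V ∈ Matrix.unitaryGroup X 𝕜) :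
    Vᴴ * V = 1 := by
  simpa [Matrix.star_eq_conjTranspose] using Matrix.mem_unitaryGroup_iff'.mp hV

theorem conjDiag_mul {V : Matrix X X 𝕜} (hV : V ∈ Matrix.unitaryGroup X 𝕜) (b c : X → ℝ) :
    conjDiag V b * conjDiag V c = conjDiag V (b * c) := by
  calc conjDiag V b * conjDiag V c
      = Vᴴ * realDiag 𝕜 b * (V * Vᴴ) * realDiag 𝕜 c * V := by
        simp only [conjDiag, Matrix.mul_assoc]
    _ = conjDiag V (b * c) := by
        rw [mul_conjTranspose_of_mem hV, Matrix.mul_one, Matrix.mul_assoc Vᴴ (realDiag 𝕜 b),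
          realDiag_mul, conjDiag]

theorem conjDiag_one {V : Matrix X X 𝕜} (hV : V ∈ Matrix.unitaryGroup X 𝕜) :
    conjDiag V 1 = 1 := by
  rw [conjDiag, realDiag_one, Matrix.mul_one, conjTranspose_mul_of_mem hV]

theorem conjDiag_apply (V : Matrix X X 𝕜) (b : X → ℝ) (x y : X) :
    conjDiag V b x y = ∑ z, (b z : 𝕜) * (starRingEnd 𝕜 (V z x) * V z y) := by
  rw [conjDiag, Matrix.mul_apply]
  simp only [realDiag, Matrix.mul_diagonal, Matrix.conjTranspose_apply, RCLike.star_def]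
  exact Finset.sum_congr rfl fun z _ => by ring

theorem re_trace_realDiag_mul_conjDiag (V : Matrix X X 𝕜) (a b : X → ℝ) :
    RCLike.re (realDiag 𝕜 a * conjDiag V b).trace = ∑ x, ∑ z, a x * b z * ‖V z x‖ ^ 2 := by
  simp only [Matrix.trace, Matrix.diag_apply, realDiag, Matrix.diagonal_mul, conjDiag_apply,
    Finset.mul_sum, map_sum, RCLike.conj_mul]
  refine Finset.sum_congr rfl fun x _ => Finset.sum_congr rfl fun z _ => ?_
  rw [← mul_assoc]
  norm_cast

theorem re_trace_realDiag_mul_conjDiag_sq (V : Matrix X X 𝕜) (a b : X → ℝ) :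
    RCLike.re ((realDiag 𝕜 a * conjDiag V b) ^ 2).trace = ∑ x, ∑ y, ∑ z, ∑ w,
      a x * a y * (b z * b w) *
        RCLike.re (starRingEnd 𝕜 (V z x) * V z y * (starRingEnd 𝕜 (V w y) * V w x)) := by
  rw [pow_two]
  simp only [Matrix.trace, Matrix.diag_apply, Matrix.mul_apply (M := realDiag 𝕜 a * conjDiag V b)]
  simp only [realDiag, Matrix.diagonal_mul, conjDiag_apply, Finset.mul_sum, Finset.sum_mul,
    map_sum]
  refine Finset.sum_congr rfl fun x _ => Finset.sum_congr rfl fun y _ => ?_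
  rw [Finset.sum_comm]
  refine Finset.sum_congr rfl fun z _ => Finset.sum_congr rfl fun w _ => ?_
  rw [← RCLike.re_ofReal_mul]
  congr 1
  push_cast
  ring

theorem trace_add_sq (A B : Matrix X X 𝕜) :
    ((A + B) ^ 2).trace = (A * A).trace + 2 * (A * B).trace + (B * B).trace := by
  have h1 := Matrix.trace_mul_comm B A
  simp only [pow_two, add_mul, mul_add, Matrix.trace_add]
  linear_combination h1

theorem trace_add_cube (A B : Matrix X X 𝕜) :
    ((A + B) ^ 3).trace = (A * A * A).trace + 3 * (A * A * B).trace + 3 * (A * (B * B)).trace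
      + (B * B * B).trace := by
  have h1 := Matrix.trace_mul_comm B (A * A)
  have h2 := Matrix.trace_mul_comm (A * B) A
  have h3 := Matrix.trace_mul_comm (B * B) A
  have h4 := Matrix.trace_mul_comm (B * A) B
  simp only [pow_succ, pow_zero, one_mul, add_mul, mul_add, Matrix.trace_add,
    Matrix.mul_assoc] at *
  linear_combination h1 + h2 + 2 * h3 + h4

/-- Of the sixteen words, fourteen are cyclic rotations of some A^i B^j; the remaining ABAB and BABA
have a common trace. The hypotheses collected in the proof are the rotations. -/
theorem trace_add_pow_four (A B : Matrix X X 𝕜) :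
    ((A + B) ^ 4).trace = (A * A * A * A).trace + 4 * (A * A * A * B).trace
      + 4 * (A * A * (B * B)).trace + 4 * (A * (B * B * B)).trace + (B * B * B * B).trace
      + 2 * ((A * B) ^ 2).trace := by
  have a1 := Matrix.trace_mul_comm B (A * A * A)
  have a2 := Matrix.trace_mul_comm (A * B) (A * A)
  have a3 := Matrix.trace_mul_comm (A * A * B) A
  have b1 := Matrix.trace_mul_comm (B * B) (A * A)
  have b2 := Matrix.trace_mul_comm (A * B * B) A
  have b3 := Matrix.trace_mul_comm (B * (A * A)) B
  have c1 := Matrix.trace_mul_comm (B * B * B) A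
  have c2 := Matrix.trace_mul_comm (B * B * A) B
  have c3 := Matrix.trace_mul_comm (B * A) (B * B)
  have d1 := Matrix.trace_mul_comm (B * A * B) A
  simp only [pow_succ, pow_zero, one_mul, add_mul, mul_add, Matrix.trace_add,
    Matrix.mul_assoc] at *
  linear_combination a1 + a2 + a3 + 2 * b1 + b2 + b3 + 3 * c1 + c2 + c3 + d1

end Traces

/-! ### Traces of powers as sums weighted by |V_zx|². -/

section TracePowers

variable {X 𝕜 : Type*} [Fintype X] [DecidableEq X] [RCLike 𝕜]

/-- The rows and columns of a unitary V have norm one, so the weights |V_zx|² can be inserted even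
where V does not occur. All terms of a power then share one double sum. -/
theorem re_trace_realDiag {V : Matrix X X 𝕜} (hV : V ∈ Matrix.unitaryGroup X 𝕜) (a : X → ℝ) :
    RCLike.re (realDiag 𝕜 a).trace = ∑ x, ∑ z, a x * ‖V z x‖ ^ 2 := by
  rw [← Matrix.mul_one (realDiag 𝕜 a), ← conjDiag_one hV, re_trace_realDiag_mul_conjDiag]
  simp

theorem re_trace_conjDiag (V : Matrix X X 𝕜) (b : X → ℝ) :
    RCLike.re (conjDiag V b).trace = ∑ x, ∑ z, b z * ‖V z x‖ ^ 2 := by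
  rw [← Matrix.one_mul (conjDiag V b), ← realDiag_one, re_trace_realDiag_mul_conjDiag]
  simp

theorem re_two_mul (z : 𝕜) : RCLike.re (2 * z) = 2 * RCLike.re z := by
  simp

theorem re_three_mul (z : 𝕜) : RCLike.re (3 * z) = 3 * RCLike.re z := by
  simp

theorem re_four_mul (z : 𝕜) : RCLike.re (4 * z) = 4 * RCLike.re z := by
  simp

/-- For exponents up to three, the trace is what it would be if a_x and b_z were commuting numbers
drawn jointly with weight |V_zx|². -/
theorem re_trace_sum_pow_one {V : Matrix X X 𝕜} (hV : V ∈ Matrix.unitaryGroup X 𝕜)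
    (a b : X → ℝ) : RCLike.re ((realDiag 𝕜 a + conjDiag V b) ^ 1).trace =
      ∑ x, ∑ z, (a x + b z) ^ 1 * ‖V z x‖ ^ 2 := by
  rw [pow_one, Matrix.trace_add, map_add, re_trace_realDiag hV, re_trace_conjDiag,
    ← Finset.sum_add_distrib]
  simp only [← Finset.sum_add_distrib]
  exact Finset.sum_congr rfl fun x _ => Finset.sum_congr rfl fun z _ => by ring

theorem re_trace_sum_pow_two {V : Matrix X X 𝕜} (hV : V ∈ Matrix.unitaryGroup X 𝕜)
    (a b : X → ℝ) : RCLike.re ((realDiag 𝕜 a + conjDiag V b) ^ 2).trace =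
      ∑ x, ∑ z, (a x + b z) ^ 2 * ‖V z x‖ ^ 2 := by
  simp only [trace_add_sq, realDiag_mul, conjDiag_mul hV, map_add, re_two_mul,
    re_trace_realDiag hV, re_trace_conjDiag, re_trace_realDiag_mul_conjDiag, Finset.mul_sum,
    ← Finset.sum_add_distrib, Pi.mul_apply]
  exact Finset.sum_congr rfl fun x _ => Finset.sum_congr rfl fun z _ => by ring

theorem re_trace_sum_pow_three {V : Matrix X X 𝕜} (hV : V ∈ Matrix.unitaryGroup X 𝕜)
    (a b : X → ℝ) : RCLike.re ((realDiag 𝕜 a + conjDiag V b) ^ 3).trace =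
      ∑ x, ∑ z, (a x + b z) ^ 3 * ‖V z x‖ ^ 2 := by
  simp only [trace_add_cube, realDiag_mul, conjDiag_mul hV, map_add, re_three_mul,
    re_trace_realDiag hV, re_trace_conjDiag, re_trace_realDiag_mul_conjDiag, Finset.mul_sum,
    ← Finset.sum_add_distrib, Pi.mul_apply]
  exact Finset.sum_congr rfl fun x _ => Finset.sum_congr rfl fun z _ => by ring

/-- Commuting letters would give 6a²b². Only four of these six words reduce to A²B'²; the other two
give the correction term. -/
theorem re_trace_sum_pow_four {V : Matrix X X 𝕜} (hV : V ∈ Matrix.unitaryGroup X 𝕜)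
    (a b : X → ℝ) : RCLike.re ((realDiag 𝕜 a + conjDiag V b) ^ 4).trace =
      ∑ x, ∑ z, ((a x + b z) ^ 4 - 2 * (a x ^ 2 * b z ^ 2)) * ‖V z x‖ ^ 2 +
        2 * RCLike.re ((realDiag 𝕜 a * conjDiag V b) ^ 2).trace := by
  simp only [trace_add_pow_four, realDiag_mul, conjDiag_mul hV, map_add, re_four_mul, re_two_mul,
    re_trace_realDiag hV, re_trace_conjDiag, re_trace_realDiag_mul_conjDiag, add_left_inj,
    Finset.mul_sum, ← Finset.sum_add_distrib, Pi.mul_apply]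
  exact Finset.sum_congr rfl fun x _ => Finset.sum_congr rfl fun z _ => by ring

end TracePowers

/-! ## Random conjugations with flat second moments -/

section Mixing

variable {X 𝕜 Ω : Type*} [Fintype X] [DecidableEq X] [RCLike 𝕜] [MeasurableSpace Ω]

/-- A random unitary matrix all of whose entries have the same second absolute moment. -/
structure IsMixing (P : Measure Ω) (V : Ω → Matrix X X 𝕜) : Prop where
  isProbabilityMeasure : IsProbabilityMeasure P
  aestronglyMeasurable : ∀ z x, AEStronglyMeasurable (fun ω => V ω z x) P
  mem_unitaryGroup : ∀ ω, V ω ∈ Matrix.unitaryGroup X 𝕜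
  integral_norm_sq : ∀ z x, ∫ ω, ‖V ω z x‖ ^ 2 ∂P = (Fintype.card X : ℝ)⁻¹

/-- The real part of `𝔼 conj(V z x) V z y conj(V w y) V w x`. -/
def quartic (P : Measure Ω) (V : Ω → Matrix X X 𝕜) (x y z w : X) : ℝ :=
  ∫ ω, RCLike.re (starRingEnd 𝕜 (V ω z x) * V ω z y * (starRingEnd 𝕜 (V ω w y) * V ω w x)) ∂P

variable {P : Measure Ω} {V : Ω → Matrix X X 𝕜}

theorem IsMixing.norm_le_one (h : IsMixing P V) (ω : Ω) (z x : X) : ‖V ω z x‖ ≤ 1 :=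
  entry_norm_bound_of_unitary (h.mem_unitaryGroup ω) z x

theorem IsMixing.integrable_norm_sq (h : IsMixing P V) (z x : X) :
    Integrable (fun ω => ‖V ω z x‖ ^ 2) P := by
  have := h.isProbabilityMeasure
  refine Integrable.of_bound ((h.aestronglyMeasurable z x).norm.pow 2) 1
    (Filter.Eventually.of_forall fun ω => ?_)
  have h1 := h.norm_le_one ω z x
  rw [Real.norm_of_nonneg (by positivity)]
  exact pow_le_one₀ (norm_nonneg _) h1

theorem IsMixing.integrable_quartic (h : IsMixing P V) (x y z w : X) :
    Integrable (fun ω => starRingEnd 𝕜 (V ω z x) * V ω z y *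
      (starRingEnd 𝕜 (V ω w y) * V ω w x)) P := by
  have := h.isProbabilityMeasure
  have hc : ∀ z x, AEStronglyMeasurable (fun ω => starRingEnd 𝕜 (V ω z x)) P := fun z x =>
    RCLike.continuous_conj.comp_aestronglyMeasurable (h.aestronglyMeasurable z x)
  refine Integrable.of_bound (((hc z x).mul (h.aestronglyMeasurable z y)).mul
    ((hc w y).mul (h.aestronglyMeasurable w x))) 1 (Filter.Eventually.of_forall fun ω => ?_)
  have h1 := h.norm_le_one ω
  simp only [norm_mul, RCLike.norm_conj]
  exact mul_le_one₀ (mul_le_one₀ (h1 _ _) (norm_nonneg _) (h1 _ _)) (by positivity)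
    (mul_le_one₀ (h1 _ _) (norm_nonneg _) (h1 _ _))

/-- For each ω the sum factors as (VV†)_zw (VV†)_wz. -/
theorem IsMixing.sum_quartic_left (h : IsMixing P V) (z w : X) :
    ∑ x, ∑ y, quartic P V x y z w = if z = w then 1 else 0 := by
  have := h.isProbabilityMeasure
  have h1 : ∀ ω, ∑ x, ∑ y, RCLike.re (starRingEnd 𝕜 (V ω z x) * V ω z y *
      (starRingEnd 𝕜 (V ω w y) * V ω w x)) = if z = w then 1 else 0 := by
    intro ω
    have hU := congrFun (congrFun (mul_conjTranspose_of_mem (h.mem_unitaryGroup ω)) z) w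
    have hU' := congrFun (congrFun (mul_conjTranspose_of_mem (h.mem_unitaryGroup ω)) w) z
    rw [Matrix.mul_apply] at hU hU'
    simp only [← map_sum]
    have : ∑ x, ∑ y, starRingEnd 𝕜 (V ω z x) * V ω z y * (starRingEnd 𝕜 (V ω w y) * V ω w x) =
        (∑ y, V ω z y * (V ω)ᴴ y w) * ∑ x, V ω w x * (V ω)ᴴ x z := by
      rw [Finset.sum_mul_sum, Finset.sum_comm]
      simp only [Matrix.conjTranspose_apply, RCLike.star_def]
      exact Finset.sum_congr rfl fun x _ => Finset.sum_congr rfl fun z _ => by ring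
    rw [this, hU, hU']
    by_cases hzw : z = w
    · subst hzw
      simp [Matrix.one_apply_eq]
    · simp [hzw]
  simp only [quartic]
  calc _ = ∫ ω, ∑ x, ∑ y, RCLike.re (starRingEnd 𝕜 (V ω z x) * V ω z y *
      (starRingEnd 𝕜 (V ω w y) * V ω w x)) ∂P := by
        rw [integral_finsetSum _ fun x _ => integrable_finsetSum _ fun y _ =>
          (h.integrable_quartic x y z w).re]
        exact Finset.sum_congr rfl fun x _ =>
          (integral_finsetSum _ fun y _ => (h.integrable_quartic x y z w).re).symm
    _ = _ := by simp only [h1]; simp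

theorem IsMixing.sum_quartic_right (h : IsMixing P V) (x y : X) :
    ∑ z, ∑ w, quartic P V x y z w = if x = y then 1 else 0 := by
  have := h.isProbabilityMeasure
  have h1 : ∀ ω, ∑ z, ∑ w, RCLike.re (starRingEnd 𝕜 (V ω z x) * V ω z y *
      (starRingEnd 𝕜 (V ω w y) * V ω w x)) = if x = y then 1 else 0 := by
    intro ω
    have hU := congrFun (congrFun (conjTranspose_mul_of_mem (h.mem_unitaryGroup ω)) x) y
    have hU' := congrFun (congrFun (conjTranspose_mul_of_mem (h.mem_unitaryGroup ω)) y) x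
    rw [Matrix.mul_apply] at hU hU'
    simp only [← map_sum]
    have : ∑ z, ∑ w, starRingEnd 𝕜 (V ω z x) * V ω z y * (starRingEnd 𝕜 (V ω w y) * V ω w x) =
        (∑ z, (V ω)ᴴ x z * V ω z y) * ∑ w, (V ω)ᴴ y w * V ω w x := by
      rw [Finset.sum_mul_sum]
      simp only [Matrix.conjTranspose_apply, RCLike.star_def]
    rw [this, hU, hU']
    by_cases hxy : x = y
    · subst hxy
      simp [Matrix.one_apply_eq]
    · simp [hxy]
  simp only [quartic]
  calc _ = ∫ ω, ∑ z, ∑ w, RCLike.re (starRingEnd 𝕜 (V ω z x) * V ω z y *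
      (starRingEnd 𝕜 (V ω w y) * V ω w x)) ∂P := by
        rw [integral_finsetSum _ fun z _ => integrable_finsetSum _ fun w _ =>
          (h.integrable_quartic x y z w).re]
        exact Finset.sum_congr rfl fun z _ =>
          (integral_finsetSum _ fun w _ => (h.integrable_quartic x y z w).re).symm
    _ = _ := by simp only [h1]; simp

end Mixing

/-! ## Moments of a sum of independent eigenvalues and eigenvectors -/

section Moments

variable {X 𝕜 Ω Ω' : Type*} [Fintype X] [DecidableEq X] [RCLike 𝕜] [MeasurableSpace Ω]
  [MeasurableSpace Ω'] {μ : Measure Ω'} {P : Measure Ω} {V : Ω → Matrix X X 𝕜}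
  {a b : Ω' → X → ℝ}

/-- The `j`-th moment of the classical convolution of the two averaged spectra. -/
def convMoment (μ : Measure Ω') (a b : Ω' → X → ℝ) (j : ℕ) : ℝ :=
  (Fintype.card X : ℝ)⁻¹ * ∑ x, ∑ z, (∫ t, (a t x + b t z) ^ j ∂μ) * (Fintype.card X : ℝ)⁻¹

/-- Independence separates the eigenvalues from the weights, and the weights have mean 1/m: nothing
else about V survives. -/
theorem IsMixing.expTrace_weighted (h : IsMixing P V) [IsProbabilityMeasure μ]
    {f : Ω' → X → X → ℝ} (hf : ∀ x z, Integrable (fun t => f t x z) μ) :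
    Integrable (fun ω : Ω' × Ω => ∑ x, ∑ z, f ω.1 x z * ‖V ω.2 z x‖ ^ 2) (μ.prod P) ∧
    ∫ ω : Ω' × Ω, ∑ x, ∑ z, f ω.1 x z * ‖V ω.2 z x‖ ^ 2 ∂(μ.prod P) =
      ∑ x, ∑ z, (∫ t, f t x z ∂μ) * (Fintype.card X : ℝ)⁻¹ := by
  have := h.isProbabilityMeasure
  have hi : ∀ x z, Integrable (fun ω : Ω' × Ω => f ω.1 x z * ‖V ω.2 z x‖ ^ 2) (μ.prod P) :=
    fun x z => (hf x z).mul_prod (h.integrable_norm_sq z x)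
  refine ⟨integrable_finsetSum _ fun x _ => integrable_finsetSum _ fun z _ => hi x z, ?_⟩
  rw [integral_finsetSum _ fun x _ => integrable_finsetSum _ fun z _ => hi x z]
  refine Finset.sum_congr rfl fun x _ => ?_
  rw [integral_finsetSum _ fun z _ => hi x z]
  refine Finset.sum_congr rfl fun z _ => ?_
  rw [integral_prod_mul (fun t => f t x z) (fun ω => ‖V ω z x‖ ^ 2), h.integral_norm_sq]

theorem integrable_pow_of_memLp [IsFiniteMeasure μ] {f : Ω' → ℝ} (hf : MemLp f 4 μ) {j : ℕ}
    (hj : j ≤ 4) : Integrable (fun t => f t ^ j) μ := by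
  have h1 : MemLp f (j : ℕ) μ := hf.mono_exponent (by exact_mod_cast hj)
  have h2 := h1.integrable_norm_pow'
  refine h2.mono (hf.aestronglyMeasurable.pow j) (Filter.Eventually.of_forall fun t => ?_)
  simp

theorem specMoment_eq_convMoment (h : IsMixing P V) [IsProbabilityMeasure μ]
    (ha : ∀ x, MemLp (fun t => a t x) 4 μ) (hb : ∀ x, MemLp (fun t => b t x) 4 μ) {j : ℕ}
    (hj : j = 1 ∨ j = 2 ∨ j = 3) :
    specMoment (μ.prod P) (fun ω => realDiag 𝕜 (a ω.1) + conjDiag (V ω.2) (b ω.1)) j =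
      convMoment μ a b j := by
  have hj4 : j ≤ 4 := by omega
  rw [specMoment, convMoment, expTrace,
    ← (h.expTrace_weighted (f := fun t x z => (a t x + b t z) ^ j) fun x z =>
      integrable_pow_of_memLp ((ha x).add (hb z)) hj4).2]
  congr 1
  refine integral_congr_ae (Filter.Eventually.of_forall fun ω => ?_)
  have hU := h.mem_unitaryGroup ω.2
  rcases hj with rfl | rfl | rfl
  · exact re_trace_sum_pow_one hU _ _
  · exact re_trace_sum_pow_two hU _ _
  · exact re_trace_sum_pow_three hU _ _

/-- With this exponent triple, four functions in L⁴ have an integrable product: pairs land in L²,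
and two of these in L¹. -/
instance : ENNReal.HolderTriple 4 4 2 where
  inv_add_inv_eq_inv := by
    rw [← two_mul]
    apply (ENNReal.toReal_eq_toReal_iff' (by simp [ENNReal.mul_eq_top]) (by simp)).mp
    simp [ENNReal.toReal_mul]
    norm_num

theorem integrable_mul_four {f₁ f₂ f₃ f₄ : Ω' → ℝ} (h₁ : MemLp f₁ 4 μ) (h₂ : MemLp f₂ 4 μ)
    (h₃ : MemLp f₃ 4 μ) (h₄ : MemLp f₄ 4 μ) :
    Integrable (fun t => f₁ t * f₂ t * (f₃ t * f₄ t)) μ :=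
  (h₂.mul h₁ (r := 2)).integrable_mul (h₄.mul h₃ (r := 2))

theorem IsMixing.expTrace_sq (h : IsMixing P V) [IsProbabilityMeasure μ]
    (ha : ∀ x, MemLp (fun t => a t x) 4 μ) (hb : ∀ x, MemLp (fun t => b t x) 4 μ) :
    Integrable (fun ω : Ω' × Ω =>
      RCLike.re ((realDiag 𝕜 (a ω.1) * conjDiag (V ω.2) (b ω.1)) ^ 2).trace) (μ.prod P) ∧
    expTrace (μ.prod P) (fun ω => (realDiag 𝕜 (a ω.1) * conjDiag (V ω.2) (b ω.1)) ^ 2) =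
      ∑ x, ∑ y, ∑ z, ∑ w, (∫ t, a t x * a t y * (b t z * b t w) ∂μ) * quartic P V x y z w := by
  have := h.isProbabilityMeasure
  have hi : ∀ x y z w, Integrable (fun ω : Ω' × Ω =>
      a ω.1 x * a ω.1 y * (b ω.1 z * b ω.1 w) *
        RCLike.re (starRingEnd 𝕜 (V ω.2 z x) * V ω.2 z y *
          (starRingEnd 𝕜 (V ω.2 w y) * V ω.2 w x))) (μ.prod P) := fun x y z w =>
    (integrable_mul_four (ha x) (ha y) (hb z) (hb w)).mul_prod (h.integrable_quartic x y z w).re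
  simp only [expTrace, re_trace_realDiag_mul_conjDiag_sq]
  refine ⟨integrable_finsetSum _ fun x _ => integrable_finsetSum _ fun y _ =>
    integrable_finsetSum _ fun z _ => integrable_finsetSum _ fun w _ => hi x y z w, ?_⟩
  rw [integral_finsetSum _ fun x _ => integrable_finsetSum _ fun y _ =>
    integrable_finsetSum _ fun z _ => integrable_finsetSum _ fun w _ => hi x y z w]
  refine Finset.sum_congr rfl fun x _ => ?_
  rw [integral_finsetSum _ fun y _ =>
    integrable_finsetSum _ fun z _ => integrable_finsetSum _ fun w _ => hi x y z w]
  refine Finset.sum_congr rfl fun y _ => ?_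
  rw [integral_finsetSum _ fun z _ => integrable_finsetSum _ fun w _ => hi x y z w]
  refine Finset.sum_congr rfl fun z _ => ?_
  rw [integral_finsetSum _ fun w _ => hi x y z w]
  refine Finset.sum_congr rfl fun w _ => ?_
  exact integral_prod_mul (fun t => a t x * a t y * (b t z * b t w))
    (fun ω => RCLike.re (starRingEnd 𝕜 (V ω z x) * V ω z y * (starRingEnd 𝕜 (V ω w y) * V ω w x)))

theorem specMoment_four (h : IsMixing P V) [IsProbabilityMeasure μ]
    (ha : ∀ x, MemLp (fun t => a t x) 4 μ) (hb : ∀ x, MemLp (fun t => b t x) 4 μ) :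
    specMoment (μ.prod P) (fun ω => realDiag 𝕜 (a ω.1) + conjDiag (V ω.2) (b ω.1)) 4 =
      (Fintype.card X : ℝ)⁻¹ * (∑ x, ∑ z, (∫ t, ((a t x + b t z) ^ 4 -
        2 * (a t x ^ 2 * b t z ^ 2)) ∂μ) * (Fintype.card X : ℝ)⁻¹) +
      2 * (Fintype.card X : ℝ)⁻¹ *
        expTrace (μ.prod P) (fun ω => (realDiag 𝕜 (a ω.1) * conjDiag (V ω.2) (b ω.1)) ^ 2) := by
  have hint : ∀ x z, Integrable (fun t => (a t x + b t z) ^ 4 - 2 * (a t x ^ 2 * b t z ^ 2)) μ :=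
    fun x z => (integrable_pow_of_memLp ((ha x).add (hb z)) le_rfl).sub
      (((integrable_mul_four (ha x) (ha x) (hb z) (hb z)).const_mul 2).congr
        (Filter.Eventually.of_forall fun t => by ring))
  obtain ⟨h1, h2⟩ := h.expTrace_weighted hint
  obtain ⟨h3, -⟩ := h.expTrace_sq ha hb
  rw [specMoment, ← h2, mul_comm 2, mul_assoc, ← mul_add]
  congr 1
  rw [expTrace, expTrace, ← integral_const_mul, ← integral_add h1 (h3.const_mul 2)]
  refine integral_congr_ae (Filter.Eventually.of_forall fun ω => ?_)
  exact re_trace_sum_pow_four (h.mem_unitaryGroup ω.2) _ _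

/-- The part of the fourth central moment that does not depend on the law of the eigenvectors. -/
def centralFourBase (μ : Measure Ω') (a b : Ω' → X → ℝ) : ℝ :=
  (Fintype.card X : ℝ)⁻¹ * (∑ x, ∑ z, (∫ t, ((a t x + b t z) ^ 4 -
      2 * (a t x ^ 2 * b t z ^ 2)) ∂μ) * (Fintype.card X : ℝ)⁻¹)
    - 4 * convMoment μ a b 1 * convMoment μ a b 3
    + 6 * convMoment μ a b 1 ^ 2 * convMoment μ a b 2 - 3 * convMoment μ a b 1 ^ 4

/-- The kurtosis depends on the law of the eigenvectors only through `𝔼 Tr (A B')²`. -/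
theorem kurtosis_eq (h : IsMixing P V) [IsProbabilityMeasure μ]
    (ha : ∀ x, MemLp (fun t => a t x) 4 μ) (hb : ∀ x, MemLp (fun t => b t x) 4 μ) :
    kurtosis (μ.prod P) (fun ω => realDiag 𝕜 (a ω.1) + conjDiag (V ω.2) (b ω.1)) =
      (centralFourBase μ a b + 2 * (Fintype.card X : ℝ)⁻¹ * expTrace (μ.prod P)
        (fun ω => (realDiag 𝕜 (a ω.1) * conjDiag (V ω.2) (b ω.1)) ^ 2)) /
        (convMoment μ a b 2 - convMoment μ a b 1 ^ 2) ^ 2 - 3 := by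
  rw [kurtosis, specVariance, specCentralFour, specMoment_four h ha hb,
    specMoment_eq_convMoment h ha hb (Or.inl rfl),
    specMoment_eq_convMoment h ha hb (Or.inr (Or.inl rfl)),
    specMoment_eq_convMoment h ha hb (Or.inr (Or.inr rfl)), centralFourBase]
  congr 2
  ring

/-- The variance of the averaged spectrum is positive if two eigenvalues of the first summand
differ with positive probability. -/
theorem convMoment_variance_pos [IsProbabilityMeasure μ]
    (ha : ∀ x, MemLp (fun t => a t x) 4 μ) (hb : ∀ x, MemLp (fun t => b t x) 4 μ)
    {x y : X} (hxy : 0 < ∫ t, (a t x - a t y) ^ 2 ∂μ) :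
    0 < convMoment μ a b 2 - convMoment μ a b 1 ^ 2 := by
  set c := convMoment μ a b 1 with hc
  have hm : (Fintype.card X : ℝ) ≠ 0 := by
    have : Nonempty X := ⟨x⟩
    exact_mod_cast Fintype.card_ne_zero
  have hi1 : ∀ x z, Integrable (fun t => (a t x + b t z) ^ 1) μ := fun x z =>
    integrable_pow_of_memLp ((ha x).add (hb z)) (by norm_num)
  have hi2 : ∀ x z, Integrable (fun t => (a t x + b t z) ^ 2) μ := fun x z =>
    integrable_pow_of_memLp ((ha x).add (hb z)) (by norm_num)
  have hi3 : ∀ x z, Integrable (fun t => (a t x + b t z - c) ^ 2) μ := fun x z =>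
    integrable_pow_of_memLp (((ha x).add (hb z)).sub (memLp_const c)) (by norm_num)
  -- The variance is the average of the squared deviations from the mean c.
  have key : convMoment μ a b 2 - c ^ 2 = (Fintype.card X : ℝ)⁻¹ *
      ∑ x, ∑ z, (∫ t, (a t x + b t z - c) ^ 2 ∂μ) * (Fintype.card X : ℝ)⁻¹ := by
    have e1 : ∀ x z, ∫ t, (a t x + b t z - c) ^ 2 ∂μ =
        ∫ t, (a t x + b t z) ^ 2 ∂μ - 2 * c * ∫ t, (a t x + b t z) ^ 1 ∂μ + c ^ 2 := by
      intro x z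
      have : ∀ t, (a t x + b t z - c) ^ 2 =
          (a t x + b t z) ^ 2 - 2 * c * (a t x + b t z) ^ 1 + c ^ 2 := fun t => by ring
      simp only [this]
      have h1 := (hi1 x z).const_mul (2 * c)
      have h12 : Integrable (fun t => (a t x + b t z) ^ 2 - 2 * c * (a t x + b t z) ^ 1) μ :=
        (hi2 x z).sub h1
      rw [integral_add h12 (integrable_const _), integral_sub (hi2 x z) h1, integral_const_mul]
      simp
    simp only [e1, add_mul, sub_mul, Finset.sum_add_distrib, Finset.sum_sub_distrib, mul_add,
      mul_sub]
    have e2 : (Fintype.card X : ℝ)⁻¹ * ∑ x : X, ∑ z : X, 2 * c *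
        (∫ t, (a t x + b t z) ^ 1 ∂μ) * (Fintype.card X : ℝ)⁻¹ = 2 * c * convMoment μ a b 1 := by
      rw [convMoment]
      simp only [mul_assoc, ← Finset.mul_sum]
      ring
    rw [e2, ← convMoment, ← hc]
    simp only [Finset.sum_const, Finset.card_univ, nsmul_eq_mul]
    field_simp
    ring
  rw [key]
  have hnn : ∀ x z, 0 ≤ (∫ t, (a t x + b t z - c) ^ 2 ∂μ) * (Fintype.card X : ℝ)⁻¹ := fun x z =>
    mul_nonneg (integral_nonneg fun t => sq_nonneg _) (by positivity)
  -- The same eigenvalue b_x is used in both deviations and cancels in their difference; then (s −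
  -- t)² ≤ 2s² + 2t².
  have hle : ∫ t, (a t x - a t y) ^ 2 ∂μ ≤
      2 * ∫ t, (a t x + b t x - c) ^ 2 ∂μ + 2 * ∫ t, (a t y + b t x - c) ^ 2 ∂μ := by
    rw [← integral_const_mul, ← integral_const_mul,
      ← integral_add ((hi3 x x).const_mul 2) ((hi3 y x).const_mul 2)]
    refine integral_mono (integrable_pow_of_memLp ((ha x).sub (ha y)) (by norm_num))
      (((hi3 x x).const_mul 2).add ((hi3 y x).const_mul 2)) fun t => ?_
    simp only
    nlinarith [sq_nonneg (a t x + b t x - c + (a t y + b t x - c))]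
  have hpos : ∃ s, 0 < ∫ t, (a t s + b t x - c) ^ 2 ∂μ := by
    by_contra! hcon
    linarith [hcon x, hcon y]
  obtain ⟨s, hs⟩ := hpos
  have hmpos : (0 : ℝ) < (Fintype.card X : ℝ)⁻¹ := by positivity
  refine mul_pos hmpos (Finset.sum_pos' (fun x _ => Finset.sum_nonneg fun z _ => hnn x z)
    ⟨s, Finset.mem_univ _, Finset.sum_pos' (fun z _ => hnn s z) ⟨x, Finset.mem_univ _, ?_⟩⟩)
  exact mul_pos hs hmpos

end Moments

/-! ## Second moments of the local eigenvalues -/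

section LocalLaw

variable {ι : Type*} {ν : Measure (ι → ℝ)}

theorem IsLocalLaw.integral_eq (h : IsLocalLaw ν) (i j : ι) :
    ∫ x, x i ∂ν = ∫ x, x j ∂ν := by
  classical
  simpa using (h.permutationInvariant (Equiv.swap j i)).1 j

theorem IsLocalLaw.integral_sq_eq (h : IsLocalLaw ν) (i j : ι) :
    ∫ x, x i * x i ∂ν = ∫ x, x j * x j ∂ν := by
  classical
  simpa using (h.permutationInvariant (Equiv.swap j i)).2 j j

/-- Two transpositions suffice: the first takes k to i and l to some l' ≠ i, the second exchanges l'
and j and fixes i. -/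
theorem IsLocalLaw.integral_mul_eq (h : IsLocalLaw ν) {i j k l : ι} (hij : i ≠ j) (hkl : k ≠ l) :
    ∫ x, x i * x j ∂ν = ∫ x, x k * x l ∂ν := by
  classical
  have h1 := (h.permutationInvariant (Equiv.swap k i)).2 k l
  rw [Equiv.swap_apply_left] at h1
  have h2 : i ≠ Equiv.swap k i l := by
    intro he
    have : Equiv.swap k i k = Equiv.swap k i l := by rw [← he, Equiv.swap_apply_left]
    exact hkl ((Equiv.swap k i).injective this)
  have h3 := (h.permutationInvariant (Equiv.swap (Equiv.swap k i l) j)).2 i (Equiv.swap k i l)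
  rw [Equiv.swap_apply_left, Equiv.swap_apply_of_ne_of_ne h2 hij] at h3
  rw [h3, h1]

/-- The second moments of permutation invariant eigenvalues: a common covariance, and an excess on
the diagonal that is positive unless all eigenvalues agree. -/
theorem IsLocalLaw.exists_moments [Finite ι] [DecidableEq ι] (h : IsLocalLaw ν) : ∃ t δ : ℝ, 0 < δ ∧
    ∀ i j, ∫ x, x i * x j ∂ν = t + δ * if i = j then 1 else 0 := by
  have := h.isProbabilityMeasure
  -- There are finitely many pairs, so failure of almost sure equality must already occur at one
  -- fixed pair.
  obtain ⟨i, j, hij⟩ : ∃ i j, ¬ ∀ᵐ x ∂ν, x i = x j := by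
    by_contra! hcon
    exact h.nondegenerate (ae_all_iff.mpr fun i => ae_all_iff.mpr fun j => hcon i j)
  have hne : i ≠ j := by
    rintro rfl
    exact hij (Filter.Eventually.of_forall fun x => rfl)
  have h2 : ∀ i, MemLp (fun x : ι → ℝ => x i) 2 ν := fun i =>
    (h.memLp i).mono_exponent (by norm_num)
  have hint : ∀ i j, Integrable (fun x : ι → ℝ => x i * x j) ν := fun i j =>
    (h2 i).integrable_mul (h2 j)
  have hsq : 0 < ∫ x, (x i - x j) ^ 2 ∂ν := by
    refine lt_of_le_of_ne (integral_nonneg fun x => sq_nonneg _) fun h0 => hij ?_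
    have h3 := (integral_eq_zero_iff_of_nonneg (fun x => sq_nonneg _)
      ((h2 i).sub (h2 j)).integrable_sq).mp h0.symm
    filter_upwards [h3] with x hx
    have : (x i - x j) ^ 2 = 0 := hx
    nlinarith [pow_eq_zero_iff (two_ne_zero) |>.mp this]
  have hexp : ∫ x, (x i - x j) ^ 2 ∂ν =
      ∫ x, x i * x i ∂ν - 2 * ∫ x, x i * x j ∂ν + ∫ x, x j * x j ∂ν := by
    have h4 := (hint i j).const_mul 2
    have h5 : Integrable (fun x : ι → ℝ => x i * x i - 2 * (x i * x j)) ν := (hint i i).sub h4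
    rw [← integral_const_mul, ← integral_sub (hint i i) h4, ← integral_add h5 (hint j j)]
    exact integral_congr_ae (Filter.Eventually.of_forall fun x => by ring)
  -- All diagonal second moments agree, so `hexp` says that 𝔼(x_i − x_j)² = 2δ; this gives δ > 0.
  refine ⟨∫ x, x i * x j ∂ν, ∫ x, x i * x i ∂ν - ∫ x, x i * x j ∂ν, ?_, fun k l => ?_⟩
  · rw [h.integral_sq_eq j i] at hexp
    linarith
  · by_cases hkl : k = l
    · subst hkl
      rw [if_pos rfl, h.integral_sq_eq k i]
      ring
    · rw [if_neg hkl, h.integral_mul_eq hkl hne]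
      ring

end LocalLaw

/-! ### Second moments of sums of independent local eigenvalues. -/

section Independent

variable {L ι : Type*} [Fintype L] [Fintype ι] [DecidableEq ι]
  {ρ : L → Measure (ι → ℝ)}

theorem measurable_coord (l : L) (i : ι) : Measurable fun t : L → ι → ℝ => t l i :=
  (measurable_pi_apply i).comp (measurable_pi_apply l)

theorem memLp_coord (hρ : ∀ l, IsLocalLaw (ρ l)) (l : L) (i : ι) :
    MemLp (fun t : L → ι → ℝ => t l i) 4 (Measure.pi ρ) := by
  have := fun l => (hρ l).isProbabilityMeasure
  exact ((hρ l).memLp i).comp_measurePreserving (measurePreserving_eval ρ l)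

theorem integral_coord (hρ : ∀ l, IsLocalLaw (ρ l)) (l : L) {f : (ι → ℝ) → ℝ}
    (hf : Measurable f) : ∫ t, f (t l) ∂(Measure.pi ρ) = ∫ x, f x ∂(ρ l) := by
  have := fun l => (hρ l).isProbabilityMeasure
  rw [← (measurePreserving_eval ρ l).map_eq, integral_map (measurable_pi_apply l).aemeasurable
    hf.aestronglyMeasurable]

theorem iIndepFun_coord (hρ : ∀ l, IsLocalLaw (ρ l)) :
    ProbabilityTheory.iIndepFun (fun l (t : L → ι → ℝ) => t l) (Measure.pi ρ) := by
  have := fun l => (hρ l).isProbabilityMeasure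
  exact ProbabilityTheory.iIndepFun_pi (X := fun _ x => x) fun l => aemeasurable_id

theorem integral_coord_mul_coord (hρ : ∀ l, IsLocalLaw (ρ l)) {l l' : L} (hl : l ≠ l') (i j : ι) :
    ∫ t, t l i * t l' j ∂(Measure.pi ρ) = (∫ x, x i ∂(ρ l)) * ∫ x, x j ∂(ρ l') := by
  have hI := ((iIndepFun_coord hρ).indepFun hl).comp (measurable_pi_apply i)
    (measurable_pi_apply j)
  rw [← integral_coord hρ l (measurable_pi_apply i), ← integral_coord hρ l' (measurable_pi_apply j)]
  exact hI.integral_fun_mul_eq_mul_integral (measurable_coord l i).aestronglyMeasurable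
    (measurable_coord l' j).aestronglyMeasurable

/-- The eigenvalue, at the configuration `x`, of the sum of the terms in `S`. -/
def sumEig {X : Type*} (S : Finset L) (r : X → L → ι) (t : L → ι → ℝ) (x : X) : ℝ :=
  ∑ l ∈ S, t l (r x l)

/-- The number of terms in `S` on which two configurations agree. -/
def agree {X : Type*} (S : Finset L) (r : X → L → ι) (x y : X) : ℝ :=
  ∑ l ∈ S, if r x l = r y l then 1 else 0

variable {X : Type*} {r : X → L → ι} {S : Finset L}

theorem memLp_sumEig (hρ : ∀ l, IsLocalLaw (ρ l)) (x : X) :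
    MemLp (fun t => sumEig S r t x) 4 (Measure.pi ρ) :=
  memLp_finsetSum _ fun l _ => memLp_coord hρ l _

/-- Two different bonds contribute the product of equal means, whatever the configurations; only l =
l' can tell x from y, and it does so through coincidence of levels. -/
theorem exists_integral_sumEig_mul (hρ : ∀ l, IsLocalLaw (ρ l)) {ν : Measure (ι → ℝ)}
    (hν : IsLocalLaw ν) (hS : ∀ l ∈ S, ρ l = ν) : ∃ K δ : ℝ, 0 < δ ∧
      ∀ x y : X, ∫ t, sumEig S r t x * sumEig S r t y ∂(Measure.pi ρ) = K + δ * agree S r x y := by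
  classical
  obtain ⟨t₀, δ, hδ, hmom⟩ := hν.exists_moments
  -- All levels have the same mean; if there are no levels, 0 serves as a dummy value.
  obtain ⟨c, hc⟩ : ∃ c, ∀ i, ∫ x, x i ∂ν = c := by
    by_cases hne : Nonempty ι
    · exact ⟨∫ x, x hne.some ∂ν, fun i => hν.integral_eq _ _⟩
    · exact ⟨0, fun i => (hne ⟨i⟩).elim⟩
  refine ⟨∑ l ∈ S, ∑ l' ∈ S, if l = l' then t₀ else c * c, δ, hδ, fun x y => ?_⟩
  have := fun l => (hρ l).isProbabilityMeasure
  have h2 : ∀ l i, MemLp (fun t : L → ι → ℝ => t l i) 2 (Measure.pi ρ) := fun l i =>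
    (memLp_coord hρ l i).mono_exponent (by norm_num)
  have hint : ∀ l l', Integrable (fun t : L → ι → ℝ => t l (r x l) * t l' (r y l'))
    (Measure.pi ρ) := fun l l' => (h2 _ _).integrable_mul (h2 _ _)
  simp only [sumEig, Finset.sum_mul_sum]
  rw [integral_finsetSum _ fun l _ => integrable_finsetSum _ fun l' _ => hint l l', agree,
    Finset.mul_sum, ← Finset.sum_add_distrib]
  refine Finset.sum_congr rfl fun l hl => ?_
  rw [integral_finsetSum _ fun l' _ => hint l l']
  have hval : ∀ l' ∈ S, ∫ t, t l (r x l) * t l' (r y l') ∂(Measure.pi ρ) =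
      (if l = l' then t₀ else c * c) +
        if l = l' then δ * (if r x l = r y l then 1 else 0) else 0 := by
    intro l' hl'
    by_cases hll : l = l'
    · subst hll
      rw [integral_coord hρ l (f := fun z => z (r x l) * z (r y l))
        ((measurable_pi_apply _).mul (measurable_pi_apply _)), hS l hl, hmom]
      simp
    · rw [integral_coord_mul_coord hρ hll, hS l hl, hS l' hl', hc, hc, if_neg hll, if_neg hll,
        add_zero]
  rw [Finset.sum_congr rfl hval, Finset.sum_add_distrib, Finset.sum_ite_eq, if_pos hl]

/-- The two factors are functions of disjoint blocks of independent coordinates. -/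
theorem integral_sumEig_mul_sumEig (hρ : ∀ l, IsLocalLaw (ρ l)) {S' : Finset L}
    (hd : Disjoint S S') (x y z w : X) :
    ∫ t, sumEig S r t x * sumEig S r t y * (sumEig S' r t z * sumEig S' r t w) ∂(Measure.pi ρ) =
      (∫ t, sumEig S r t x * sumEig S r t y ∂(Measure.pi ρ)) *
        ∫ t, sumEig S' r t z * sumEig S' r t w ∂(Measure.pi ρ) := by
  have hI := (iIndepFun_coord hρ).indepFun_finset S S' hd fun l => measurable_pi_apply l
  have hm : ∀ (T : Finset L) (x y : X), Measurable fun u : T → ι → ℝ =>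
      (∑ l : T, u l (r x l)) * ∑ l : T, u l (r y l) := fun T x y =>
    (Finset.measurable_sum _ fun l _ => measurable_coord l _).mul
      (Finset.measurable_sum _ fun l _ => measurable_coord l _)
  have hI2 := hI.comp (hm S x y) (hm S' z w)
  have he : ∀ (T : Finset L) (x y : X), ((fun u : T → ι → ℝ =>
      (∑ l : T, u l (r x l)) * ∑ l : T, u l (r y l)) ∘ fun (t : L → ι → ℝ) (l : T) => t l) =
      fun t => sumEig T r t x * sumEig T r t y := by
    intro T x y
    ext t
    simp only [Function.comp, sumEig]
    rw [← Finset.sum_coe_sort T fun l => t l (r x l), ← Finset.sum_coe_sort T fun l => t l (r y l)]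
  rw [he, he] at hI2
  have hms : ∀ (T : Finset L) (x : X), Measurable fun t : L → ι → ℝ => sumEig T r t x :=
    fun T x => Finset.measurable_sum _ fun l _ => measurable_coord l _
  exact hI2.integral_fun_mul_eq_mul_integral
    ((hms S x).mul (hms S y)).aestronglyMeasurable ((hms S' z).mul (hms S' w)).aestronglyMeasurable

end Independent

/-! ## The dependence on the eigenvectors factors out -/

section Coupling

variable {X L ι 𝕜 Ω : Type*} [Fintype X] [DecidableEq X] [Fintype L] [Fintype ι] [DecidableEq ι]
  [RCLike 𝕜] [MeasurableSpace Ω] {r : X → L → ι} {S S' : Finset L}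

/-- The contribution of the eigenvectors to `𝔼 Tr (A B')²`. -/
def coupling (S S' : Finset L) (r : X → L → ι) (P : Measure Ω) (V : Ω → Matrix X X 𝕜) : ℝ :=
  ∑ x, ∑ y, ∑ z, ∑ w, agree S r x y * agree S' r z w * quartic P V x y z w

theorem agree_self (x : X) : agree S r x x = S.card := by
  simp [agree]

/-- In the product of the two affine second moments, every term lacking one of the `agree` factors
has a free sum over (x, y) or over (z, w). Unitarity turns that sum into a Kronecker delta, and on
the diagonal `agree` is the number of bonds. -/
theorem IsMixing.expTrace_sq_eq {P : Measure Ω} {V : Ω → Matrix X X 𝕜} (h : IsMixing P V)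
    {ρ : L → Measure (ι → ℝ)} (hρ : ∀ l, IsLocalLaw (ρ l)) (hd : Disjoint S S') {K δ K' δ' : ℝ}
    (hS : ∀ x y : X, ∫ t, sumEig S r t x * sumEig S r t y ∂(Measure.pi ρ) = K + δ * agree S r x y)
    (hS' : ∀ x y : X, ∫ t, sumEig S' r t x * sumEig S' r t y ∂(Measure.pi ρ) =
      K' + δ' * agree S' r x y) :
    expTrace ((Measure.pi ρ).prod P) (fun ω =>
      (realDiag 𝕜 (sumEig S r ω.1) * conjDiag (V ω.2) (sumEig S' r ω.1)) ^ 2) =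
      Fintype.card X * (K * K' + K * δ' * S'.card + K' * δ * S.card) +
        δ * δ' * coupling S S' r P V := by
  have := fun l => (hρ l).isProbabilityMeasure
  rw [(h.expTrace_sq (fun x => memLp_sumEig hρ x) (fun x => memLp_sumEig hρ x)).2]
  simp only [integral_sumEig_mul_sumEig hρ hd, hS, hS']
  have e : ∀ x y z w : X, (K + δ * agree S r x y) * (K' + δ' * agree S' r z w) *
      quartic P V x y z w = K * (K' + δ' * agree S' r z w) * quartic P V x y z w +
      K' * δ * (agree S r x y * quartic P V x y z w) +
      δ * δ' * (agree S r x y * agree S' r z w * quartic P V x y z w) := by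
    intro x y z w
    ring
  simp only [e, Finset.sum_add_distrib]
  have e1 : ∑ x, ∑ y, ∑ z, ∑ w, K * (K' + δ' * agree S' r z w) * quartic P V x y z w =
      Fintype.card X * (K * (K' + δ' * S'.card)) := by
    calc _ = ∑ z, ∑ w, K * (K' + δ' * agree S' r z w) * ∑ x, ∑ y, quartic P V x y z w := by
          simp only [Finset.mul_sum]
          calc _ = ∑ x, ∑ z, ∑ y, ∑ w, K * (K' + δ' * agree S' r z w) * quartic P V x y z w :=
                Finset.sum_congr rfl fun x _ => Finset.sum_comm
            _ = ∑ z, ∑ x, ∑ w, ∑ y, K * (K' + δ' * agree S' r z w) * quartic P V x y z w := by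
                rw [Finset.sum_comm]
                exact Finset.sum_congr rfl fun z _ => Finset.sum_congr rfl fun x _ =>
                  Finset.sum_comm
            _ = _ := Finset.sum_congr rfl fun z _ => Finset.sum_comm
      _ = _ := by simp [h.sum_quartic_left, agree_self]
  have e2 : ∑ x, ∑ y, ∑ z, ∑ w, K' * δ * (agree S r x y * quartic P V x y z w) =
      Fintype.card X * (K' * δ * S.card) := by
    simp only [← Finset.mul_sum, h.sum_quartic_right]
    simp [agree_self]
    ring
  rw [e1, e2]
  simp only [← Finset.mul_sum]
  rw [coupling]
  ring

end Coupling

/-! ### The coupling as the expectation of a pointwise sum. -/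

section CouplingIntegral

variable {X L ι 𝕜 Ω : Type*} [Fintype X] [DecidableEq X] [Fintype L] [Fintype ι] [DecidableEq ι]
  [RCLike 𝕜] [MeasurableSpace Ω] {r : X → L → ι} {S S' : Finset L}

theorem IsMixing.coupling_eq_integral {P : Measure Ω} {V : Ω → Matrix X X 𝕜} (h : IsMixing P V) :
    coupling S S' r P V = ∫ ω, ∑ x, ∑ y, ∑ z, ∑ w, agree S r x y * agree S' r z w *
      RCLike.re (starRingEnd 𝕜 (V ω z x) * V ω z y * (starRingEnd 𝕜 (V ω w y) * V ω w x)) ∂P := by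
  have hi : ∀ x y z w, Integrable (fun ω => agree S r x y * agree S' r z w *
      RCLike.re (starRingEnd 𝕜 (V ω z x) * V ω z y *
        (starRingEnd 𝕜 (V ω w y) * V ω w x))) P := fun x y z w =>
    (h.integrable_quartic x y z w).re.const_mul _
  rw [coupling, integral_finsetSum _ fun x _ => integrable_finsetSum _ fun y _ =>
    integrable_finsetSum _ fun z _ => integrable_finsetSum _ fun w _ => hi x y z w]
  refine Finset.sum_congr rfl fun x _ => ?_
  rw [integral_finsetSum _ fun y _ =>
    integrable_finsetSum _ fun z _ => integrable_finsetSum _ fun w _ => hi x y z w]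
  refine Finset.sum_congr rfl fun y _ => ?_
  rw [integral_finsetSum _ fun z _ => integrable_finsetSum _ fun w _ => hi x y z w]
  refine Finset.sum_congr rfl fun z _ => ?_
  rw [integral_finsetSum _ fun w _ => hi x y z w]
  exact Finset.sum_congr rfl fun w _ => (integral_const_mul _ _).symm

end CouplingIntegral

/-! ## Random permutations -/

section Classical

variable {X L ι 𝕜 : Type*} [Fintype X] [DecidableEq X] [Fintype L] [Fintype ι] [DecidableEq ι]
  [RCLike 𝕜] {r : X → L → ι} {S S' : Finset L}

instance instIsProbabilityMeasureUniformPerm : IsProbabilityMeasure (uniformPerm X) := by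
  unfold uniformPerm; infer_instance

theorem permMatrix_apply (σ : Equiv.Perm X) (z x : X) :
    σ.permMatrix 𝕜 z x = if σ z = x then 1 else 0 := by
  simp [Equiv.Perm.permMatrix, PEquiv.toMatrix_apply, eq_comm]

theorem integral_uniformPerm_mul (f : Equiv.Perm X → ℝ) (τ : Equiv.Perm X) :
    ∫ σ, f (τ * σ) ∂(uniformPerm X) = ∫ σ, f σ ∂(uniformPerm X) := by
  rw [uniformPerm, PMF.integral_eq_sum, PMF.integral_eq_sum]
  simp only [PMF.uniformOfFintype_apply]
  exact Fintype.sum_equiv (Equiv.mulLeft τ) _ _ fun σ => rfl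

/-- Flatness of the second moments is obtained from this in all three models: a transitive symmetry
makes them equal, and unitarity normalises their sum. -/
theorem eq_inv_card_of_sum {f : X → ℝ} (hf : ∀ x y, f x = f y) (hs : ∑ x, f x = 1) (x : X) :
    f x = (Fintype.card X : ℝ)⁻¹ := by
  rw [Finset.sum_congr rfl fun y _ => hf y x, Finset.sum_const, Finset.card_univ,
    nsmul_eq_mul] at hs
  exact eq_inv_of_mul_eq_one_right hs

theorem isMixing_permMatrix :
    IsMixing (uniformPerm X) fun σ : Equiv.Perm X => σ.permMatrix 𝕜 where
  isProbabilityMeasure := inferInstance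
  aestronglyMeasurable z x := (measurable_from_top).aestronglyMeasurable
  mem_unitaryGroup σ := (permUnitary 𝕜 σ).2
  integral_norm_sq z x := by
    refine eq_inv_card_of_sum (f := fun x => ∫ σ : Equiv.Perm X, ‖σ.permMatrix 𝕜 z x‖ ^ 2
      ∂(uniformPerm X)) (fun x y => ?_) ?_ x
    · rw [← integral_uniformPerm_mul _ (Equiv.swap x y)]
      refine integral_congr_ae (Filter.Eventually.of_forall fun σ => ?_)
      simp only [permMatrix_apply, Equiv.Perm.mul_apply]
      congr 3
      rw [Equiv.swap_apply_eq_iff, Equiv.swap_apply_left]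
    · have hi : ∀ x, Integrable (fun σ : Equiv.Perm X => ‖σ.permMatrix 𝕜 z x‖ ^ 2)
          (uniformPerm X) := fun x => by
        rw [uniformPerm]
        exact Integrable.of_finite
      rw [← integral_finsetSum _ fun x _ => hi x]
      have : ∀ σ : Equiv.Perm X, ∑ x, ‖σ.permMatrix 𝕜 z x‖ ^ 2 = 1 := fun σ => by
        rw [Finset.sum_eq_single (σ z)] <;> simp +contextual [eq_comm]
      simp only [this]
      simp

/-- For a permutation matrix the quartic product is nonzero only if x = y and z = w is the preimage
of x, so each of the m configurations contributes two diagonal values of `agree`. -/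
theorem coupling_permMatrix :
    coupling S S' r (uniformPerm X) (fun σ : Equiv.Perm X => σ.permMatrix 𝕜) =
      S.card * S'.card * Fintype.card X := by
  rw [isMixing_permMatrix.coupling_eq_integral]
  have h : ∀ σ : Equiv.Perm X, ∑ x, ∑ y, ∑ z, ∑ w, agree S r x y * agree S' r z w *
      RCLike.re (starRingEnd 𝕜 (σ.permMatrix 𝕜 z x) * σ.permMatrix 𝕜 z y *
        (starRingEnd 𝕜 (σ.permMatrix 𝕜 w y) * σ.permMatrix 𝕜 w x)) =
      S.card * S'.card * Fintype.card X := by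
    intro σ
    have h1 : ∀ x y z w, agree S r x y * agree S' r z w *
        RCLike.re (starRingEnd 𝕜 (σ.permMatrix 𝕜 z x) * σ.permMatrix 𝕜 z y *
          (starRingEnd 𝕜 (σ.permMatrix 𝕜 w y) * σ.permMatrix 𝕜 w x)) =
        if w = σ.symm x then (if z = σ.symm x then (if y = x then
          (S.card : ℝ) * S'.card else 0) else 0) else 0 := by
      intro x y z w
      simp only [permMatrix_apply, Equiv.eq_symm_apply]
      by_cases hw : σ w = x
      · by_cases hz : σ z = x
        · by_cases hy : y = x
          · have : z = w := σ.injective (hz.trans hw.symm)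
            subst hy this
            simp [hz, agree_self]
          · have : x ≠ y := fun h => hy h.symm
            simp [hw, hz, hy, this]
        · simp [hz]
      · simp [hw]
    simp only [h1, Finset.sum_ite_eq', Finset.mem_univ, if_true]
    simp [mul_comm]
  simp only [h]
  simp

end Classical

/-! ## Haar matrices -/

section Isotropic

variable {X L ι 𝕜 : Type*} [Fintype X] [DecidableEq X] [Fintype L] [Fintype ι] [DecidableEq ι]
  [RCLike 𝕜] {r : X → L → ι} {S S' : Finset L}

theorem sum_norm_sq_col {V : Matrix X X 𝕜} (hV : V ∈ Matrix.unitaryGroup X 𝕜) (x : X) :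
    ∑ z, ‖V z x‖ ^ 2 = 1 := by
  have h := congrArg RCLike.re (congrFun (congrFun (conjTranspose_mul_of_mem hV) x) x)
  simp only [Matrix.mul_apply, Matrix.conjTranspose_apply, RCLike.star_def, RCLike.conj_mul,
    map_sum, Matrix.one_apply_eq, RCLike.one_re] at h
  rw [← h]
  exact Finset.sum_congr rfl fun x _ => by norm_cast

theorem isMixing_haar :
    IsMixing (haar X 𝕜) fun Q : Matrix.unitaryGroup X 𝕜 => (Q : Matrix X X 𝕜) where
  isProbabilityMeasure := inferInstance
  aestronglyMeasurable z x := (continuous_entry z x).aestronglyMeasurable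
  mem_unitaryGroup Q := Q.2
  integral_norm_sq z x := by
    refine eq_inv_card_of_sum (f := fun z => ∫ Q : Matrix.unitaryGroup X 𝕜,
      ‖(Q : Matrix X X 𝕜) z x‖ ^ 2 ∂(haar X 𝕜)) (fun z w => ?_) ?_ z
    · rw [← integral_mul_left_eq_self (μ := haar X 𝕜) _ (permUnitary 𝕜 (Equiv.swap w z))]
      simp [permUnitary_mul_apply]
    · have hi : ∀ z, Integrable (fun Q : Matrix.unitaryGroup X 𝕜 => ‖(Q : Matrix X X 𝕜) z x‖ ^ 2)
          (haar X 𝕜) := fun z => integrable_of_continuous ((continuous_entry z x).norm.pow 2)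
      rw [← integral_finsetSum _ fun z _ => hi z]
      simp [fun Q : Matrix.unitaryGroup X 𝕜 => sum_norm_sq_col Q.2 x]

variable (X 𝕜) in
/-- The quartic moments of a Haar matrix. -/
def haarQuartic (x y z w : X) : ℝ :=
  quartic (haar X 𝕜) (fun Q : Matrix.unitaryGroup X 𝕜 => (Q : Matrix X X 𝕜)) x y z w

theorem haarQuartic_perm_left (σ : Equiv.Perm X) (x y z w : X) :
    haarQuartic X 𝕜 x y (σ z) (σ w) = haarQuartic X 𝕜 x y z w := by
  have h := integral_mul_left_eq_self (μ := haar X 𝕜) (fun Q : Matrix.unitaryGroup X 𝕜 =>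
    RCLike.re (starRingEnd 𝕜 ((Q : Matrix X X 𝕜) z x) * (Q : Matrix X X 𝕜) z y *
      (starRingEnd 𝕜 ((Q : Matrix X X 𝕜) w y) * (Q : Matrix X X 𝕜) w x))) (permUnitary 𝕜 σ)
  simp only [permUnitary_mul_apply] at h
  exact h

theorem haarQuartic_perm_right (σ : Equiv.Perm X) (x y z w : X) :
    haarQuartic X 𝕜 (σ x) (σ y) z w = haarQuartic X 𝕜 x y z w := by
  have h := integral_mul_right_eq_self (μ := haar X 𝕜) (fun Q : Matrix.unitaryGroup X 𝕜 =>
    RCLike.re (starRingEnd 𝕜 ((Q : Matrix X X 𝕜) z x) * (Q : Matrix X X 𝕜) z y *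
      (starRingEnd 𝕜 ((Q : Matrix X X 𝕜) w y) * (Q : Matrix X X 𝕜) w x)))
    (permUnitary 𝕜 σ.symm)
  simp only [mul_permUnitary_apply, Equiv.symm_symm] at h
  exact h

theorem integrable_haarQuartic (x y z w : X) :
    Integrable (fun Q : Matrix.unitaryGroup X 𝕜 =>
      RCLike.re (starRingEnd 𝕜 ((Q : Matrix X X 𝕜) z x) * (Q : Matrix X X 𝕜) z y *
        (starRingEnd 𝕜 ((Q : Matrix X X 𝕜) w y) * (Q : Matrix X X 𝕜) w x))) (haar X 𝕜) :=
  (isMixing_haar.integrable_quartic x y z w).re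

/-- The sum over y produces (VV†)_zw, and what remains for z = w is |V_zx|². -/
theorem sum_haarQuartic_right (x z w : X) :
    ∑ y, haarQuartic X 𝕜 x y z w = if z = w then (Fintype.card X : ℝ)⁻¹ else 0 := by
  simp only [haarQuartic, quartic]
  rw [← integral_finsetSum _ fun y _ => integrable_haarQuartic x y z w]
  have h : ∀ Q : Matrix.unitaryGroup X 𝕜,
      ∑ y, RCLike.re (starRingEnd 𝕜 ((Q : Matrix X X 𝕜) z x) * (Q : Matrix X X 𝕜) z y *
        (starRingEnd 𝕜 ((Q : Matrix X X 𝕜) w y) * (Q : Matrix X X 𝕜) w x)) =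
      if z = w then ‖(Q : Matrix X X 𝕜) z x‖ ^ 2 else 0 := by
    intro Q
    have hU := congrFun (congrFun (mul_conjTranspose_of_mem Q.2) z) w
    rw [Matrix.mul_apply] at hU
    simp only [Matrix.conjTranspose_apply, RCLike.star_def] at hU
    have : ∑ y, starRingEnd 𝕜 ((Q : Matrix X X 𝕜) z x) * (Q : Matrix X X 𝕜) z y *
        (starRingEnd 𝕜 ((Q : Matrix X X 𝕜) w y) * (Q : Matrix X X 𝕜) w x) =
        starRingEnd 𝕜 ((Q : Matrix X X 𝕜) z x) * (Q : Matrix X X 𝕜) w x *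
          ∑ y, (Q : Matrix X X 𝕜) z y * starRingEnd 𝕜 ((Q : Matrix X X 𝕜) w y) := by
      rw [Finset.mul_sum]
      exact Finset.sum_congr rfl fun y _ => by ring
    rw [← map_sum, this, hU]
    by_cases hzw : z = w
    · subst hzw
      rw [Matrix.one_apply_eq, mul_one, RCLike.conj_mul, if_pos rfl]
      norm_cast
    · simp [hzw]
  simp only [h]
  by_cases hzw : z = w
  · simp only [if_pos hzw]
    exact isMixing_haar.integral_norm_sq z x
  · simp [hzw]

theorem sum_haarQuartic_left (x z : X) :
    ∑ w, haarQuartic X 𝕜 x x z w = (Fintype.card X : ℝ)⁻¹ := by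
  simp only [haarQuartic, quartic]
  rw [← integral_finsetSum _ fun w _ => integrable_haarQuartic x x z w]
  have h : ∀ Q : Matrix.unitaryGroup X 𝕜,
      ∑ w, RCLike.re (starRingEnd 𝕜 ((Q : Matrix X X 𝕜) z x) * (Q : Matrix X X 𝕜) z x *
        (starRingEnd 𝕜 ((Q : Matrix X X 𝕜) w x) * (Q : Matrix X X 𝕜) w x)) =
      ‖(Q : Matrix X X 𝕜) z x‖ ^ 2 := by
    intro Q
    have h1 : ∀ w, RCLike.re (starRingEnd 𝕜 ((Q : Matrix X X 𝕜) z x) * (Q : Matrix X X 𝕜) z x *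
        (starRingEnd 𝕜 ((Q : Matrix X X 𝕜) w x) * (Q : Matrix X X 𝕜) w x)) =
        ‖(Q : Matrix X X 𝕜) z x‖ ^ 2 * ‖(Q : Matrix X X 𝕜) w x‖ ^ 2 := by
      intro w
      rw [RCLike.conj_mul, RCLike.conj_mul]
      norm_cast
    simp only [h1]
    rw [← Finset.mul_sum, sum_norm_sq_col Q.2, mul_one]
  simp only [h]
  exact isMixing_haar.integral_norm_sq z x

variable (X 𝕜) in
/-- The fourth absolute moment of an entry of a Haar matrix. -/
def haarFourth (z x : X) : ℝ :=
  ∫ Q : Matrix.unitaryGroup X 𝕜, ‖(Q : Matrix X X 𝕜) z x‖ ^ 4 ∂(haar X 𝕜)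

theorem haarQuartic_diag (x z : X) : haarQuartic X 𝕜 x x z z = haarFourth X 𝕜 z x := by
  refine integral_congr_ae (Filter.Eventually.of_forall fun Q => ?_)
  simp only [RCLike.conj_mul]
  norm_cast
  ring

theorem haarFourth_eq (z x w y : X) : haarFourth X 𝕜 z x = haarFourth X 𝕜 w y := by
  rw [← haarQuartic_diag, ← haarQuartic_diag]
  have h1 := haarQuartic_perm_left (𝕜 := 𝕜) (Equiv.swap z w) x x z z
  have h2 := haarQuartic_perm_right (𝕜 := 𝕜) (Equiv.swap x y) x x w w
  rw [Equiv.swap_apply_left] at h1 h2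
  rw [h2, h1]

theorem sum_eq_of_const_off {f : X → ℝ} (x y : X)
    (hf : ∀ y', y' ≠ x → f y' = f y) : ∑ y', f y' = f x + (Fintype.card X - 1) * f y := by
  rw [← Finset.add_sum_erase _ _ (Finset.mem_univ x), Finset.sum_congr rfl fun y' hy' =>
    hf y' (Finset.ne_of_mem_erase hy'), Finset.sum_const, Finset.card_erase_of_mem
    (Finset.mem_univ x), Finset.card_univ, nsmul_eq_mul, Nat.cast_sub, Nat.cast_one]
  exact Fintype.card_pos_iff.mpr ⟨x⟩

/-- All quartic moments of a Haar matrix in terms of the fourth absolute moment. -/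
theorem haarQuartic_eq (hX : 2 ≤ Fintype.card X) (x y z w a b : X) :
    haarQuartic X 𝕜 x y z w = if x = y then
      (if z = w then haarFourth X 𝕜 a b else
        ((Fintype.card X : ℝ)⁻¹ - haarFourth X 𝕜 a b) / (Fintype.card X - 1))
      else (if z = w then ((Fintype.card X : ℝ)⁻¹ - haarFourth X 𝕜 a b) / (Fintype.card X - 1)
        else -((Fintype.card X : ℝ)⁻¹ - haarFourth X 𝕜 a b) / (Fintype.card X - 1) ^ 2) := by
  have hm : (0 : ℝ) < Fintype.card X - 1 := by
    have : (2 : ℝ) ≤ Fintype.card X := by exact_mod_cast hX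
    linarith
  -- Row permutations fixing z make all values with w ≠ z equal; since columns have norm one, these
  -- m − 1 equal values and the fourth moment add up to 1/m.
  have hrow : ∀ x z w : X, z ≠ w → haarQuartic X 𝕜 x x z w =
      ((Fintype.card X : ℝ)⁻¹ - haarFourth X 𝕜 a b) / (Fintype.card X - 1) := by
    intro x z w hzw
    have h1 := sum_haarQuartic_left (𝕜 := 𝕜) x z
    rw [sum_eq_of_const_off z w, haarQuartic_diag, haarFourth_eq z x a b] at h1
    · rw [eq_div_iff hm.ne']
      linarith
    · intro w' hw'
      rw [← haarQuartic_perm_left (𝕜 := 𝕜) (Equiv.swap w w') x x z w, Equiv.swap_apply_left,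
        Equiv.swap_apply_of_ne_of_ne hzw hw'.symm]
  -- Column permutations fixing x make the m − 1 values with y ≠ x equal, and orthonormality of the
  -- rows gives their sum.
  have hcol : ∀ z x y w : X, x ≠ y → haarQuartic X 𝕜 x x z w + (Fintype.card X - 1) *
      haarQuartic X 𝕜 x y z w = if z = w then (Fintype.card X : ℝ)⁻¹ else 0 := by
    intro z x y w hxy
    rw [← sum_haarQuartic_right (𝕜 := 𝕜) x z w, sum_eq_of_const_off x y]
    intro y' hy'
    rw [← haarQuartic_perm_right (𝕜 := 𝕜) (Equiv.swap y y') x y z w, Equiv.swap_apply_left,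
      Equiv.swap_apply_of_ne_of_ne hxy hy'.symm]
  by_cases hxy : x = y
  · subst hxy
    by_cases hzw : z = w
    · subst hzw
      rw [if_pos rfl, if_pos rfl, haarQuartic_diag, haarFourth_eq z x a b]
    · rw [if_pos rfl, if_neg hzw, hrow x z w hzw]
  · have h := hcol z x y w hxy
    rw [if_neg hxy]
    by_cases hzw : z = w
    · subst hzw
      rw [if_pos rfl, haarQuartic_diag, haarFourth_eq z x a b] at h
      rw [if_pos rfl, eq_div_iff hm.ne']
      linarith
    · rw [if_neg hzw, hrow x z w hzw] at h
      rw [if_neg hzw, eq_div_iff (pow_pos hm 2).ne']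
      field_simp at h
      have h2 : haarQuartic X 𝕜 x y z w * (Fintype.card X - 1) ^ 2 +
        ((Fintype.card X : ℝ)⁻¹ - haarFourth X 𝕜 a b) = 0 := by
        field_simp
        linarith
      linarith

theorem sum_agree {f : ℝ} (hf : ∀ l, ∑ x : X, ∑ y : X, (if r x l = r y l then (1 : ℝ) else 0) = f) :
    ∑ x : X, ∑ y : X, agree S r x y = S.card * f := by
  simp only [agree]
  rw [Finset.sum_congr rfl fun x _ => Finset.sum_comm, Finset.sum_comm]
  simp only [hf, Finset.sum_const, nsmul_eq_mul]

/-- The number f is the mean number of configurations sharing the level of a given one at a bond; on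
the chain it is m/d². -/
theorem coupling_haar (hX : 2 ≤ Fintype.card X) {f : ℝ}
    (hf : ∀ l, ∑ x : X, ∑ y : X, (if r x l = r y l then (1 : ℝ) else 0) = Fintype.card X * f)
    (a b : X) :
    S.card * S'.card * Fintype.card X -
      coupling S S' r (haar X 𝕜) (fun Q : Matrix.unitaryGroup X 𝕜 => (Q : Matrix X X 𝕜)) =
      S.card * S'.card * Fintype.card X * (1 - Fintype.card X * haarFourth X 𝕜 a b) *
        ((Fintype.card X - f) / (Fintype.card X - 1)) ^ 2 := by
  have hm : (0 : ℝ) < Fintype.card X - 1 := by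
    have : (2 : ℝ) ≤ Fintype.card X := by exact_mod_cast hX
    linarith
  have hm0 : (Fintype.card X : ℝ) ≠ 0 := by linarith
  set m : ℝ := ((Fintype.card X : ℕ) : ℝ) with hmdef
  set h := haarFourth X 𝕜 a b with hh
  set k := (m⁻¹ - h) / (m - 1) with hk
  set c := -(m⁻¹ - h) / (m - 1) ^ 2 with hc
  -- The quartic moment depends only on whether x = y and whether z = w. Written in the products of
  -- these two indicators, each fourfold sum splits into a sum over (x, y) times a sum over (z, w).
  have hq : ∀ x y z w, haarQuartic X 𝕜 x y z w = c + (k - c) * (if x = y then 1 else 0) +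
      (k - c) * (if z = w then 1 else 0) +
      (h - 2 * k + c) * ((if x = y then 1 else 0) * (if z = w then 1 else 0)) := by
    intro x y z w
    rw [haarQuartic_eq hX x y z w a b]
    split_ifs <;> ring
  have hcoup : coupling S S' r (haar X 𝕜)
      (fun Q : Matrix.unitaryGroup X 𝕜 => (Q : Matrix X X 𝕜)) =
      c * ((S.card * (m * f)) * (S'.card * (m * f))) +
      (k - c) * ((S.card * m) * (S'.card * (m * f))) +
      (k - c) * ((S.card * (m * f)) * (S'.card * m)) +
      (h - 2 * k + c) * ((S.card * m) * (S'.card * m)) := by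
    have e1 : coupling S S' r (haar X 𝕜)
        (fun Q : Matrix.unitaryGroup X 𝕜 => (Q : Matrix X X 𝕜)) =
        ∑ x, ∑ y, ∑ z, ∑ w, agree S r x y * agree S' r z w * haarQuartic X 𝕜 x y z w := rfl
    have e2 : ∀ x y z w, agree S r x y * agree S' r z w * haarQuartic X 𝕜 x y z w =
        c * (agree S r x y * agree S' r z w) +
        (k - c) * ((agree S r x y * if x = y then 1 else 0) * agree S' r z w) +
        (k - c) * (agree S r x y * (agree S' r z w * if z = w then 1 else 0)) +
        (h - 2 * k + c) * ((agree S r x y * if x = y then 1 else 0) *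
          (agree S' r z w * if z = w then 1 else 0)) := by
      intro x y z w
      rw [hq]
      ring
    have e3 : ∀ T : Finset L, ∑ x : X, ∑ y : X, (agree T r x y * if x = y then 1 else 0) =
        T.card * m := by
      intro T
      simp [agree_self, hmdef, mul_comm]
    rw [e1]
    simp only [e2, Finset.sum_add_distrib, ← Finset.mul_sum, ← Finset.sum_mul, e3, sum_agree hf]
  rw [hcoup, hc, hk]
  field_simp
  ring

/-- The reflection `1 - (2 / m) J`, where all entries of `J` are one. -/
theorem reflection_mem_unitaryGroup [Nonempty X] :
    (Matrix.of fun i j : X => (if i = j then (1 : 𝕜) else 0) - 2 / (Fintype.card X : 𝕜)) ∈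
      Matrix.unitaryGroup X 𝕜 := by
  have hm : (Fintype.card X : 𝕜) ≠ 0 := by exact_mod_cast Fintype.card_ne_zero
  rw [Matrix.mem_unitaryGroup_iff]
  ext i j
  simp only [Matrix.mul_apply, Matrix.star_apply, Matrix.of_apply, RCLike.star_def, map_sub,
    map_div₀, apply_ite (starRingEnd 𝕜), map_one, map_zero, map_ofNat, map_natCast, sub_mul,
    mul_sub, Finset.sum_sub_distrib, Matrix.one_apply, ite_mul, mul_ite, one_mul, zero_mul,
    mul_one, mul_zero, Finset.sum_ite_eq, Finset.mem_univ, if_true, Finset.sum_const,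
    Finset.card_univ, nsmul_eq_mul]
  by_cases hij : i = j
  · subst hij
    simp
    field_simp
    ring
  · simp [hij]
    field_simp
    ring

/-- Entries satisfy |q|⁴ ≤ |q|², so m𝔼|q|⁴ ≤ m𝔼|q|² = 1. By continuity and full support of Haar
measure, one matrix with 0 < |q_ab| < 1 makes this strict. The reflection does so for every a, b
once m ≥ 3; for m = 2 its entries are 0 and −1. -/
theorem card_mul_haarFourth_lt_one (hX : 3 ≤ Fintype.card X) (a b : X) :
    Fintype.card X * haarFourth X 𝕜 a b < 1 := by
  have : Nonempty X := ⟨a⟩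
  have hc := continuous_entry (𝕜 := 𝕜) a b
  have hm : (3 : ℝ) ≤ Fintype.card X := by exact_mod_cast hX
  have hpos : 0 < ∫ Q : Matrix.unitaryGroup X 𝕜, (‖(Q : Matrix X X 𝕜) a b‖ ^ 2 -
      ‖(Q : Matrix X X 𝕜) a b‖ ^ 4) ∂(haar X 𝕜) := by
    refine Continuous.integral_pos_of_hasCompactSupport_nonneg_nonzero
      (x := ⟨_, reflection_mem_unitaryGroup⟩) ((hc.norm.pow 2).sub (hc.norm.pow 4))
      (HasCompactSupport.of_compactSpace _) (fun Q => ?_) ?_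
    · have h1 : ‖(Q : Matrix X X 𝕜) a b‖ ≤ 1 := entry_norm_bound_of_unitary Q.2 a b
      have h2 := pow_le_pow_of_le_one (norm_nonneg _) h1 (show 2 ≤ 4 by norm_num)
      simpa using h2
    · have key : ∀ t : ℝ, 0 < |t| → |t| < 1 → |t| ^ 2 - |t| ^ 4 ≠ 0 := by
        intro t h0 h1
        have h2 : |t| ^ 2 < 1 := by nlinarith
        have h3 : 0 < |t| ^ 2 := by positivity
        nlinarith
      have hval : ∀ t : ℝ, ‖(t : 𝕜)‖ = |t| := fun t => RCLike.norm_ofReal t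
      simp only [Matrix.of_apply]
      have hcast : (if a = b then (1 : 𝕜) else 0) - 2 / (Fintype.card X : 𝕜) =
          (((if a = b then (1 : ℝ) else 0) - 2 / (Fintype.card X : ℝ) : ℝ) : 𝕜) := by
        push_cast
        split_ifs <;> simp
      rw [hcast, hval]
      have hd : 2 / (Fintype.card X : ℝ) ≤ 2 / 3 := by gcongr
      have hd0 : 0 < 2 / (Fintype.card X : ℝ) := by positivity
      refine key _ ?_ ?_
      · rw [abs_pos]
        split_ifs <;> linarith
      · rw [abs_lt]
        split_ifs <;> constructor <;> linarith
  have hi : ∀ j, Integrable (fun Q : Matrix.unitaryGroup X 𝕜 => ‖(Q : Matrix X X 𝕜) a b‖ ^ j)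
    (haar X 𝕜) := fun j => integrable_of_continuous (hc.norm.pow j)
  rw [integral_sub (hi 2) (hi 4), isMixing_haar.integral_norm_sq] at hpos
  have : haarFourth X 𝕜 a b < (Fintype.card X : ℝ)⁻¹ := by
    rw [haarFourth]
    linarith
  calc Fintype.card X * haarFourth X 𝕜 a b < Fintype.card X * (Fintype.card X : ℝ)⁻¹ :=
        mul_lt_mul_of_pos_left this (by linarith)
    _ = 1 := mul_inv_cancel₀ (by linarith)

end Isotropic

/-! ## Operators on bonds of the chain -/

section Local

variable {N d : ℕ} {𝕜 : Type*} [RCLike 𝕜]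

/-- The tensor product of matrices on pairwise disjoint bonds. -/
def tensorOf (S : Finset (Fin (N - 1))) (M : Fin (N - 1) → Matrix (Fin d × Fin d) (Fin d × Fin d) 𝕜) :
    Matrix (Fin N → Fin d) (Fin N → Fin d) 𝕜 :=
  Matrix.of fun x y => (∏ l ∈ S, M l (atBond x l) (atBond y l)) *
    if ∀ s : Fin N, (∀ l ∈ S, s ≠ left l ∧ s ≠ right l) → x s = y s then 1 else 0

theorem bondTensor_eq_tensorOf (S : Finset (Fin (N - 1))) (Q : LocalUnitaries N d 𝕜) :
    bondTensor S Q = tensorOf S fun l => (Q l : Matrix (Fin d × Fin d) (Fin d × Fin d) 𝕜) := rfl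

/-- A matrix that acts on one bond. -/
def loc (l : Fin (N - 1)) (P : Matrix (Fin d × Fin d) (Fin d × Fin d) 𝕜) :
    Matrix (Fin N → Fin d) (Fin N → Fin d) 𝕜 :=
  Matrix.of fun x y => P (atBond x l) (atBond y l) *
    if ∀ s : Fin N, s ≠ left l → s ≠ right l → x s = y s then 1 else 0

/-- Bonds without a common site. -/
def Far (l l' : Fin (N - 1)) : Prop := l.1 + 2 ≤ l'.1 ∨ l'.1 + 2 ≤ l.1

theorem Far.ne {l l' : Fin (N - 1)} (h : Far l l') :
    left l ≠ left l' ∧ left l ≠ right l' ∧ right l ≠ left l' ∧ right l ≠ right l' := by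
  simp only [Far, left, right, ne_eq, Fin.mk.injEq] at *
  omega

theorem left_ne_right (l : Fin (N - 1)) : left l ≠ right l := by
  simp [left, right]

theorem tensorOf_conjTranspose (S : Finset (Fin (N - 1)))
    (M : Fin (N - 1) → Matrix (Fin d × Fin d) (Fin d × Fin d) 𝕜) :
    (tensorOf S M)ᴴ = tensorOf S fun l => (M l)ᴴ := by
  ext x y
  simp only [tensorOf, Matrix.conjTranspose_apply, Matrix.of_apply, star_mul', star_prod,
    apply_ite star, star_one, star_zero, eq_comm]

theorem loc_conjTranspose (l : Fin (N - 1)) (P : Matrix (Fin d × Fin d) (Fin d × Fin d) 𝕜) :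
    (loc l P)ᴴ = loc l Pᴴ := by
  ext x y
  simp only [loc, Matrix.conjTranspose_apply, Matrix.of_apply, star_mul', apply_ite star,
    star_one, star_zero, eq_comm]

theorem tensorOf_singleton (l : Fin (N - 1))
    (M : Fin (N - 1) → Matrix (Fin d × Fin d) (Fin d × Fin d) 𝕜) :
    tensorOf {l} M = loc l (M l) := by
  ext x y
  simp [tensorOf, loc]

theorem tensorOf_empty (M : Fin (N - 1) → Matrix (Fin d × Fin d) (Fin d × Fin d) 𝕜) :
    tensorOf ∅ M = 1 := by
  ext x y
  simp [tensorOf, Matrix.one_apply, funext_iff]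

/-- Adding one far bond at a time reduces tensor products to products of one-bond operators. -/
theorem loc_mul_tensorOf {l : Fin (N - 1)} {S : Finset (Fin (N - 1))} (hS : ∀ l' ∈ S, Far l l')
    (P : Matrix (Fin d × Fin d) (Fin d × Fin d) 𝕜)
    (M : Fin (N - 1) → Matrix (Fin d × Fin d) (Fin d × Fin d) 𝕜) :
    loc l P * tensorOf S M = tensorOf (insert l S) (Function.update M l P) := by
  have hl : l ∉ S := fun h => by
    have := hS l h
    simp only [Far] at this
    omega
  have hlS : ∀ s, s = left l ∨ s = right l → ∀ l' ∈ S, s ≠ left l' ∧ s ≠ right l' := by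
    rintro s hs l' hl'
    obtain ⟨h1, h2, h3, h4⟩ := (hS l' hl').ne
    rcases hs with rfl | rfl
    · exact ⟨h1, h2⟩
    · exact ⟨h3, h4⟩
  ext x y
  -- This is the only intermediate configuration that can contribute: the identity part of `loc`
  -- forces z = x off the bond l, and that of `tensorOf` forces z = y at the ends of l, which lie on
  -- no bond of S.
  set z₀ : Fin N → Fin d := fun s => if s = left l ∨ s = right l then y s else x s with hz₀
  rw [Matrix.mul_apply, Finset.sum_eq_single z₀]
  · have h1 : atBond z₀ l = atBond y l := by simp [atBond, z₀]
    have h2 : ∀ l' ∈ S, atBond z₀ l' = atBond x l' := by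
      intro l' hl'
      obtain ⟨h1, h2, h3, h4⟩ := (hS l' hl').ne
      simp [atBond, z₀, h1.symm, h2.symm, h3.symm, h4.symm]
    have h3 : ∀ s : Fin N, s ≠ left l → s ≠ right l → x s = z₀ s := by
      intro s hs1 hs2
      simp [z₀, hs1, hs2]
    have h4 : (∀ s : Fin N, (∀ l' ∈ S, s ≠ left l' ∧ s ≠ right l') → z₀ s = y s) ↔
        ∀ s : Fin N, (∀ l' ∈ insert l S, s ≠ left l' ∧ s ≠ right l') → x s = y s := by
      constructor
      · intro h s hs
        rw [← h s fun l' hl' => hs l' (Finset.mem_insert_of_mem hl')]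
        obtain ⟨a, b⟩ := hs l (Finset.mem_insert_self _ _)
        exact h3 s a b
      · intro h s hs
        by_cases hsl : s = left l ∨ s = right l
        · simp [z₀, hsl]
        · rw [not_or] at hsl
          rw [← h3 s hsl.1 hsl.2]
          refine h s fun l' hl' => ?_
          rcases Finset.mem_insert.mp hl' with rfl | hl'
          · exact hsl
          · exact hs l' hl'
    simp only [loc, tensorOf, Matrix.of_apply, h1, if_pos h3, mul_one, h4]
    rw [Finset.prod_insert hl, Function.update_self, mul_assoc]
    congr 2
    refine Finset.prod_congr rfl fun l' hl' => ?_
    rw [h2 l' hl', Function.update_of_ne]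
    rintro rfl
    exact hl hl'
  · intro z _ hz
    by_cases ha : ∀ s : Fin N, s ≠ left l → s ≠ right l → x s = z s
    · by_cases hb : ∀ s : Fin N, (∀ l' ∈ S, s ≠ left l' ∧ s ≠ right l') → z s = y s
      · refine (hz (funext fun s => ?_)).elim
        by_cases hsl : s = left l ∨ s = right l
        · simp only [z₀, if_pos hsl]
          exact hb s (hlS s hsl)
        · simp only [z₀, if_neg hsl]
          rw [not_or] at hsl
          exact (ha s hsl.1 hsl.2).symm
      · simp only [tensorOf, Matrix.of_apply, if_neg hb, mul_zero]
    · simp only [loc, Matrix.of_apply, if_neg ha, mul_zero, zero_mul]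
  · exact fun h => (h (Finset.mem_univ _)).elim

theorem tensorOf_mul_loc {l : Fin (N - 1)} {S : Finset (Fin (N - 1))} (hS : ∀ l' ∈ S, Far l l')
    (P : Matrix (Fin d × Fin d) (Fin d × Fin d) 𝕜)
    (M : Fin (N - 1) → Matrix (Fin d × Fin d) (Fin d × Fin d) 𝕜) :
    tensorOf S M * loc l P = tensorOf (insert l S) (Function.update M l P) := by
  apply Matrix.conjTranspose_injective
  rw [Matrix.conjTranspose_mul, tensorOf_conjTranspose, tensorOf_conjTranspose, loc_conjTranspose,
    loc_mul_tensorOf hS]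
  congr 1
  ext l' : 1
  by_cases h : l' = l
  · subst h; simp
  · simp [h]

/-- Both orders give the same tensor product over the two bonds. -/
theorem loc_comm_of_far {l l' : Fin (N - 1)} (h : Far l l')
    (P R : Matrix (Fin d × Fin d) (Fin d × Fin d) 𝕜) : loc l P * loc l' R = loc l' R * loc l P := by
  have h1 := loc_mul_tensorOf (S := {l'}) (by simpa using h) P fun _ => R
  have h2 := tensorOf_mul_loc (S := {l'}) (by simpa using h) P fun _ => R
  rw [tensorOf_singleton] at h1 h2
  rw [h1, h2]

/-- Splitting off the values at two sites. -/
def splitTwo {u v : Fin N} (huv : u ≠ v) :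
    (Fin N → Fin d) ≃ (Fin d × Fin d) × ({s // s ≠ u ∧ s ≠ v} → Fin d) where
  toFun x := ((x u, x v), fun s => x s)
  invFun p s := if h1 : s = u then p.1.1 else if h2 : s = v then p.1.2 else p.2 ⟨s, h1, h2⟩
  left_inv x := by
    ext s
    by_cases h1 : s = u
    · simp [h1]
    · by_cases h2 : s = v
      · subst h2
        simp [h1]
      · simp [h1, h2]
  right_inv p := by
    refine Prod.ext (Prod.ext ?_ ?_) ?_
    · simp
    · simp [huv.symm]
    · ext s
      simp [s.2.1, s.2.2]

/-- In the coordinates of `splitTwo` the operator is P ⊗ 1, so the algebra of one-bond operators is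
inherited from the Kronecker product. -/
theorem loc_eq_submatrix (l : Fin (N - 1)) (P : Matrix (Fin d × Fin d) (Fin d × Fin d) 𝕜) :
    loc l P = (P ⊗ₖ (1 : Matrix ({s // s ≠ left l ∧ s ≠ right l} → Fin d) _ 𝕜)).submatrix
      (splitTwo (left_ne_right l)) (splitTwo (left_ne_right l)) := by
  ext x y
  simp only [loc, Matrix.of_apply, Matrix.submatrix_apply, Matrix.kroneckerMap_apply, splitTwo,
    Equiv.coe_fn_mk, Matrix.one_apply, funext_iff, Subtype.forall, atBond, and_imp]

theorem loc_mul_loc (l : Fin (N - 1)) (P R : Matrix (Fin d × Fin d) (Fin d × Fin d) 𝕜) :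
    loc l P * loc l R = loc l (P * R) := by
  rw [loc_eq_submatrix, loc_eq_submatrix, loc_eq_submatrix, Matrix.submatrix_mul_equiv,
    ← Matrix.mul_kronecker_mul, Matrix.one_mul]

theorem loc_one (l : Fin (N - 1)) :
    loc l (1 : Matrix (Fin d × Fin d) (Fin d × Fin d) 𝕜) = 1 := by
  rw [loc_eq_submatrix, Matrix.one_kronecker_one, Matrix.submatrix_one_equiv]

theorem loc_sum {ι : Type*} (s : Finset ι) (l : Fin (N - 1))
    (P : ι → Matrix (Fin d × Fin d) (Fin d × Fin d) 𝕜) :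
    ∑ i ∈ s, loc l (P i) = loc l (∑ i ∈ s, P i) := by
  ext x y
  simp [loc, Matrix.sum_apply]

/-- Agreement at l leaves the other N − 2 sites free. The factor d² avoids a division. -/
theorem sum_ite_atBond_eq (l : Fin (N - 1)) :
    ∑ x : Fin N → Fin d, ∑ y, (if atBond x l = atBond y l then (1 : ℝ) else 0) *
      (d : ℝ) ^ 2 = (Fintype.card (Fin N → Fin d) : ℝ) ^ 2 := by
  set R := {s // s ≠ left l ∧ s ≠ right l} → Fin d
  have hc : (Fintype.card (Fin N → Fin d) : ℝ) = d ^ 2 * Fintype.card R := by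
    rw [Fintype.card_congr (splitTwo (d := d) (left_ne_right l))]
    simp [R, pow_two]
  have h1 : ∀ x, ∑ y : Fin N → Fin d, (if atBond x l = atBond y l then (1 : ℝ) else 0) =
      Fintype.card R := by
    intro x
    have h := Fintype.sum_equiv (splitTwo (d := d) (left_ne_right l))
      (fun y => if atBond x l = atBond y l then (1 : ℝ) else 0)
      (fun p => if atBond x l = p.1 then (1 : ℝ) else 0) fun y => rfl
    rw [h, Fintype.sum_prod_type]
    calc _ = ∑ p : Fin d × Fin d, ∑ _g : R, (if atBond x l = p then (1 : ℝ) else 0) := rfl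
      _ = _ := by
        simp only [Finset.sum_const, nsmul_eq_mul, Finset.card_univ, mul_ite, mul_one, mul_zero,
          Finset.sum_ite_eq, Finset.mem_univ, if_true]
  simp only [← Finset.sum_mul, h1]
  rw [Finset.sum_const, Finset.card_univ, nsmul_eq_mul, hc]
  ring

/-- The bonds of `S` are pairwise disjoint. -/
def PairwiseFar (S : Finset (Fin (N - 1))) : Prop := ∀ l ∈ S, ∀ l' ∈ S, l ≠ l' → Far l l'

theorem pairwiseFar_oddBonds : PairwiseFar (oddBonds N) := by
  intro l hl l' hl' hne
  simp only [oddBonds, Finset.mem_filter, Finset.mem_univ, true_and, Nat.even_iff] at hl hl'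
  have : l.1 ≠ l'.1 := fun h => hne (Fin.ext h)
  simp only [Far]
  omega

theorem pairwiseFar_evenBonds : PairwiseFar (evenBonds N) := by
  intro l hl l' hl' hne
  simp only [evenBonds, Finset.mem_filter, Finset.mem_univ, true_and, Nat.even_iff] at hl hl'
  have : l.1 ≠ l'.1 := fun h => hne (Fin.ext h)
  simp only [Far]
  omega

theorem bondTensor_insert {l : Fin (N - 1)} {S : Finset (Fin (N - 1))} (hS : ∀ l' ∈ S, Far l l')
    (Q : LocalUnitaries N d 𝕜) :
    bondTensor (insert l S) Q = loc l (Q l : Matrix _ _ 𝕜) * bondTensor S Q := by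
  rw [bondTensor_eq_tensorOf, bondTensor_eq_tensorOf, loc_mul_tensorOf hS,
    Function.update_eq_self l fun l => (Q l : Matrix (Fin d × Fin d) (Fin d × Fin d) 𝕜)]

theorem bondTensor_mul_loc {l : Fin (N - 1)} {S : Finset (Fin (N - 1))} (hS : ∀ l' ∈ S, Far l l')
    (Q : LocalUnitaries N d 𝕜) (P : Matrix (Fin d × Fin d) (Fin d × Fin d) 𝕜) :
    bondTensor S Q * loc l P = loc l P * bondTensor S Q := by
  rw [bondTensor_eq_tensorOf, loc_mul_tensorOf hS, tensorOf_mul_loc hS]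

theorem conjTranspose_mul_bondTensor {S : Finset (Fin (N - 1))} (hS : PairwiseFar S)
    (Q : LocalUnitaries N d 𝕜) : (bondTensor S Q)ᴴ * bondTensor S Q = 1 := by
  induction S using Finset.induction_on with
  | empty => rw [bondTensor_eq_tensorOf, tensorOf_empty]; simp
  | insert l S hl ih =>
    have h1 : ∀ l' ∈ S, Far l l' := fun l' hl' =>
      hS l (Finset.mem_insert_self _ _) l' (Finset.mem_insert_of_mem hl') (by
        rintro rfl
        exact hl hl')
    rw [bondTensor_insert h1, Matrix.conjTranspose_mul, Matrix.mul_assoc,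
      ← Matrix.mul_assoc _ (loc l _) (bondTensor S Q), loc_conjTranspose,
      loc_mul_loc, conjTranspose_mul_of_mem (Q l).2, loc_one, Matrix.one_mul]
    exact ih fun a ha b hb => hS a (Finset.mem_insert_of_mem ha) b (Finset.mem_insert_of_mem hb)

theorem bondTensor_mem_unitaryGroup {S : Finset (Fin (N - 1))} (hS : PairwiseFar S)
    (Q : LocalUnitaries N d 𝕜) :
    bondTensor S Q ∈ Matrix.unitaryGroup (Fin N → Fin d) 𝕜 := by
  rw [Matrix.mem_unitaryGroup_iff', Matrix.star_eq_conjTranspose, conjTranspose_mul_bondTensor hS]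

/-- The factors on the other bonds commute with an operator on l and cancel against their adjoints.
-/
theorem bondTensor_conj_loc {S : Finset (Fin (N - 1))} (hS : PairwiseFar S)
    (Q : LocalUnitaries N d 𝕜) {l : Fin (N - 1)} (hl : l ∈ S)
    (P : Matrix (Fin d × Fin d) (Fin d × Fin d) 𝕜) :
    (bondTensor S Q)ᴴ * loc l P * bondTensor S Q =
      loc l ((Q l : Matrix _ _ 𝕜)ᴴ * P * (Q l : Matrix _ _ 𝕜)) := by
  have h1 : ∀ l' ∈ S.erase l, Far l l' := fun l' hl' =>
    hS l hl l' (Finset.mem_of_mem_erase hl') (Finset.ne_of_mem_erase hl').symm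
  have h2 : PairwiseFar (S.erase l) := fun a ha b hb =>
    hS a (Finset.mem_of_mem_erase ha) b (Finset.mem_of_mem_erase hb)
  set T := bondTensor (S.erase l) Q with hT
  have hTu : Tᴴ * T = 1 := conjTranspose_mul_bondTensor h2 Q
  rw [← Finset.insert_erase hl, bondTensor_insert h1, ← hT, Matrix.conjTranspose_mul,
    loc_conjTranspose]
  calc _ = Tᴴ * ((loc l (Q l : Matrix _ _ 𝕜)ᴴ * loc l P * loc l (Q l : Matrix _ _ 𝕜)) * T) := by
        simp only [Matrix.mul_assoc]
    _ = _ := by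
        rw [loc_mul_loc, loc_mul_loc, ← bondTensor_mul_loc h1, ← hT, ← Matrix.mul_assoc, hTu,
          Matrix.one_mul]

theorem matQq_mem_unitaryGroup (Q : LocalUnitaries N d 𝕜) :
    matQq Q ∈ Matrix.unitaryGroup (Fin N → Fin d) 𝕜 :=
  mul_mem (bondTensor_mem_unitaryGroup pairwiseFar_evenBonds Q)
    (Unitary.star_mem (bondTensor_mem_unitaryGroup pairwiseFar_oddBonds Q))

end Local

/-! ## The quantum eigenvectors have flat second moments -/

section QuantumMixing

variable {N d : ℕ} {𝕜 : Type*} [RCLike 𝕜]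

theorem continuous_bondTensor (S : Finset (Fin (N - 1))) (x y : Fin N → Fin d) :
    Continuous fun Q : LocalUnitaries N d 𝕜 => bondTensor S Q x y := by
  simp only [bondTensor, Matrix.of_apply]
  exact (continuous_finsetProd _ fun l _ => (continuous_entry _ _).comp (continuous_apply l)).mul
    continuous_const

theorem continuous_matQq (x y : Fin N → Fin d) :
    Continuous fun Q : LocalUnitaries N d 𝕜 => matQq Q x y := by
  simp only [matQq, Matrix.mul_apply, Matrix.conjTranspose_apply]
  exact continuous_finsetSum _ fun z _ => (continuous_bondTensor _ _ _).mul
    (continuous_star.comp (continuous_bondTensor _ _ _))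

/-- The action of a permutation of the levels of each site on the two ends of a bond. -/
def bondPerm (τ : Fin N → Equiv.Perm (Fin d)) (l : Fin (N - 1)) : Equiv.Perm (Fin d × Fin d) :=
  Equiv.prodCongr (τ (left l)) (τ (right l))

theorem atBond_piCongrRight (τ : Fin N → Equiv.Perm (Fin d)) (x : Fin N → Fin d)
    (l : Fin (N - 1)) : atBond (Equiv.piCongrRight τ x) l = bondPerm τ l (atBond x l) := rfl

open Classical in
/-- The permutations `τ` on the sites that belong to no bond of `S`. -/
def offPerm (S : Finset (Fin (N - 1))) (τ : Fin N → Equiv.Perm (Fin d)) :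
    Fin N → Equiv.Perm (Fin d) :=
  fun s => if ∀ l ∈ S, s ≠ left l ∧ s ≠ right l then τ s else 1

theorem exists_bond (hN : 2 ≤ N) (s : Fin N) : ∃ l : Fin (N - 1), s = left l ∨ s = right l := by
  have hs := s.2
  by_cases h : s.1 + 1 < N
  · exact ⟨⟨s.1, by omega⟩, Or.inl rfl⟩
  · exact ⟨⟨s.1 - 1, by omega⟩, Or.inr (Fin.ext (by simp only [right]; omega))⟩

theorem mem_oddBonds {l : Fin (N - 1)} : l ∈ oddBonds N ↔ Even l.1 := by simp [oddBonds]

theorem mem_evenBonds {l : Fin (N - 1)} : l ∈ evenBonds N ↔ ¬ Even l.1 := by simp [evenBonds]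

/-- Every site meets some bond, so a site off the odd bonds lies on an even one. Hence the column
permutation applied to the odd factor does not disturb its identity part. -/
theorem offPerm_evenBonds_of_off_oddBonds (hN : 2 ≤ N) (τ : Fin N → Equiv.Perm (Fin d))
    {s : Fin N} (hs : ∀ l ∈ oddBonds N, s ≠ left l ∧ s ≠ right l) :
    offPerm (evenBonds N) τ s = 1 := by
  rw [offPerm, if_neg]
  intro h
  obtain ⟨l, hl⟩ := exists_bond hN s
  have key : s ≠ left l ∧ s ≠ right l := by
    by_cases he : Even l.1
    · exact hs l (mem_oddBonds.mpr he)
    · exact h l (mem_evenBonds.mpr he)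
  rcases hl with hl | hl
  · exact key.1 hl
  · exact key.2 hl

/-- The relabelling of the local unitaries that permutes the rows of `matQq`. -/
def relabel (τ : Fin N → Equiv.Perm (Fin d)) (Q : LocalUnitaries N d 𝕜) : LocalUnitaries N d 𝕜 :=
  (fun l => if Even l.1 then 1 else permUnitary 𝕜 (bondPerm τ l)) *
    (Q * fun l => if Even l.1 then permUnitary 𝕜 (bondPerm (offPerm (evenBonds N) τ) l).symm else 1)

theorem relabel_apply_odd (τ : Fin N → Equiv.Perm (Fin d)) (Q : LocalUnitaries N d 𝕜)
    {l : Fin (N - 1)} (hl : l ∈ oddBonds N) (a b : Fin d × Fin d) :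
    (relabel τ Q l : Matrix _ _ 𝕜) a b =
      (Q l : Matrix _ _ 𝕜) a (bondPerm (offPerm (evenBonds N) τ) l b) := by
  have h := mem_oddBonds.mp hl
  simp only [relabel, Pi.mul_apply, if_pos h, one_mul, mul_permUnitary_apply, Equiv.symm_symm]

theorem relabel_apply_even (τ : Fin N → Equiv.Perm (Fin d)) (Q : LocalUnitaries N d 𝕜)
    {l : Fin (N - 1)} (hl : l ∈ evenBonds N) (a b : Fin d × Fin d) :
    (relabel τ Q l : Matrix _ _ 𝕜) a b = (Q l : Matrix _ _ 𝕜) (bondPerm τ l a) b := by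
  have h := mem_evenBonds.mp hl
  simp only [relabel, Pi.mul_apply, if_neg h, mul_one, permUnitary_mul_apply]

theorem bondTensor_odd_relabel (hN : 2 ≤ N) (τ : Fin N → Equiv.Perm (Fin d))
    (Q : LocalUnitaries N d 𝕜) (y z : Fin N → Fin d) :
    bondTensor (oddBonds N) (relabel τ Q) y z =
      bondTensor (oddBonds N) Q y (Equiv.piCongrRight (offPerm (evenBonds N) τ) z) := by
  simp only [bondTensor, Matrix.of_apply]
  congr 1
  · refine Finset.prod_congr rfl fun l hl => ?_
    rw [relabel_apply_odd τ Q hl, atBond_piCongrRight]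
  · congr 1
    refine propext (forall_congr' fun s => forall_congr' fun hs => ?_)
    simp only [Equiv.piCongrRight_apply, Pi.map_apply]
    rw [offPerm_evenBonds_of_off_oddBonds hN τ hs, Equiv.Perm.one_apply]

theorem bondTensor_even_relabel (τ : Fin N → Equiv.Perm (Fin d))
    (Q : LocalUnitaries N d 𝕜) (x z : Fin N → Fin d) :
    bondTensor (evenBonds N) (relabel τ Q) x z =
      bondTensor (evenBonds N) Q (Equiv.piCongrRight τ x)
        (Equiv.piCongrRight (offPerm (evenBonds N) τ) z) := by
  simp only [bondTensor, Matrix.of_apply]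
  congr 1
  · refine Finset.prod_congr rfl fun l hl => ?_
    rw [relabel_apply_even τ Q hl, atBond_piCongrRight]
    have h1 : offPerm (evenBonds N) τ (left l) = 1 := by
      rw [offPerm, if_neg]
      exact fun h => (h l hl).1 rfl
    have h2 : offPerm (evenBonds N) τ (right l) = 1 := by
      rw [offPerm, if_neg]
      exact fun h => (h l hl).2 rfl
    simp [atBond, h1, h2]
  · congr 1
    refine propext (forall_congr' fun s => forall_congr' fun hs => ?_)
    simp only [Equiv.piCongrRight_apply, Pi.map_apply]
    rw [offPerm, if_pos hs, EmbeddingLike.apply_eq_iff_eq]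

/-- On even bonds a row permutation is absorbed by left translation of the Q_l. On a site without an
even bond, Q^(B) is the identity, so the permutation passes through it to the rows of (Q^(A))⁻¹,
where right translation of the odd Q_l absorbs it. -/
theorem matQq_relabel (hN : 2 ≤ N) (τ : Fin N → Equiv.Perm (Fin d))
    (Q : LocalUnitaries N d 𝕜) (x y : Fin N → Fin d) :
    matQq (relabel τ Q) x y = matQq Q (Equiv.piCongrRight τ x) y := by
  simp only [matQq, Matrix.mul_apply, Matrix.conjTranspose_apply, bondTensor_odd_relabel hN,
    bondTensor_even_relabel]
  exact Fintype.sum_equiv (Equiv.piCongrRight (offPerm (evenBonds N) τ)) _ _ fun z => rfl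

theorem isMixing_matQq (hN : 2 ≤ N) :
    IsMixing (Measure.pi fun _ : Fin (N - 1) => haar (Fin d × Fin d) 𝕜)
      fun Q : LocalUnitaries N d 𝕜 => matQq Q where
  isProbabilityMeasure := inferInstance
  aestronglyMeasurable z x := (continuous_matQq z x).aestronglyMeasurable
  mem_unitaryGroup Q := matQq_mem_unitaryGroup Q
  integral_norm_sq z x := by
    refine eq_inv_card_of_sum (f := fun z => ∫ Q : LocalUnitaries N d 𝕜,
      ‖matQq Q z x‖ ^ 2 ∂(Measure.pi fun _ => haar (Fin d × Fin d) 𝕜)) (fun z w => ?_) ?_ z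
    -- Permutations acting site by site are already transitive on configurations; this one takes w
    -- to z. As `relabel` is a left and a right translation, it preserves the product Haar measure.
    · set τ : Fin N → Equiv.Perm (Fin d) := fun s => Equiv.swap (w s) (z s) with hτ
      have hz : Equiv.piCongrRight τ w = z := by
        ext s
        simp [τ]
      have h1 := integral_mul_left_eq_self
        (μ := Measure.pi fun _ : Fin (N - 1) => haar (Fin d × Fin d) 𝕜)
        (fun Q : LocalUnitaries N d 𝕜 => ‖matQq (Q * fun l => if Even l.1 then
          permUnitary 𝕜 (bondPerm (offPerm (evenBonds N) τ) l).symm else 1) w x‖ ^ 2)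
        (fun l => if Even l.1 then 1 else permUnitary 𝕜 (bondPerm τ l))
      have h2 := integral_mul_right_eq_self
        (μ := Measure.pi fun _ : Fin (N - 1) => haar (Fin d × Fin d) 𝕜)
        (fun Q : LocalUnitaries N d 𝕜 => ‖matQq Q w x‖ ^ 2) (fun l => if Even l.1 then
          permUnitary 𝕜 (bondPerm (offPerm (evenBonds N) τ) l).symm else 1)
      rw [← h2, ← h1]
      refine integral_congr_ae (Filter.Eventually.of_forall fun Q => ?_)
      have h3 := matQq_relabel hN τ Q w x
      rw [hz] at h3
      simp only [← h3, relabel, mul_assoc]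
    · have hi : ∀ z, Integrable (fun Q : LocalUnitaries N d 𝕜 => ‖matQq Q z x‖ ^ 2)
          (Measure.pi fun _ => haar (Fin d × Fin d) 𝕜) := fun z =>
        integrable_of_continuous ((continuous_matQq z x).norm.pow 2)
      rw [← integral_finsetSum _ fun z _ => hi z]
      simp [fun Q : LocalUnitaries N d 𝕜 => sum_norm_sq_col (matQq_mem_unitaryGroup Q) x]

end QuantumMixing

/-! ## Decomposition of the coupling into pairs of bonds -/

section PairDecomposition

variable {X L ι 𝕜 : Type*} [Fintype X] [DecidableEq X] [Fintype L] [Fintype ι] [DecidableEq ι]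
  [RCLike 𝕜] {r : X → L → ι}

/-- The indicator function of the configurations that have the value `i` at `l`. -/
def levelInd (r : X → L → ι) (l : L) (i : ι) (x : X) : ℝ := if r x l = i then 1 else 0

/-- Two levels coincide exactly if some i is the value of both; the index p runs over pairs (bond,
level). -/
theorem agree_eq_sum_levelInd (S : Finset L) (x y : X) :
    agree S r x y = ∑ p ∈ S ×ˢ Finset.univ, levelInd r p.1 p.2 x * levelInd r p.1 p.2 y := by
  rw [Finset.sum_product, agree]
  refine Finset.sum_congr rfl fun l _ => ?_
  simp only [levelInd, ite_mul, one_mul, zero_mul]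
  rw [Finset.sum_ite_eq]
  simp [eq_comm]

theorem sum_comm_four {κ : Type*} (s : Finset κ) (F : X → X → X → X → κ → ℝ) :
    ∑ x, ∑ y, ∑ z, ∑ w, ∑ p ∈ s, F x y z w p = ∑ p ∈ s, ∑ x, ∑ y, ∑ z, ∑ w, F x y z w p := by
  refine (Finset.sum_congr rfl fun x _ => ?_).trans Finset.sum_comm
  refine (Finset.sum_congr rfl fun y _ => ?_).trans Finset.sum_comm
  exact (Finset.sum_congr rfl fun z _ => Finset.sum_comm).trans Finset.sum_comm

/-- Replacing both `agree` factors by products of indicators turns the quartic sum back into traces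
of the form Tr(AB')², now with A and B the projections onto single local levels. -/
theorem sum_agree_mul_eq (S S' : Finset L) (V : Matrix X X 𝕜) :
    ∑ x, ∑ y, ∑ z, ∑ w, agree S r x y * agree S' r z w *
      RCLike.re (starRingEnd 𝕜 (V z x) * V z y * (starRingEnd 𝕜 (V w y) * V w x)) =
    ∑ l ∈ S, ∑ l' ∈ S', ∑ i, ∑ j, RCLike.re
      ((realDiag 𝕜 (levelInd r l i) * conjDiag V (levelInd r l' j)) ^ 2).trace := by
  have h : ∀ x y z w, agree S r x y * agree S' r z w *
      RCLike.re (starRingEnd 𝕜 (V z x) * V z y * (starRingEnd 𝕜 (V w y) * V w x)) =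
      ∑ p ∈ S ×ˢ Finset.univ, ∑ q ∈ S' ×ˢ Finset.univ,
        levelInd r p.1 p.2 x * levelInd r p.1 p.2 y *
          (levelInd r q.1 q.2 z * levelInd r q.1 q.2 w) *
        RCLike.re (starRingEnd 𝕜 (V z x) * V z y * (starRingEnd 𝕜 (V w y) * V w x)) := by
    intro x y z w
    rw [agree_eq_sum_levelInd, agree_eq_sum_levelInd, Finset.sum_mul_sum, Finset.sum_mul]
    exact Finset.sum_congr rfl fun p _ => Finset.sum_mul _ _ _
  simp only [re_trace_realDiag_mul_conjDiag_sq, h]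
  rw [sum_comm_four, Finset.sum_product]
  refine Finset.sum_congr rfl fun l _ => Eq.trans ?_ Finset.sum_comm
  refine Finset.sum_congr rfl fun i _ => ?_
  rw [sum_comm_four, Finset.sum_product]

end PairDecomposition

/-! ## Pairs of local projections -/

section Projections

variable {N d : ℕ} {𝕜 : Type*} [RCLike 𝕜]

/-- The projection onto the `i`-th eigenvector. -/
def eigenProj (Q : Matrix.unitaryGroup (Fin d × Fin d) 𝕜) (i : Fin d × Fin d) :
    Matrix (Fin d × Fin d) (Fin d × Fin d) 𝕜 :=
  (Q : Matrix _ _ 𝕜)ᴴ * Matrix.single i i 1 * (Q : Matrix _ _ 𝕜)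

theorem eigenProj_apply (Q : Matrix.unitaryGroup (Fin d × Fin d) 𝕜) (i a b : Fin d × Fin d) :
    eigenProj Q i a b = eigenvectorMatrix Q i a.1 a.2 *
      starRingEnd 𝕜 (eigenvectorMatrix Q i b.1 b.2) := by
  rw [eigenProj, Matrix.mul_assoc, Matrix.mul_apply, Finset.sum_eq_single i]
  · simp [eigenvectorMatrix]
  · intro j _ hj
    rw [Matrix.single_mul_apply_of_ne _ _ _ _ _ hj, mul_zero]
  · simp

theorem eigenProj_mul_self (Q : Matrix.unitaryGroup (Fin d × Fin d) 𝕜) (i : Fin d × Fin d) :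
    eigenProj Q i * eigenProj Q i = eigenProj Q i := by
  calc _ = (Q : Matrix _ _ 𝕜)ᴴ * Matrix.single i i 1 * ((Q : Matrix _ _ 𝕜) * (Q : Matrix _ _ 𝕜)ᴴ) *
        Matrix.single i i 1 * (Q : Matrix _ _ 𝕜) := by simp only [eigenProj, Matrix.mul_assoc]
    _ = _ := by
        rw [mul_conjTranspose_of_mem Q.2, Matrix.mul_one, Matrix.mul_assoc _ (Matrix.single i i 1)
          (Matrix.single i i 1), Matrix.single_mul_single_same, mul_one, eigenProj]

theorem sum_eigenProj (Q : Matrix.unitaryGroup (Fin d × Fin d) 𝕜) :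
    ∑ i, eigenProj Q i = 1 := by
  simp only [eigenProj]
  rw [← Finset.sum_mul, ← Finset.mul_sum]
  have : ∑ i : Fin d × Fin d, Matrix.single i i (1 : 𝕜) = 1 := by
    ext a b
    simp [Matrix.sum_apply, Matrix.single_apply, Matrix.one_apply, ite_and]
  rw [this, Matrix.mul_one, conjTranspose_mul_of_mem Q.2]

theorem realDiag_levelInd (l : Fin (N - 1)) (i : Fin d × Fin d) :
    realDiag 𝕜 (levelInd (fun (x : Fin N → Fin d) => atBond x) l i) =
      loc l (Matrix.single i i 1) := by
  ext x y
  by_cases hxy : x = y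
  · subst hxy
    simp [realDiag, levelInd, loc, Matrix.single_apply, eq_comm]
  · rw [realDiag, Matrix.diagonal_apply_ne _ hxy]
    simp only [loc, Matrix.of_apply, Matrix.single_apply]
    by_cases h1 : i = atBond x l ∧ i = atBond y l
    · have hne : ¬ ∀ s : Fin N, s ≠ left l → s ≠ right l → x s = y s := ?_
      · rw [if_neg hne, mul_zero]
      intro h
      refine hxy (funext fun s => ?_)
      have h2 := h1.1.symm.trans h1.2
      simp only [atBond, Prod.mk.injEq] at h2
      by_cases hs : s = left l
      · rw [hs, h2.1]
      · by_cases hs' : s = right l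
        · rw [hs', h2.2]
        · exact h s hs hs'
    · rw [if_neg h1, zero_mul]

/-- Since `matQq` is Q^(B)(Q^(A))⁻¹, conjugation by Q^(A) carries the two level projections to the
local eigenprojections of bonds l and l', and the trace is unchanged. -/
theorem trace_sq_matQq (Q : LocalUnitaries N d 𝕜) {l l' : Fin (N - 1)} (hl : l ∈ oddBonds N)
    (hl' : l' ∈ evenBonds N) (i j : Fin d × Fin d) :
    ((realDiag 𝕜 (levelInd (fun (x : Fin N → Fin d) => atBond x) l i) *
      conjDiag (matQq Q) (levelInd (fun (x : Fin N → Fin d) => atBond x) l' j)) ^ 2).trace =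
    ((loc l (eigenProj (Q l) i) * loc l' (eigenProj (Q l') j)) ^ 2).trace := by
  set A := bondTensor (oddBonds N) Q with hA
  set B := bondTensor (evenBonds N) Q with hB
  have hAu : A * Aᴴ = 1 :=
    mul_conjTranspose_of_mem (bondTensor_mem_unitaryGroup pairwiseFar_oddBonds Q)
  have hAu' : Aᴴ * A = 1 := conjTranspose_mul_bondTensor pairwiseFar_oddBonds Q
  have h1 : loc l (eigenProj (Q l) i) = Aᴴ * loc l (Matrix.single i i 1) * A :=
    (bondTensor_conj_loc pairwiseFar_oddBonds Q hl _).symm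
  have h2 : loc l' (eigenProj (Q l') j) = Bᴴ * loc l' (Matrix.single j j 1) * B :=
    (bondTensor_conj_loc pairwiseFar_evenBonds Q hl' _).symm
  have h3 : realDiag 𝕜 (levelInd (fun (x : Fin N → Fin d) => atBond x) l i) *
      conjDiag (matQq Q) (levelInd (fun (x : Fin N → Fin d) => atBond x) l' j) =
      A * (loc l (eigenProj (Q l) i) * loc l' (eigenProj (Q l') j)) * Aᴴ := by
    rw [realDiag_levelInd, conjDiag, realDiag_levelInd, matQq, ← hA, ← hB, h1, h2,
      Matrix.conjTranspose_mul, Matrix.conjTranspose_conjTranspose]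
    calc _ = 1 * loc l (Matrix.single i i 1) * (A * Bᴴ * loc l' (Matrix.single j j 1) *
          (B * Aᴴ)) := by rw [Matrix.one_mul]
      _ = _ := by
          rw [← hAu]
          simp only [Matrix.mul_assoc]
  rw [h3, pow_two, pow_two]
  calc _ = (A * (loc l (eigenProj (Q l) i) * loc l' (eigenProj (Q l') j)) * (Aᴴ * A) *
        (loc l (eigenProj (Q l) i) * loc l' (eigenProj (Q l') j)) * Aᴴ).trace := by
        simp only [Matrix.mul_assoc]
    _ = (Aᴴ * (A * (loc l (eigenProj (Q l) i) * loc l' (eigenProj (Q l') j)) *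
        (loc l (eigenProj (Q l) i) * loc l' (eigenProj (Q l') j)))).trace := by
        rw [hAu', Matrix.mul_one, Matrix.trace_mul_comm _ Aᴴ]
    _ = _ := by
        simp only [← Matrix.mul_assoc, hAu', Matrix.one_mul]

/-- Far projections commute, so their product is idempotent; summing over both resolutions of the
identity leaves Tr 1 = m. This equals the classical contribution of the pair, so disjoint bonds drop
out of the difference. -/
theorem sum_trace_sq_of_far {l l' : Fin (N - 1)} (h : Far l l')
    (Q R : Matrix.unitaryGroup (Fin d × Fin d) 𝕜) :
    ∑ i, ∑ j, RCLike.re ((loc l (eigenProj Q i) * loc l' (eigenProj R j)) ^ 2).trace =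
      (Fintype.card (Fin N → Fin d) : ℝ) := by
  have h1 : ∀ i j, (loc l (eigenProj Q i) * loc l' (eigenProj R j)) ^ 2 =
      loc l (eigenProj Q i) * loc l' (eigenProj R j) := by
    intro i j
    calc _ = loc l (eigenProj Q i) * (loc l' (eigenProj R j) * loc l (eigenProj Q i)) *
          loc l' (eigenProj R j) := by simp only [pow_two, Matrix.mul_assoc]
      _ = (loc l (eigenProj Q i) * loc l (eigenProj Q i)) *
          (loc l' (eigenProj R j) * loc l' (eigenProj R j)) := by
          rw [← loc_comm_of_far h]
          simp only [Matrix.mul_assoc]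
      _ = _ := by rw [loc_mul_loc, loc_mul_loc, eigenProj_mul_self, eigenProj_mul_self]
  simp only [h1, ← map_sum, ← Matrix.trace_sum, ← Finset.mul_sum, loc_sum,
    sum_eigenProj, loc_one, Matrix.mul_one, Matrix.trace_one]
  exact RCLike.natCast_re _

/-- Splitting off the values at three sites. -/
def splitThree {u v w : Fin N} (huv : u ≠ v) (huw : u ≠ w) (hvw : v ≠ w) :
    (Fin N → Fin d) ≃ (Fin d × Fin d × Fin d) × ({s // s ≠ u ∧ s ≠ v ∧ s ≠ w} → Fin d) where
  toFun x := ((x u, x v, x w), fun s => x s)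
  invFun p s := if h1 : s = u then p.1.1 else if h2 : s = v then p.1.2.1 else
    if h3 : s = w then p.1.2.2 else p.2 ⟨s, h1, h2, h3⟩
  left_inv x := by
    ext s
    by_cases h1 : s = u
    · simp [h1]
    · by_cases h2 : s = v
      · subst h2
        simp [h1]
      · by_cases h3 : s = w
        · subst h3
          simp [h1, h2]
        · simp [h1, h2, h3]
  right_inv p := by
    refine Prod.ext (Prod.ext ?_ (Prod.ext ?_ ?_)) ?_
    · simp
    · simp [huv.symm]
    · simp [huw.symm, hvw.symm]
    · ext s
      simp [s.2.1, s.2.2.1, s.2.2.2]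

/-- A matrix on the first two of three sites. -/
def firstTwo (P : Matrix (Fin d × Fin d) (Fin d × Fin d) 𝕜) :
    Matrix (Fin d × Fin d × Fin d) (Fin d × Fin d × Fin d) 𝕜 :=
  Matrix.of fun a b => P (a.1, a.2.1) (b.1, b.2.1) * if a.2.2 = b.2.2 then 1 else 0

/-- A matrix on the last two of three sites. -/
def lastTwo (P : Matrix (Fin d × Fin d) (Fin d × Fin d) 𝕜) :
    Matrix (Fin d × Fin d × Fin d) (Fin d × Fin d × Fin d) 𝕜 :=
  Matrix.of fun a b => P a.2 b.2 * if a.1 = b.1 then 1 else 0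

/-- Both operators are a three-site matrix tensored with the identity on the remaining sites, whose
dimension is m/d³; the factor d³ avoids the division. -/
theorem trace_sq_of_adjacent {l l' : Fin (N - 1)} (h : l.1 + 1 = l'.1)
    (P R : Matrix (Fin d × Fin d) (Fin d × Fin d) 𝕜) :
    (d : 𝕜) ^ 3 * ((loc l P * loc l' R) ^ 2).trace =
      (Fintype.card (Fin N → Fin d) : 𝕜) * ((firstTwo P * lastTwo R) ^ 2).trace := by
  have hv : right l = left l' := Fin.ext h
  have huv : left l ≠ right l := left_ne_right l
  have hvw : right l ≠ right l' := by
    rw [hv]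
    exact left_ne_right l'
  have huw : left l ≠ right l' := by
    simp only [left, right, ne_eq, Fin.mk.injEq]
    omega
  set T := {s // s ≠ left l ∧ s ≠ right l ∧ s ≠ right l'} → Fin d with hT
  set e := splitThree (d := d) huv huw hvw with he
  have h1 : loc l P = (firstTwo P ⊗ₖ (1 : Matrix T T 𝕜)).submatrix e e := by
    ext x y
    simp only [loc, firstTwo, Matrix.of_apply, Matrix.submatrix_apply, Matrix.kroneckerMap_apply,
      e, splitThree, Equiv.coe_fn_mk, Matrix.one_apply, atBond,
      mul_assoc]
    congr 1
    rw [ite_zero_mul_ite_zero, one_mul]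
    congr 1
    refine propext ⟨fun h => ⟨h _ huw.symm hvw.symm, funext fun s => h s s.2.1 s.2.2.1⟩,
      fun h s hs1 hs2 => ?_⟩
    by_cases hs3 : s = right l'
    · rw [hs3]; exact h.1
    · exact congrFun h.2 ⟨s, hs1, hs2, hs3⟩
  have h2 : loc l' R = (lastTwo R ⊗ₖ (1 : Matrix T T 𝕜)).submatrix e e := by
    ext x y
    simp only [loc, lastTwo, Matrix.of_apply, Matrix.submatrix_apply, Matrix.kroneckerMap_apply,
      e, splitThree, Equiv.coe_fn_mk, Matrix.one_apply, atBond,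
      mul_assoc, hv]
    congr 1
    rw [ite_zero_mul_ite_zero, one_mul]
    congr 1
    refine propext ⟨fun h => ⟨h _ (hv ▸ huv) huw, funext fun s => h s (hv ▸ s.2.2.1) s.2.2.2⟩,
      fun h s hs1 hs2 => ?_⟩
    by_cases hs3 : s = left l
    · rw [hs3]; exact h.1
    · exact congrFun h.2 ⟨s, hs3, hv.symm ▸ hs1, hs2⟩
  have hc : (Fintype.card (Fin N → Fin d) : 𝕜) = d ^ 3 * Fintype.card T := by
    rw [Fintype.card_congr e]
    simp only [Fintype.card_prod, Fintype.card_fin]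
    push_cast
    ring
  have h3 : (loc l P * loc l' R) ^ 2 =
      (((firstTwo P * lastTwo R) ^ 2) ⊗ₖ (1 : Matrix T T 𝕜)).submatrix e e := by
    rw [h1, h2, Matrix.submatrix_mul_equiv, ← Matrix.mul_kronecker_mul, Matrix.one_mul, pow_two,
      Matrix.submatrix_mul_equiv, ← Matrix.mul_kronecker_mul, Matrix.one_mul, pow_two]
  have h4 : ∀ M : Matrix ((Fin d × Fin d × Fin d) × T) ((Fin d × Fin d × Fin d) × T) 𝕜,
      (M.submatrix e e).trace = M.trace := fun M =>
    Fintype.sum_equiv e _ _ fun x => rfl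
  rw [h3, h4, Matrix.trace_kronecker, Matrix.trace_one, hc]
  ring

/-- With P = |u⟩⟨u| and R = |v⟩⟨v|, contraction over the shared site joins the bra of u to the ket
of v, which gives an entry of ūv. -/
theorem firstTwo_mul_lastTwo_eigenProj (Q R : Matrix.unitaryGroup (Fin d × Fin d) 𝕜)
    (i j : Fin d × Fin d) (a b : Fin d × Fin d × Fin d) :
    (firstTwo (eigenProj Q i) * lastTwo (eigenProj R j)) a b =
      eigenvectorMatrix Q i a.1 a.2.1 * starRingEnd 𝕜 (eigenvectorMatrix R j b.2.1 b.2.2) *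
        (eigenvectorMatrix (conjUnitary Q) i * eigenvectorMatrix R j) b.1 a.2.2 := by
  simp only [Matrix.mul_apply, firstTwo, lastTwo, Matrix.of_apply, eigenProj_apply,
    Fintype.sum_prod_type, mul_ite, mul_one, mul_zero, ite_mul, zero_mul, Finset.mul_sum]
  -- The second factor is the identity on the first site.
  rw [Finset.sum_eq_single b.1]
  · refine Finset.sum_congr rfl fun c _ => ?_
    simp [eigenvectorMatrix]
    ring
  · intro c _ hc
    simp [hc]
  · simp

/-- Here W plays the role of ūv. For fixed first-site indices a and b, summing over the other four
indices gives (WW†)_ba (WW†)_ab, and WW† is Hermitian. -/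
theorem sum_six_eq_frobSq {u v W : Matrix (Fin d) (Fin d) 𝕜}
    (hW : ∀ a c, starRingEnd 𝕜 (W a c) = ∑ b, u a b * starRingEnd 𝕜 (v b c)) :
    ∑ a : Fin d × Fin d × Fin d, ∑ b : Fin d × Fin d × Fin d,
      (u a.1 a.2.1 * starRingEnd 𝕜 (v b.2.1 b.2.2) * W b.1 a.2.2) *
        (u b.1 b.2.1 * starRingEnd 𝕜 (v a.2.1 a.2.2) * W a.1 b.2.2) =
      ((frobSq (W * Wᴴ) : ℝ) : 𝕜) := by
  have hG : ∀ a b, ∑ a2, ∑ a3, u a a2 * starRingEnd 𝕜 (v a2 a3) * W b a3 = (W * Wᴴ) b a := by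
    intro a b
    rw [Finset.sum_comm, Matrix.mul_apply]
    refine Finset.sum_congr rfl fun c _ => ?_
    rw [← Finset.sum_mul, ← hW, Matrix.conjTranspose_apply, RCLike.star_def, mul_comm]
  have hH : ∀ a b, (W * Wᴴ) b a = starRingEnd 𝕜 ((W * Wᴴ) a b) := by
    intro a b
    have h := congrFun (congrFun (Matrix.isHermitian_mul_conjTranspose_self W) b) a
    rw [Matrix.conjTranspose_apply] at h
    exact h.symm
  -- The two factors v̄ trade places, so that each bracket contracts u with v̄ into W̄.
  have h1 : ∀ a b, (∑ a2, ∑ a3, u a a2 * starRingEnd 𝕜 (v a2 a3) * W b a3) *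
      (∑ b2, ∑ b3, u b b2 * starRingEnd 𝕜 (v b2 b3) * W a b3) = ∑ a2, ∑ a3, ∑ b2, ∑ b3,
        (u a a2 * starRingEnd 𝕜 (v b2 b3) * W b a3) *
          (u b b2 * starRingEnd 𝕜 (v a2 a3) * W a b3) := by
    intro a b
    rw [Finset.sum_mul]
    refine Finset.sum_congr rfl fun a2 _ => ?_
    rw [Finset.sum_mul]
    refine Finset.sum_congr rfl fun a3 _ => ?_
    rw [Finset.mul_sum]
    refine Finset.sum_congr rfl fun b2 _ => ?_
    rw [Finset.mul_sum]
    exact Finset.sum_congr rfl fun b3 _ => by ring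
  have h2 : ((frobSq (W * Wᴴ) : ℝ) : 𝕜) = ∑ a, ∑ b, (W * Wᴴ) b a * (W * Wᴴ) a b := by
    rw [frobSq]
    push_cast
    refine Finset.sum_congr rfl fun a _ => Finset.sum_congr rfl fun b _ => ?_
    rw [hH, RCLike.norm_conj, RCLike.mul_conj]
  rw [h2]
  simp only [← hG, h1, Fintype.sum_prod_type]
  refine Finset.sum_congr rfl fun a _ => ?_
  refine (Finset.sum_congr rfl fun a2 _ => Finset.sum_comm).trans Finset.sum_comm

theorem trace_sq_firstTwo_mul_lastTwo (Q R : Matrix.unitaryGroup (Fin d × Fin d) 𝕜)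
    (i j : Fin d × Fin d) :
    ((firstTwo (eigenProj Q i) * lastTwo (eigenProj R j)) ^ 2).trace =
      ((frobSq (eigenvectorMatrix (conjUnitary Q) i * eigenvectorMatrix R j *
        (eigenvectorMatrix (conjUnitary Q) i * eigenvectorMatrix R j)ᴴ) : ℝ) : 𝕜) := by
  have hW : ∀ a c, starRingEnd 𝕜
      ((eigenvectorMatrix (conjUnitary Q) i * eigenvectorMatrix R j) a c) =
      ∑ b, eigenvectorMatrix Q i a b * starRingEnd 𝕜 (eigenvectorMatrix R j b c) := by
    intro a c
    rw [Matrix.mul_apply, map_sum]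
    exact Finset.sum_congr rfl fun b _ => by simp [eigenvectorMatrix]
  rw [← sum_six_eq_frobSq hW, pow_two, Matrix.trace]
  refine Finset.sum_congr rfl fun a _ => ?_
  rw [Matrix.diag_apply, Matrix.mul_apply]
  refine Finset.sum_congr rfl fun b _ => ?_
  rw [firstTwo_mul_lastTwo_eigenProj, firstTwo_mul_lastTwo_eigenProj]

end Projections

/-! ### Pairs of eigenvectors, neighbouring bonds and the quantum coupling. -/

section EigenvectorPairs

variable {N d : ℕ} {𝕜 : Type*} [RCLike 𝕜]

/-- For fixed a, the d vectors i ↦ u^(i)_ab are orthonormal rows of the unitary Q⁻¹, so this is the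
Pythagorean identity. -/
theorem sum_norm_sq_eigenvectorMatrix_mul (Q : Matrix.unitaryGroup (Fin d × Fin d) 𝕜) (a : Fin d)
    (t : Fin d → 𝕜) :
    ∑ i, ‖∑ b, eigenvectorMatrix Q i a b * t b‖ ^ 2 = ∑ b, ‖t b‖ ^ 2 := by
  have hU : ∀ b b' : Fin d, ∑ i, eigenvectorMatrix Q i a b *
      starRingEnd 𝕜 (eigenvectorMatrix Q i a b') = if b = b' then 1 else 0 := by
    intro b b'
    have h := congrFun (congrFun (conjTranspose_mul_of_mem Q.2) (a, b)) (a, b')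
    rw [Matrix.mul_apply, Matrix.one_apply] at h
    simpa [eigenvectorMatrix] using h
  have h : ∑ i, (((‖∑ b, eigenvectorMatrix Q i a b * t b‖ : ℝ) : 𝕜)) ^ 2 =
      ∑ b, ((‖t b‖ : ℝ) : 𝕜) ^ 2 := by
    calc _ = ∑ i, ∑ b, ∑ b', t b * starRingEnd 𝕜 (t b') * (eigenvectorMatrix Q i a b *
          starRingEnd 𝕜 (eigenvectorMatrix Q i a b')) := by
          refine Finset.sum_congr rfl fun i _ => ?_
          rw [← RCLike.mul_conj, map_sum, Finset.sum_mul_sum]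
          refine Finset.sum_congr rfl fun b _ => Finset.sum_congr rfl fun b' _ => ?_
          rw [map_mul]
          ring
      _ = ∑ b, ∑ b', t b * starRingEnd 𝕜 (t b') * ∑ i, (eigenvectorMatrix Q i a b *
          starRingEnd 𝕜 (eigenvectorMatrix Q i a b')) := by
          rw [Finset.sum_comm]
          refine Finset.sum_congr rfl fun b _ => ?_
          rw [Finset.sum_comm]
          exact Finset.sum_congr rfl fun b' _ => (Finset.mul_sum _ _ _).symm
      _ = _ := by simp [hU, RCLike.mul_conj]
  exact_mod_cast h

/-- Summing over i first removes Q by the preceding isometry; the unit columns of R then leave d³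
ones. Because this total is deterministic, it can stand in for the classical value, one ‖uv‖² for
each pair of eigenvectors. -/
theorem sum_frobSq_mul (Q R : Matrix.unitaryGroup (Fin d × Fin d) 𝕜) :
    ∑ i, ∑ j, frobSq (eigenvectorMatrix Q i * eigenvectorMatrix R j) = (d : ℝ) ^ 3 := by
  simp only [frobSq, Matrix.mul_apply]
  have hR : ∀ b c : Fin d, ∑ j, ‖eigenvectorMatrix R j b c‖ ^ 2 = 1 := by
    intro b c
    have h := sum_norm_sq_col R.2 (b, c)
    simpa [eigenvectorMatrix] using h
  calc _ = ∑ j, ∑ a : Fin d, ∑ c : Fin d, ∑ i,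
        ‖∑ b, eigenvectorMatrix Q i a b * eigenvectorMatrix R j b c‖ ^ 2 := by
        rw [Finset.sum_comm]
        refine Finset.sum_congr rfl fun j _ => ?_
        rw [Finset.sum_comm]
        exact Finset.sum_congr rfl fun a _ => Finset.sum_comm
    _ = ∑ a : Fin d, ∑ c : Fin d, ∑ b : Fin d, ∑ j, ‖eigenvectorMatrix R j b c‖ ^ 2 := by
        simp only [sum_norm_sq_eigenvectorMatrix_mul]
        rw [Finset.sum_comm]
        refine Finset.sum_congr rfl fun a _ => ?_
        rw [Finset.sum_comm]
        exact Finset.sum_congr rfl fun c _ => Finset.sum_comm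
    _ = _ := by
        simp only [hR]
        simp
        ring

/-- `‖u v‖² - ‖u v (u v)†‖²` for two local eigenvectors. -/
def uvDefect (i j : Fin d × Fin d) (ω : Matrix.unitaryGroup (Fin d × Fin d) 𝕜 ×
    Matrix.unitaryGroup (Fin d × Fin d) 𝕜) : ℝ :=
  frobSq (eigenvectorMatrix ω.1 i * eigenvectorMatrix ω.2 j) -
    frobSq (eigenvectorMatrix ω.1 i * eigenvectorMatrix ω.2 j *
      (eigenvectorMatrix ω.1 i * eigenvectorMatrix ω.2 j)ᴴ)

theorem continuous_eigenvectorMatrix (i : Fin d × Fin d) :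
    Continuous fun Q : Matrix.unitaryGroup (Fin d × Fin d) 𝕜 => eigenvectorMatrix Q i :=
  continuous_matrix fun a b => continuous_star.comp (continuous_entry i (a, b))

theorem continuous_frobSq {ι : Type*} [Fintype ι] :
    Continuous (frobSq : Matrix ι ι 𝕜 → ℝ) :=
  continuous_finsetSum _ fun _ _ => continuous_finsetSum _ fun _ _ =>
    (continuous_id.matrix_elem _ _).norm.pow 2

theorem continuous_uvDefect (i j : Fin d × Fin d) : Continuous (uvDefect (𝕜 := 𝕜) i j) := by
  have h : Continuous fun ω : Matrix.unitaryGroup (Fin d × Fin d) 𝕜 ×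
      Matrix.unitaryGroup (Fin d × Fin d) 𝕜 => eigenvectorMatrix ω.1 i * eigenvectorMatrix ω.2 j :=
    ((continuous_eigenvectorMatrix i).comp continuous_fst).matrix_mul
      ((continuous_eigenvectorMatrix j).comp continuous_snd)
  exact (continuous_frobSq.comp h).sub
    (continuous_frobSq.comp (h.matrix_mul h.matrix_conjTranspose))

theorem eigenvectorMatrix_permUnitary_mul (σ : Equiv.Perm (Fin d × Fin d))
    (Q : Matrix.unitaryGroup (Fin d × Fin d) 𝕜) (i : Fin d × Fin d) :
    eigenvectorMatrix (permUnitary 𝕜 σ * Q) i = eigenvectorMatrix Q (σ i) := by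
  ext a b
  simp only [eigenvectorMatrix, Matrix.of_apply, Matrix.conjTranspose_apply,
    permUnitary_mul_apply]

/-- Left translation by permutation matrices exchanges the eigenvectors of each local term. -/
theorem uvExpectation_eq (i j i' j' : Fin d × Fin d) :
    uvExpectation 𝕜 i j = uvExpectation 𝕜 i' j' := by
  have h := integral_mul_left_eq_self
    (μ := (haar (Fin d × Fin d) 𝕜).prod (haar (Fin d × Fin d) 𝕜)) (uvDefect (𝕜 := 𝕜) i' j')
    (permUnitary 𝕜 (Equiv.swap i' i), permUnitary 𝕜 (Equiv.swap j' j))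
  simp only [uvDefect, Prod.fst_mul, Prod.snd_mul, eigenvectorMatrix_permUnitary_mul,
    Equiv.swap_apply_left] at h
  exact h

/-- Distinct coordinates of the product measure are independent Haar matrices, and conjugating one
of them preserves its law. -/
theorem integral_conj_pair {l l' : Fin (N - 1)} (hl : l ≠ l')
    {f : Matrix.unitaryGroup (Fin d × Fin d) 𝕜 × Matrix.unitaryGroup (Fin d × Fin d) 𝕜 → ℝ}
    (hf : Continuous f) :
    ∫ Q : LocalUnitaries N d 𝕜, f (conjUnitary (Q l), Q l')
      ∂(Measure.pi fun _ => haar (Fin d × Fin d) 𝕜) =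
    ∫ ω, f ω ∂((haar (Fin d × Fin d) 𝕜).prod (haar (Fin d × Fin d) 𝕜)) := by
  set μ := haar (Fin d × Fin d) 𝕜 with hμ
  have hI : ProbabilityTheory.iIndepFun (fun (l : Fin (N - 1)) (Q : LocalUnitaries N d 𝕜) => Q l)
      (Measure.pi fun _ => μ) :=
    ProbabilityTheory.iIndepFun_pi (X := fun _ x => x) fun l => aemeasurable_id
  have hmap := (ProbabilityTheory.indepFun_iff_map_prod_eq_prod_map_map
    (measurable_pi_apply l).aemeasurable (measurable_pi_apply l').aemeasurable).mp (hI.indepFun hl)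
  have he : ∀ l : Fin (N - 1), Measure.map (fun Q : LocalUnitaries N d 𝕜 => Q l)
      (Measure.pi fun _ => μ) = μ := fun l => (measurePreserving_eval (fun _ => μ) l).map_eq
  rw [he, he] at hmap
  have hconj : MeasurePreserving (Prod.map (conjUnitary : Matrix.unitaryGroup (Fin d × Fin d) 𝕜 → _)
      (id : Matrix.unitaryGroup (Fin d × Fin d) 𝕜 → _)) (μ.prod μ) (μ.prod μ) :=
    measurePreserving_conjUnitary.prod (MeasurePreserving.id μ)
  calc _ = ∫ ω, f (Prod.map conjUnitary id ω) ∂(μ.prod μ) := by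
        rw [← hmap, integral_map ((measurable_pi_apply l).prodMk
          (measurable_pi_apply l')).aemeasurable]
        · rfl
        · exact (hf.comp (continuous_conjUnitary.prodMap continuous_id)).aestronglyMeasurable
    _ = _ := by
        conv_rhs => rw [← hconj.map_eq]
        rw [integral_map hconj.measurable.aemeasurable hf.aestronglyMeasurable]

/-- The contribution of a pair of bonds to `coupling`. -/
def pairSum (l l' : Fin (N - 1)) (Q : LocalUnitaries N d 𝕜) : ℝ :=
  ∑ i, ∑ j, RCLike.re ((loc l (eigenProj (Q l) i) * loc l' (eigenProj (Q l') j)) ^ 2).trace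

theorem trace_mul_sq_comm {X : Type*} [Fintype X] [DecidableEq X] (A B : Matrix X X 𝕜) :
    ((A * B) ^ 2).trace = ((B * A) ^ 2).trace := by
  rw [pow_two, pow_two, Matrix.mul_assoc, Matrix.trace_mul_comm]
  simp only [Matrix.mul_assoc]

theorem pairSum_comm (l l' : Fin (N - 1)) (Q : LocalUnitaries N d 𝕜) :
    pairSum l l' Q = pairSum l' l Q := by
  rw [pairSum, Finset.sum_comm]
  refine Finset.sum_congr rfl fun j _ => Finset.sum_congr rfl fun i _ => ?_
  rw [trace_mul_sq_comm]

theorem pairSum_of_adjacent (hd : d ≠ 0) {l l' : Fin (N - 1)} (h : l.1 + 1 = l'.1)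
    (Q : LocalUnitaries N d 𝕜) :
    Fintype.card (Fin N → Fin d) - pairSum l l' Q =
      (Fintype.card (Fin N → Fin d) / (d : ℝ) ^ 3) *
        ∑ i, ∑ j, uvDefect i j (conjUnitary (Q l), Q l') := by
  have h1 : ∀ i j, (d : ℝ) ^ 3 * RCLike.re
      ((loc l (eigenProj (Q l) i) * loc l' (eigenProj (Q l') j)) ^ 2).trace =
      Fintype.card (Fin N → Fin d) * frobSq (eigenvectorMatrix (conjUnitary (Q l)) i *
        eigenvectorMatrix (Q l') j * (eigenvectorMatrix (conjUnitary (Q l)) i *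
        eigenvectorMatrix (Q l') j)ᴴ) := by
    intro i j
    have h2 := trace_sq_of_adjacent h (eigenProj (Q l) i) (eigenProj (Q l') j)
    rw [trace_sq_firstTwo_mul_lastTwo] at h2
    have h3 := congrArg RCLike.re h2
    rw [show (d : 𝕜) ^ 3 = (((d : ℝ) ^ 3 : ℝ) : 𝕜) by push_cast; rfl, RCLike.re_ofReal_mul,
      show (Fintype.card (Fin N → Fin d) : 𝕜) = ((Fintype.card (Fin N → Fin d) : ℝ) : 𝕜) by
        push_cast; rfl, RCLike.re_ofReal_mul, RCLike.ofReal_re] at h3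
    exact h3
  have hd3 : (d : ℝ) ^ 3 ≠ 0 := by positivity
  have h4 : (d : ℝ) ^ 3 * pairSum l l' Q = Fintype.card (Fin N → Fin d) *
      ((d : ℝ) ^ 3 - ∑ i, ∑ j, uvDefect i j (conjUnitary (Q l), Q l')) := by
    simp only [uvDefect, Finset.sum_sub_distrib, sum_frobSq_mul, sub_sub_cancel]
    simp only [pairSum, Finset.mul_sum, h1]
  have h5 : pairSum l l' Q = Fintype.card (Fin N → Fin d) *
      ((d : ℝ) ^ 3 - ∑ i, ∑ j, uvDefect i j (conjUnitary (Q l), Q l')) / (d : ℝ) ^ 3 := by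
    rw [eq_div_iff hd3, ← h4, mul_comm]
  rw [h5]
  field_simp
  ring

/-- All d⁴ pairs of eigenvectors have the same expected defect, and (m/d³)·d⁴ = m·d. -/
theorem integral_pairSum_of_adjacent (hd : d ≠ 0) {l l' : Fin (N - 1)} (h : l.1 + 1 = l'.1)
    (i₀ j₀ : Fin d × Fin d) :
    Integrable (pairSum (𝕜 := 𝕜) (d := d) l l') (Measure.pi fun _ => haar (Fin d × Fin d) 𝕜) ∧
    Fintype.card (Fin N → Fin d) - ∫ Q : LocalUnitaries N d 𝕜, pairSum l l' Q
      ∂(Measure.pi fun _ => haar (Fin d × Fin d) 𝕜) =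
      Fintype.card (Fin N → Fin d) * d * uvExpectation 𝕜 i₀ j₀ := by
  have hne : l ≠ l' := by
    rintro rfl
    omega
  have hd' : (d : ℝ) ≠ 0 := by exact_mod_cast hd
  set m : ℝ := (Fintype.card (Fin N → Fin d) : ℝ) with hm
  have hc : ∀ i j, Continuous fun Q : LocalUnitaries N d 𝕜 =>
      uvDefect i j (conjUnitary (Q l), Q l') := fun i j =>
    (continuous_uvDefect i j).comp ((continuous_conjUnitary.comp (continuous_apply l)).prodMk
      (continuous_apply l'))
  have hi : ∀ i j, Integrable (fun Q : LocalUnitaries N d 𝕜 =>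
      uvDefect i j (conjUnitary (Q l), Q l')) (Measure.pi fun _ => haar (Fin d × Fin d) 𝕜) :=
    fun i j => integrable_of_continuous (hc i j)
  have hp : pairSum (𝕜 := 𝕜) (d := d) l l' = fun Q =>
      m - (m / (d : ℝ) ^ 3) * ∑ i, ∑ j, uvDefect i j (conjUnitary (Q l), Q l') := by
    ext Q
    rw [← pairSum_of_adjacent hd h Q]
    ring
  have hs := integrable_finsetSum (μ := Measure.pi fun _ => haar (Fin d × Fin d) 𝕜) Finset.univ
    fun i _ => integrable_finsetSum Finset.univ fun j _ => hi i j
  refine ⟨?_, ?_⟩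
  · rw [hp]
    exact (integrable_const _).sub (hs.const_mul _)
  · rw [hp, integral_sub (integrable_const _) (hs.const_mul _), integral_const_mul,
      integral_finsetSum _ fun i _ => integrable_finsetSum Finset.univ fun j _ => hi i j]
    have hu : ∀ i j, ∫ Q : LocalUnitaries N d 𝕜, uvDefect i j (conjUnitary (Q l), Q l')
        ∂(Measure.pi fun _ => haar (Fin d × Fin d) 𝕜) = uvExpectation 𝕜 i₀ j₀ := by
      intro i j
      rw [integral_conj_pair hne (continuous_uvDefect i j), uvExpectation_eq i₀ j₀ i j]
      rfl
    have : ∀ i, ∫ Q : LocalUnitaries N d 𝕜, ∑ j, uvDefect i j (conjUnitary (Q l), Q l')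
        ∂(Measure.pi fun _ => haar (Fin d × Fin d) 𝕜) = d * d * uvExpectation 𝕜 i₀ j₀ := by
      intro i
      rw [integral_finsetSum _ fun j _ => hi i j]
      simp [hu]
    simp only [this]
    simp
    field_simp

open Classical in
-- Bonds of opposite parity are either neighbours or disjoint. Disjoint pairs match the classical
-- value m, and only the neighbours leave a deficit.
theorem coupling_matQq (hN : 2 ≤ N) (hd : d ≠ 0) (i j : Fin d × Fin d) :
    (oddBonds N).card * (evenBonds N).card * (Fintype.card (Fin N → Fin d) : ℝ) -
      coupling (oddBonds N) (evenBonds N) (fun (x : Fin N → Fin d) => atBond x)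
        (Measure.pi fun _ : Fin (N - 1) => haar (Fin d × Fin d) 𝕜)
        (fun Q : LocalUnitaries N d 𝕜 => matQq Q) =
      (∑ l ∈ oddBonds N, ∑ l' ∈ evenBonds N,
        if l.1 + 1 = l'.1 ∨ l'.1 + 1 = l.1 then (1 : ℝ) else 0) *
        (Fintype.card (Fin N → Fin d) * d * uvExpectation 𝕜 i j) := by
  set m : ℝ := (Fintype.card (Fin N → Fin d) : ℝ) with hm
  have key : ∀ l ∈ oddBonds N, ∀ l' ∈ evenBonds N,
      Integrable (pairSum (𝕜 := 𝕜) (d := d) l l') (Measure.pi fun _ => haar (Fin d × Fin d) 𝕜) ∧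
      m - ∫ Q : LocalUnitaries N d 𝕜, pairSum l l' Q
        ∂(Measure.pi fun _ => haar (Fin d × Fin d) 𝕜) =
        (if l.1 + 1 = l'.1 ∨ l'.1 + 1 = l.1 then (1 : ℝ) else 0) *
          (m * d * uvExpectation 𝕜 i j) := by
    intro l hl l' hl'
    by_cases h1 : l.1 + 1 = l'.1
    · rw [if_pos (Or.inl h1), one_mul]
      exact integral_pairSum_of_adjacent hd h1 i j
    · by_cases h2 : l'.1 + 1 = l.1
      · rw [if_pos (Or.inr h2), one_mul]
        have h3 : pairSum (𝕜 := 𝕜) (d := d) l l' = pairSum l' l :=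
          funext fun Q => pairSum_comm l l' Q
        rw [h3]
        exact integral_pairSum_of_adjacent hd h2 i j
      · rw [if_neg (by tauto), zero_mul]
        have hfar : Far l l' := by
          have ha := mem_oddBonds.mp hl
          have hb := mem_evenBonds.mp hl'
          have : l.1 ≠ l'.1 := fun h => hb (h ▸ ha)
          simp only [Far]
          omega
        have h3 : pairSum (𝕜 := 𝕜) (d := d) l l' = fun _ => m :=
          funext fun Q => sum_trace_sq_of_far hfar (Q l) (Q l')
        rw [h3]
        exact ⟨integrable_const _, by simp⟩
  have hc : coupling (oddBonds N) (evenBonds N) (fun (x : Fin N → Fin d) => atBond x)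
        (Measure.pi fun _ : Fin (N - 1) => haar (Fin d × Fin d) 𝕜)
        (fun Q : LocalUnitaries N d 𝕜 => matQq Q) =
      ∑ l ∈ oddBonds N, ∑ l' ∈ evenBonds N, ∫ Q : LocalUnitaries N d 𝕜, pairSum l l' Q
        ∂(Measure.pi fun _ => haar (Fin d × Fin d) 𝕜) := by
    rw [(isMixing_matQq hN).coupling_eq_integral]
    calc _ = ∫ Q : LocalUnitaries N d 𝕜, ∑ l ∈ oddBonds N, ∑ l' ∈ evenBonds N, pairSum l l' Q
          ∂(Measure.pi fun _ => haar (Fin d × Fin d) 𝕜) := by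
          refine integral_congr_ae (Filter.Eventually.of_forall fun Q => ?_)
          simp only [sum_agree_mul_eq]
          refine Finset.sum_congr rfl fun l hl => Finset.sum_congr rfl fun l' hl' =>
            Finset.sum_congr rfl fun i _ => Finset.sum_congr rfl fun j _ => ?_
          rw [trace_sq_matQq Q hl hl']
      _ = _ := by
          rw [integral_finsetSum _ fun l hl => integrable_finsetSum _ fun l' hl' =>
            (key l hl l' hl').1]
          exact Finset.sum_congr rfl fun l hl =>
            integral_finsetSum _ fun l' hl' => (key l hl l' hl').1
  rw [hc, Finset.sum_mul]
  have h0 : ((oddBonds N).card * (evenBonds N).card * m : ℝ) =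
      ∑ l ∈ oddBonds N, ∑ l' ∈ evenBonds N, m := by
    simp [mul_assoc]
  rw [h0, ← Finset.sum_sub_distrib]
  refine Finset.sum_congr rfl fun l hl => ?_
  rw [← Finset.sum_sub_distrib, Finset.sum_mul]
  exact Finset.sum_congr rfl fun l' hl' => (key l hl l' hl').2

open Classical in
theorem sum_adjacent (hN : 2 ≤ N) :
    ∑ l ∈ oddBonds N, ∑ l' ∈ evenBonds N,
      (if l.1 + 1 = l'.1 ∨ l'.1 + 1 = l.1 then (1 : ℝ) else 0) = (N : ℝ) - 2 := by
  rw [← Finset.sum_product', Finset.sum_boole]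
  -- Neighbouring pairs correspond to the N − 2 interior sites: the index a stands for the bonds a
  -- and a + 1, ordered so that the one with even index comes first.
  have hcard : (Finset.univ : Finset (Fin (N - 2))).card = (((oddBonds N) ×ˢ (evenBonds N)).filter
      fun p => p.1.1 + 1 = p.2.1 ∨ p.2.1 + 1 = p.1.1).card := by
    refine Finset.card_bij (fun a _ => if Even a.1 then
      ((⟨a.1, by omega⟩ : Fin (N - 1)), (⟨a.1 + 1, by omega⟩ : Fin (N - 1))) else
      (⟨a.1 + 1, by omega⟩, ⟨a.1, by omega⟩)) ?_ ?_ ?_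
    · intro a _
      by_cases ha : Even a.1
      · simp [ha, mem_oddBonds, mem_evenBonds, Nat.even_add_one]
      · simp [ha, mem_oddBonds, mem_evenBonds, Nat.even_add_one]
    · intro a _ b _ hab
      have := a.2
      by_cases ha : Even a.1 <;> by_cases hb : Even b.1 <;>
        simp only [ha, hb, if_true, if_false, Prod.mk.injEq, Fin.mk.injEq] at hab
      all_goals first
        | exact Fin.ext (by omega)
    · rintro ⟨l, l'⟩ hp
      simp only [Finset.mem_filter, Finset.mem_product, mem_oddBonds, mem_evenBonds] at hp
      obtain ⟨⟨h1, h2⟩, h3 | h3⟩ := hp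
      · refine ⟨⟨l.1, by have := l'.2; omega⟩, Finset.mem_univ _, ?_⟩
        rw [if_pos h1]
        exact Prod.ext rfl (Fin.ext h3)
      · refine ⟨⟨l'.1, by have := l.2; omega⟩, Finset.mem_univ _, ?_⟩
        rw [if_neg h2]
        exact Prod.ext (Fin.ext h3) rfl
  rw [← hcard, Finset.card_univ, Fintype.card_fin, Nat.cast_sub hN]
  norm_num

theorem card_oddBonds (k : ℕ) : (oddBonds (2 * k + 1)).card = k := by
  have h : (Finset.univ : Finset (Fin k)).card = (oddBonds (2 * k + 1)).card := by
    refine Finset.card_bij (fun a _ => ⟨2 * a.1, by have := a.2; omega⟩) ?_ ?_ ?_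
    · intro a _
      exact mem_oddBonds.mpr (by simp)
    · intro a _ b _ hab
      simp only [Fin.mk.injEq] at hab
      exact Fin.ext (by omega)
    · intro l hl
      have h := mem_oddBonds.mp hl
      rw [Nat.even_iff] at h
      exact ⟨⟨l.1 / 2, by have := l.2; omega⟩, Finset.mem_univ _, Fin.ext (by simp; omega)⟩
  rw [← h, Finset.card_univ, Fintype.card_fin]

theorem card_evenBonds (k : ℕ) : (evenBonds (2 * k + 1)).card = k := by
  have h : (Finset.univ : Finset (Fin k)).card = (evenBonds (2 * k + 1)).card := by
    refine Finset.card_bij (fun a _ => ⟨2 * a.1 + 1, by have := a.2; omega⟩) ?_ ?_ ?_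
    · intro a _
      exact mem_evenBonds.mpr (by simp)
    · intro a _ b _ hab
      simp only [Fin.mk.injEq] at hab
      exact Fin.ext (by omega)
    · intro l hl
      have h := mem_evenBonds.mp hl
      rw [Nat.even_iff] at h
      exact ⟨⟨l.1 / 2, by have := l.2; omega⟩, Finset.mem_univ _, Fin.ext (by simp; omega)⟩
  rw [← h, Finset.card_univ, Fintype.card_fin]

end EigenvectorPairs

/-! ## Universality of the interpolation parameter -/

section Universality

variable {N d : ℕ}

/-- `coupling` for the chain, with the odd bonds in the first and the even bonds in the second
summand. -/
def chainCoupling {𝕜 Ω : Type*} [RCLike 𝕜] [MeasurableSpace Ω] (P : Measure Ω)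
    (V : Ω → Matrix (Fin N → Fin d) (Fin N → Fin d) 𝕜) : ℝ :=
  coupling (oddBonds N) (evenBonds N) (fun (x : Fin N → Fin d) => atBond x) P V

/-- `chainCoupling` for a uniformly random permutation matrix. -/
def couplingClassical (𝕜 : Type*) [RCLike 𝕜] (N d : ℕ) : ℝ :=
  chainCoupling (N := N) (d := d) (uniformPerm (Fin N → Fin d)) fun σ => σ.permMatrix 𝕜

/-- `chainCoupling` for a Haar matrix. -/
def couplingIso (𝕜 : Type*) [RCLike 𝕜] (N d : ℕ) : ℝ :=
  chainCoupling (N := N) (d := d) (haar (Fin N → Fin d) 𝕜)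
    fun Q => (Q : Matrix (Fin N → Fin d) (Fin N → Fin d) 𝕜)

/-- `chainCoupling` for the product of local Haar matrices. -/
def couplingQuantum (𝕜 : Type*) [RCLike 𝕜] (N d : ℕ) : ℝ :=
  chainCoupling (N := N) (d := d) (Measure.pi fun _ : Fin (N - 1) => haar (Fin d × Fin d) 𝕜)
    fun Q : LocalUnitaries N d 𝕜 => matQq Q

/-- The interpolation parameter in terms of the couplings. -/
def universalP (𝕜 : Type*) [RCLike 𝕜] (N d : ℕ) : ℝ :=
  1 - (couplingClassical 𝕜 N d - couplingQuantum 𝕜 N d) /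
    (couplingClassical 𝕜 N d - couplingIso 𝕜 N d)

variable (𝕜 : Type*) [RCLike 𝕜]

/-- The eigenvalues of `A`. -/
def eigA (Λ : LocalEigenvalues N d) : (Fin N → Fin d) → ℝ :=
  sumEig (oddBonds N) (fun x => atBond x) Λ

/-- The eigenvalues of `B`. -/
def eigB (Λ : LocalEigenvalues N d) : (Fin N → Fin d) → ℝ :=
  sumEig (evenBonds N) (fun x => atBond x) Λ

theorem matA_eq (Λ : LocalEigenvalues N d) : matA 𝕜 Λ = realDiag 𝕜 (eigA Λ) := rfl

theorem matB_eq (Λ : LocalEigenvalues N d) : matB 𝕜 Λ = realDiag 𝕜 (eigB Λ) := rfl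

theorem classicalB_eq (ω : LocalEigenvalues N d × Equiv.Perm (Fin N → Fin d)) :
    classicalB 𝕜 ω = conjDiag (ω.2.permMatrix 𝕜) (eigB ω.1) := by
  rw [conjDiag, Matrix.conjTranspose_permMatrix, classicalB, Matrix.transpose_permMatrix, matB_eq]

variable {𝕜} in
theorem isoB_eq (ω : LocalEigenvalues N d × Matrix.unitaryGroup (Fin N → Fin d) 𝕜) :
    isoB ω = conjDiag (ω.2 : Matrix _ _ 𝕜) (eigB ω.1) := rfl

variable {𝕜} in
theorem quantumB_eq (ω : LocalEigenvalues N d × LocalUnitaries N d 𝕜) :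
    quantumB ω = conjDiag (matQq ω.2) (eigB ω.1) := rfl

theorem card_config : (Fintype.card (Fin N → Fin d) : ℝ) = (d : ℝ) ^ N := by simp

theorem two_pow_le_card (hN : 3 ≤ N) (hd : 2 ≤ d) : 8 ≤ Fintype.card (Fin N → Fin d) := by
  simp only [Fintype.card_pi, Fintype.card_fin, Finset.prod_const, Finset.card_univ]
  calc 8 = 2 ^ 3 := by norm_num
    _ ≤ 2 ^ N := Nat.pow_le_pow_right (by norm_num) hN
    _ ≤ d ^ N := Nat.pow_le_pow_left hd N

theorem oddBonds_card_pos (hN : 3 ≤ N) : 0 < (oddBonds N).card :=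
  Finset.card_pos.mpr ⟨⟨0, by omega⟩, mem_oddBonds.mpr (by simp)⟩

theorem evenBonds_card_pos (hN : 3 ≤ N) : 0 < (evenBonds N).card :=
  Finset.card_pos.mpr ⟨⟨1, by omega⟩, mem_evenBonds.mpr (by simp)⟩

theorem couplingClassical_eq : couplingClassical 𝕜 N d =
    (oddBonds N).card * (evenBonds N).card * Fintype.card (Fin N → Fin d) :=
  coupling_permMatrix

theorem couplingClassical_sub_couplingIso (hN : 3 ≤ N) (hd : 2 ≤ d) (a b : Fin N → Fin d) :
    couplingClassical 𝕜 N d - couplingIso 𝕜 N d =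
      (oddBonds N).card * (evenBonds N).card * Fintype.card (Fin N → Fin d) *
        (1 - Fintype.card (Fin N → Fin d) * entryFourth 𝕜 a b) *
        ((Fintype.card (Fin N → Fin d) - Fintype.card (Fin N → Fin d) / (d : ℝ) ^ 2) /
          (Fintype.card (Fin N → Fin d) - 1)) ^ 2 := by
  have hd0 : (d : ℝ) ^ 2 ≠ 0 := by positivity
  have hX : 2 ≤ Fintype.card (Fin N → Fin d) := by
    have := two_pow_le_card hN hd
    omega
  rw [couplingClassical_eq]
  refine coupling_haar hX (fun l => ?_) a b
  have h := sum_ite_atBond_eq (d := d) l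
  simp only [← Finset.sum_mul] at h
  -- The parameter f of `coupling_haar` is m/d² here.
  rw [mul_div_assoc', eq_div_iff hd0, h, pow_two]

theorem couplingIso_lt_couplingClassical (hN : 3 ≤ N) (hd : 2 ≤ d) :
    couplingIso 𝕜 N d < couplingClassical 𝕜 N d := by
  have h8 := two_pow_le_card hN hd
  have h8' : (8 : ℝ) ≤ Fintype.card (Fin N → Fin d) := by exact_mod_cast h8
  have hd2 : (2 : ℝ) ≤ d := by exact_mod_cast hd
  have x₀ : Fin N → Fin d := fun _ => ⟨0, by omega⟩
  have h := couplingClassical_sub_couplingIso 𝕜 hN hd x₀ x₀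
  have hF : (Fintype.card (Fin N → Fin d) : ℝ) * entryFourth 𝕜 x₀ x₀ < 1 :=
    card_mul_haarFourth_lt_one (by omega) x₀ x₀
  have ho : (0 : ℝ) < (oddBonds N).card := by exact_mod_cast oddBonds_card_pos hN
  have he : (0 : ℝ) < (evenBonds N).card := by exact_mod_cast evenBonds_card_pos hN
  have hlt : (Fintype.card (Fin N → Fin d) : ℝ) / (d : ℝ) ^ 2 < Fintype.card (Fin N → Fin d) :=
    div_lt_self (by linarith) (by nlinarith)
  have hpos : 0 < couplingClassical 𝕜 N d - couplingIso 𝕜 N d := by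
    rw [h]
    refine mul_pos (mul_pos (mul_pos (mul_pos ho he) (by linarith)) (by linarith)) (pow_pos ?_ 2)
    exact div_pos (by linarith) (by linarith)
  linarith

variable {𝕜} {νo νe : Measure (Fin d × Fin d → ℝ)}

theorem isLocalLaw_ite (ho : IsLocalLaw νo) (he : IsLocalLaw νe) (l : Fin (N - 1)) :
    IsLocalLaw (if Even l.1 then νo else νe) := by
  split_ifs
  · exact ho
  · exact he

theorem disjoint_oddBonds_evenBonds : Disjoint (oddBonds N) (evenBonds N) :=
  Finset.disjoint_left.mpr fun _ h h' => mem_evenBonds.mp h' (mem_oddBonds.mp h)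

theorem integral_eigA (ho : IsLocalLaw νo) (he : IsLocalLaw νe) : ∃ K δ : ℝ, 0 < δ ∧
    ∀ x y : Fin N → Fin d, ∫ t, eigA t x * eigA t y ∂(eigLaw N νo νe) =
      K + δ * agree (oddBonds N) (fun (x : Fin N → Fin d) => atBond x) x y :=
  exists_integral_sumEig_mul (isLocalLaw_ite ho he) ho fun _ hl => if_pos (mem_oddBonds.mp hl)

theorem integral_eigB (ho : IsLocalLaw νo) (he : IsLocalLaw νe) : ∃ K δ : ℝ, 0 < δ ∧
    ∀ x y : Fin N → Fin d, ∫ t, eigB t x * eigB t y ∂(eigLaw N νo νe) =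
      K + δ * agree (evenBonds N) (fun (x : Fin N → Fin d) => atBond x) x y :=
  exists_integral_sumEig_mul (isLocalLaw_ite ho he) he fun _ hl => if_neg (mem_evenBonds.mp hl)

/-- The law of the local eigenvalues enters `𝔼 Tr (A B')²` through two constants, and the
eigenvectors enter through `chainCoupling`. -/
theorem exists_depart_eq (hN : 2 ≤ N) (ho : IsLocalLaw νo) (he : IsLocalLaw νe) :
    ∃ C δ : ℝ, 0 < δ ∧
      departClassical 𝕜 N νo νe = C + δ * couplingClassical 𝕜 N d ∧
      departIso 𝕜 N νo νe = C + δ * couplingIso 𝕜 N d ∧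
      departQuantum 𝕜 N νo νe = C + δ * couplingQuantum 𝕜 N d := by
  have hρ := isLocalLaw_ite (N := N) ho he
  obtain ⟨K, δ, hδ, hS⟩ := integral_eigA (N := N) ho he
  obtain ⟨K', δ', hδ', hS'⟩ := integral_eigB (N := N) ho he
  refine ⟨Fintype.card (Fin N → Fin d) * (K * K' + K * δ' * (evenBonds N).card +
    K' * δ * (oddBonds N).card), _, mul_pos hδ hδ', ?_, ?_, ?_⟩
  · rw [departClassical]
    simp only [matA_eq, classicalB_eq]
    exact (isMixing_permMatrix (X := Fin N → Fin d) (𝕜 := 𝕜)).expTrace_sq_eq hρ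
      disjoint_oddBonds_evenBonds hS hS'
  · rw [departIso]
    simp only [matA_eq, isoB_eq]
    exact (isMixing_haar (X := Fin N → Fin d) (𝕜 := 𝕜)).expTrace_sq_eq hρ
      disjoint_oddBonds_evenBonds hS hS'
  · rw [departQuantum]
    simp only [matA_eq, quantumB_eq]
    exact (isMixing_matQq (d := d) (𝕜 := 𝕜) hN).expTrace_sq_eq hρ
      disjoint_oddBonds_evenBonds hS hS'

theorem isProbabilityMeasure_eigLaw (ho : IsLocalLaw νo) (he : IsLocalLaw νe) :
    IsProbabilityMeasure (eigLaw N νo νe) := by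
  have := fun l => (isLocalLaw_ite (N := N) ho he l).isProbabilityMeasure
  rw [eigLaw]
  infer_instance

theorem memLp_eigA (ho : IsLocalLaw νo) (he : IsLocalLaw νe) (x : Fin N → Fin d) :
    MemLp (fun t => eigA t x) 4 (eigLaw N νo νe) := memLp_sumEig (isLocalLaw_ite ho he) x

theorem memLp_eigB (ho : IsLocalLaw νo) (he : IsLocalLaw νe) (x : Fin N → Fin d) :
    MemLp (fun t => eigB t x) 4 (eigLaw N νo νe) := memLp_sumEig (isLocalLaw_ite ho he) x

theorem chain_variance_pos (hN : 3 ≤ N) (hd : 2 ≤ d) (ho : IsLocalLaw νo) (he : IsLocalLaw νe) :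
    0 < convMoment (eigLaw N νo νe) eigA eigB 2 -
      convMoment (eigLaw N νo νe) eigA eigB 1 ^ 2 := by
  have := isProbabilityMeasure_eigLaw (N := N) ho he
  obtain ⟨K, δ, hδ, hS⟩ := integral_eigA (N := N) ho he
  -- Two constant configurations with different levels agree on no bond, so 𝔼(a_x − a_y)² is 2δ
  -- times the number of odd bonds.
  set x : Fin N → Fin d := fun _ => ⟨0, by omega⟩ with hx
  set y : Fin N → Fin d := fun _ => ⟨1, by omega⟩ with hy
  refine convMoment_variance_pos (memLp_eigA ho he) (memLp_eigB ho he) (x := x) (y := y) ?_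
  have h2 : ∀ x, MemLp (fun t => eigA t x) 2 (eigLaw N νo νe) := fun x =>
    (memLp_eigA ho he x).mono_exponent (by norm_num)
  have hint : ∀ x y, Integrable (fun t => eigA t x * eigA t y) (eigLaw N νo νe) := fun x y =>
    (h2 x).integrable_mul (h2 y)
  have hexp : ∫ t, (eigA t x - eigA t y) ^ 2 ∂(eigLaw N νo νe) =
      ∫ t, eigA t x * eigA t x ∂(eigLaw N νo νe) -
      2 * ∫ t, eigA t x * eigA t y ∂(eigLaw N νo νe) +
      ∫ t, eigA t y * eigA t y ∂(eigLaw N νo νe) := by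
    have h4 := (hint x y).const_mul 2
    have h5 : Integrable (fun t => eigA t x * eigA t x - 2 * (eigA t x * eigA t y))
      (eigLaw N νo νe) := (hint x x).sub h4
    rw [← integral_const_mul, ← integral_sub (hint x x) h4, ← integral_add h5 (hint y y)]
    exact integral_congr_ae (Filter.Eventually.of_forall fun t => by ring)
  have h0 : agree (oddBonds N) (fun (x : Fin N → Fin d) => atBond x) x y = 0 := by
    refine Finset.sum_eq_zero fun l _ => if_neg ?_
    simp [atBond, x, y]
  have hc : (0 : ℝ) < (oddBonds N).card := by exact_mod_cast oddBonds_card_pos hN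
  rw [hexp, hS, hS, hS, h0, agree_self, agree_self]
  nlinarith [mul_pos hδ hc]

/-- The kurtosis of each of the three sums is the same affine function of `𝔼 Tr (A B')²`. -/
theorem exists_kurtosis_eq (hN : 3 ≤ N) (hd : 2 ≤ d) (ho : IsLocalLaw νo) (he : IsLocalLaw νe) :
    ∃ G c : ℝ, 0 < c ∧ kurtosisClassical 𝕜 N νo νe = G + c * departClassical 𝕜 N νo νe ∧
      kurtosisIso 𝕜 N νo νe = G + c * departIso 𝕜 N νo νe ∧
      kurtosisQuantum 𝕜 N νo νe = G + c * departQuantum 𝕜 N νo νe := by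
  have := isProbabilityMeasure_eigLaw (N := N) ho he
  have ha := memLp_eigA (N := N) ho he
  have hb := memLp_eigB (N := N) ho he
  have hvar := chain_variance_pos hN hd ho he
  have hm : (0 : ℝ) < (Fintype.card (Fin N → Fin d) : ℝ)⁻¹ := by
    have h8 := two_pow_le_card hN hd
    have : (0 : ℝ) < Fintype.card (Fin N → Fin d) := by
      exact_mod_cast (by omega : 0 < Fintype.card (Fin N → Fin d))
    positivity
  refine ⟨centralFourBase (eigLaw N νo νe) eigA eigB / (convMoment (eigLaw N νo νe) eigA eigB 2 -
      convMoment (eigLaw N νo νe) eigA eigB 1 ^ 2) ^ 2 - 3,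
    2 * (Fintype.card (Fin N → Fin d) : ℝ)⁻¹ / (convMoment (eigLaw N νo νe) eigA eigB 2 -
      convMoment (eigLaw N νo νe) eigA eigB 1 ^ 2) ^ 2, by positivity, ?_, ?_, ?_⟩
  · rw [kurtosisClassical, departClassical, classicalLaw]
    simp only [matA_eq, classicalB_eq]
    rw [kurtosis_eq (isMixing_permMatrix (X := Fin N → Fin d) (𝕜 := 𝕜)) ha hb]
    ring
  · rw [kurtosisIso, departIso, isoLaw]
    simp only [matA_eq, isoB_eq]
    rw [kurtosis_eq (isMixing_haar (X := Fin N → Fin d) (𝕜 := 𝕜)) ha hb]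
    ring
  · rw [kurtosisQuantum, departQuantum, quantumLaw]
    simp only [matA_eq, quantumB_eq]
    rw [kurtosis_eq (isMixing_matQq (N := N) (d := d) (𝕜 := 𝕜) (by omega)) ha hb]
    ring

/-- For N = 2k + 1 there are k bonds of each parity and N − 2 = 2k − 1 neighbouring pairs; the rest
is the quotient of the two coupling differences. -/
theorem one_sub_universalP_eq {k : ℕ} {n m : ℝ} (hk : 3 ≤ 2 * k + 1) (hd : 2 ≤ d)
    (hn : n = (d : ℝ) ^ 2) (hm : m = (d : ℝ) ^ (2 * k + 1)) (i j : Fin d × Fin d)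
    (a b : Fin (2 * k + 1) → Fin d) :
    1 - universalP 𝕜 (2 * k + 1) d = (d : ℝ) * (2 * (k : ℝ) - 1) * uvExpectation 𝕜 i j /
      (((k : ℝ) * m * (n - 1) / (n * (m - 1))) ^ 2 * (1 - m * entryFourth 𝕜 a b)) := by
  have h8 := two_pow_le_card hk hd
  have hmcard : (Fintype.card (Fin (2 * k + 1) → Fin d) : ℝ) = m := by rw [hm, card_config]
  have h8' : 8 ≤ m := by rw [← hmcard]; exact_mod_cast h8
  have hd2 : (2 : ℝ) ≤ d := by exact_mod_cast hd
  have hn4 : 4 ≤ n := by rw [hn]; nlinarith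
  have hk1 : (1 : ℝ) ≤ k := by exact_mod_cast (by omega : 1 ≤ k)
  have hF : m * entryFourth 𝕜 a b < 1 := by
    rw [← hmcard]
    exact card_mul_haarFourth_lt_one (by omega) a b
  have h1 := couplingClassical_sub_couplingIso 𝕜 hk hd a b
  have h2 : couplingClassical 𝕜 (2 * k + 1) d - couplingQuantum 𝕜 (2 * k + 1) d =
      (((2 * k + 1 : ℕ) : ℝ) - 2) * (m * d * uvExpectation 𝕜 i j) := by
    have h := coupling_matQq (𝕜 := 𝕜) (N := 2 * k + 1) (by omega) (by omega) i j
    rw [sum_adjacent (by omega)] at h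
    rw [couplingClassical_eq, ← hmcard]
    exact h
  rw [hmcard, card_oddBonds, card_evenBonds, ← hn] at h1
  have e1 : (1 - m * entryFourth 𝕜 a b) ≠ 0 := by linarith
  have e2 : m - 1 ≠ 0 := by linarith
  have e3 : n - 1 ≠ 0 := by linarith
  have e4 : n ≠ 0 := by linarith
  have e5 : m ≠ 0 := by linarith
  have e6 : (k : ℝ) ≠ 0 := by linarith
  have e7 : m - m / n = m * (n - 1) / n := by field_simp
  rw [universalP, sub_sub_cancel, h1, h2, e7]
  push_cast
  field_simp
  ring

end Universality

end SpinChain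

end

/-- The witness p is a ratio of couplings, chosen before any eigenvalue law. Kurtosis and 𝔼 Tr(AB')²
are both increasing affine functions of the coupling, with coefficients shared by the three models;
hence the strict inequality between the isotropic and the classical coupling makes both denominators
nonzero, and the slopes cancel from the ratios. -/
theorem mainTheorem3 (𝕜 : Type*) [RCLike 𝕜] :
    ∃ p : ℕ → ℕ → ℝ, ∀ N d : ℕ, 3 ≤ N → 2 ≤ d →
      (∀ νo νe : MeasureTheory.Measure (Fin d × Fin d → ℝ),
        SpinChain.IsLocalLaw νo → SpinChain.IsLocalLaw νe →
          SpinChain.kurtosisClassical 𝕜 N νo νe ≠ SpinChain.kurtosisIso 𝕜 N νo νe ∧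
          SpinChain.interpolation 𝕜 N νo νe = p N d ∧
          SpinChain.departClassical 𝕜 N νo νe ≠ SpinChain.departIso 𝕜 N νo νe ∧
          1 - SpinChain.interpolation 𝕜 N νo νe =
            (SpinChain.departClassical 𝕜 N νo νe - SpinChain.departQuantum 𝕜 N νo νe) /
              (SpinChain.departClassical 𝕜 N νo νe - SpinChain.departIso 𝕜 N νo νe)) ∧
      ∀ (k : ℕ) (n m : ℝ), N = 2 * k + 1 → n = (d : ℝ) ^ 2 → m = (d : ℝ) ^ N →
        ∀ (i j : Fin d × Fin d) (a b : Fin N → Fin d),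
          1 - p N d =
            (d : ℝ) * (2 * (k : ℝ) - 1) * SpinChain.uvExpectation 𝕜 i j /
              (((k : ℝ) * m * (n - 1) / (n * (m - 1))) ^ 2 *
                (1 - m * SpinChain.entryFourth 𝕜 a b)) := by
  refine ⟨fun N d => SpinChain.universalP 𝕜 N d, fun N d hN hd => ⟨fun νo νe ho he => ?_, ?_⟩⟩
  · obtain ⟨C, δ, hδ, hc, hi, hq⟩ :=
      SpinChain.exists_depart_eq (𝕜 := 𝕜) (N := N) (by omega) ho he
    obtain ⟨G, c, hc0, kc, ki, kq⟩ := SpinChain.exists_kurtosis_eq (𝕜 := 𝕜) hN hd ho he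
    have hlt := SpinChain.couplingIso_lt_couplingClassical 𝕜 hN hd
    have hT : SpinChain.couplingClassical 𝕜 N d - SpinChain.couplingIso 𝕜 N d ≠ 0 := by
      linarith
    have hD : SpinChain.departIso 𝕜 N νo νe < SpinChain.departClassical 𝕜 N νo νe := by
      rw [hc, hi]
      nlinarith
    have hK : SpinChain.kurtosisIso 𝕜 N νo νe < SpinChain.kurtosisClassical 𝕜 N νo νe := by
      rw [kc, ki]
      nlinarith
    have hp : SpinChain.interpolation 𝕜 N νo νe = SpinChain.universalP 𝕜 N d := by
      have e1 : SpinChain.kurtosisQuantum 𝕜 N νo νe - SpinChain.kurtosisIso 𝕜 N νo νe =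
          c * δ * (SpinChain.couplingQuantum 𝕜 N d - SpinChain.couplingIso 𝕜 N d) := by
        rw [kq, ki, hq, hi]
        ring
      have e2 : SpinChain.kurtosisClassical 𝕜 N νo νe - SpinChain.kurtosisIso 𝕜 N νo νe =
          c * δ * (SpinChain.couplingClassical 𝕜 N d - SpinChain.couplingIso 𝕜 N d) := by
        rw [kc, ki, hc, hi]
        ring
      rw [SpinChain.interpolation, e1, e2, mul_div_mul_left _ _ (mul_pos hc0 hδ).ne',
        SpinChain.universalP]
      field_simp
      ring
    refine ⟨hK.ne', hp, hD.ne', ?_⟩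
    have e3 : SpinChain.departClassical 𝕜 N νo νe - SpinChain.departQuantum 𝕜 N νo νe =
        δ * (SpinChain.couplingClassical 𝕜 N d - SpinChain.couplingQuantum 𝕜 N d) := by
      rw [hc, hq]
      ring
    have e4 : SpinChain.departClassical 𝕜 N νo νe - SpinChain.departIso 𝕜 N νo νe =
        δ * (SpinChain.couplingClassical 𝕜 N d - SpinChain.couplingIso 𝕜 N d) := by
      rw [hc, hi]
      ring
    rw [hp, e3, e4, mul_div_mul_left _ _ hδ.ne', SpinChain.universalP, sub_sub_cancel]
  · rintro k n m rfl hn hm i j a b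
    exact SpinChain.one_sub_universalP_eq hN hd hn hm i j a b
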